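/- Let $0<\beta\le 2$, $\sigma>0$, $\theta\neq 0$, $\lambda>0$. Let $W$ be a standard symmetric stable process of index $\beta$, normalised by $\mathbb{E}(e^{iuW_t})=e^{-t|u|^\beta/2}$, and let $Y$ be a compound Poisson process, independent of $W$, with arrival rate $\lambda$ and law of jumps $\mu$. Suppose that $\mu$ has a differentiable density $f$ with $$\lim_{|u|\to\infty}uf(u)=0,\qquad \sup_u|f'(u)|(1+|u|)<\infty,\qquad \mathcal L:=\int\frac{(uf'(u)+f(u))^2}{f(u)}\,du<\infty$$ (the integrand being $0$ where $f=0$). Let $h_\beta$ be the continuous density of $W_1$ and put $$\mathcal I(\beta)=\int\frac{(h_\beta(w)+wh_\beta'(w))^2}{h_\beta(w)}\,dw .$$ For $\Delta>0$ let $p_\Delta$ be the density of $X_\Delta=\sigma W_\Delta+\theta Y_\Delta$, that is, with $G_\Delta$ the law of $Y_\Delta$, $$p_\Delta(x)=\frac1{\sigma\Delta^{1/\beta}}\int h_\beta\Big(\frac{x-\theta y}{\sigma\Delta^{1/\beta}}\Big)\,G_\Delta(dy),$$ and let $$I^{\sigma\sigma}_\Delta=\int\frac{(\partial_\sigma p_\Delta)^2}{p_\Delta}\,dx,\qquad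 I^{\sigma\theta}_\Delta=\int\frac{\partial_\sigma p_\Delta\,\partial_\theta p_\Delta}{p_\Delta}\,dx,\qquad I^{\theta\theta}_\Delta=\int\frac{(\partial_\theta p_\Delta)^2}{p_\Delta}\,dx$$ be the entries of the $(\sigma,\theta)$ block of the Fisher information matrix for one observation of $X_\Delta$. For every $\Delta>0$ the function $p_\Delta$ is positive and has partial derivatives in $\sigma$ and $\theta$, and these three integrals, as well as $\mathcal I(\beta)$, converge. As $\Delta\downarrow0$, $$I^{\sigma\sigma}_\Delta\to\frac1{\sigma^2}\,\mathcal I(\beta),\qquad \frac1{\sqrt\Delta}\,I^{\sigma\theta}_\Delta\to0 .$$ If $\beta<2$, then $$\frac{\lambda^2}{\theta^2}\int\frac{(xf'(x)+f(x))^2}{\lambda f(x)+\dfrac{c_\beta\,\sigma^\beta}{|\theta|^\beta|x|^{1+\beta}}}\,dx\;\le\;\liminf_{\Delta\downarrow0}\frac1\Delta I^{\theta\theta}_\Delta\;\le\;\limsup_{\Delta\downarrow0}\frac1\Delta I^{\theta\theta}_\Delta\;\le\;\frac{\lambda}{\theta^2}\,\mathcal L ,$$ where $c_\beta=\dfrac{\beta(1-\beta)}{4\,\Gamma(2-\beta)\cos(\beta\pi/2)}$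 if $\beta\ne1$ and $c_1=\dfrac1{2\pi}$. If $\beta=2$, then $$\frac1\Delta I^{\theta\theta}_\Delta\to\frac{\lambda}{\theta^2}\,\mathcal L .$$ -/

import Mathlib

open MeasureTheory ProbabilityTheory Filter Topology
open scoped NNReal

noncomputable section

namespace LevyFisher

/-- A real-valued Lévy process: it starts at `0`, has independent and stationary increments, and
is continuous in probability. -/
structure IsLevyProcess {Ω : Type*} [MeasurableSpace Ω] (P : Measure Ω) (X : ℝ≥0 → Ω → ℝ) :
    Prop where
  measurable : ∀ t, Measurable (X t)
  zero : ∀ᵐ ω ∂P, X 0 ω = 0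
  indep_increments : HasIndepIncrements X P
  stationary : ∀ s t, P.map (fun ω => X (s + t) ω - X s ω) = P.map (X t)
  continuous : ∀ t, TendstoInMeasure P X (𝓝 t) (X t)

/-- The standard symmetric stable process of index `β`, normalised by
`𝔼 exp (i u W_t) = exp (- t |u| ^ β / 2)`. -/
structure IsStdStableProcess {Ω : Type*} [MeasurableSpace Ω] (P : Measure Ω) (β : ℝ)
    (W : ℝ≥0 → Ω → ℝ) : Prop extends IsLevyProcess P W where
  charFun_eq : ∀ (t : ℝ≥0) (u : ℝ),
    charFun (P.map (W t)) u = Complex.exp ((-((t : ℝ) * |u| ^ β / 2) : ℝ) : ℂ)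

/-- The Lévy-Khintchine exponent with characteristic triple `(b, c, F)` and truncation
function `x ↦ x 1_{|x| ≤ 1}`. -/
def levyExponent (b c : ℝ) (F : Measure ℝ) (v : ℝ) : ℂ :=
  Complex.I * v * b - c * v ^ 2 / 2
    + ∫ x, (Complex.exp (Complex.I * v * x) - 1
        - Set.indicator {y : ℝ | |y| ≤ 1} (fun y : ℝ => Complex.I * v * y) x) ∂F

/-- The compound Poisson process with arrival rate `lam` and law of jumps `μ`: the Lévy process
with triple `b = lam ∫_{|x| ≤ 1} x μ(dx)`, `c = 0`, `F = lam μ`. -/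
structure IsCompoundPoisson {Ω : Type*} [MeasurableSpace Ω] (P : Measure Ω) (lam : ℝ)
    (μ : Measure ℝ) (Y : ℝ≥0 → Ω → ℝ) : Prop extends IsLevyProcess P Y where
  charFun_eq : ∀ (t : ℝ≥0) (u : ℝ),
    charFun (P.map (Y t)) u =
      Complex.exp ((t : ℝ) *
        levyExponent (lam * ∫ x in {y : ℝ | |y| ≤ 1}, x ∂μ) 0 (ENNReal.ofReal lam • μ) u)

/-- The (continuous) density `h_β` of `W_1`, by Fourier inversion of `exp (- |u| ^ β / 2)`. -/
def stableDensity (β w : ℝ) : ℝ :=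
  (2 * Real.pi)⁻¹ * ∫ u : ℝ, Real.cos (u * w) * Real.exp (-(|u| ^ β / 2))

/-- The integrand `(h_β(w) + w h_β'(w))² / h_β(w)` of `𝓘(β)`. -/
def scaleIntegrand (β w : ℝ) : ℝ :=
  (stableDensity β w + w * deriv (stableDensity β) w) ^ 2 / stableDensity β w

/-- `𝓘(β)`, the Fisher information at `σ = 1` for the observation of `σ W_1`. -/
def scaleInfo (β : ℝ) : ℝ := ∫ w, scaleIntegrand β w

/-- The constant `c_β` in the tail `h_β(w) ~ c_β / |w| ^ (1 + β)`, for `0 < β < 2`. -/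
def tailConst (β : ℝ) : ℝ :=
  if β = 1 then 1 / (2 * Real.pi)
  else β * (1 - β) / (4 * Real.Gamma (2 - β) * Real.cos (β * Real.pi / 2))

/-- The density at `x` of `X_Δ = σ W_Δ + θ Y_Δ`, where `G` is the law of `Y_Δ`: the convolution of
the law of `θ Y_Δ` with the density of `σ W_Δ`, which is that of `σ Δ^{1/β} W_1`. -/
def density (β : ℝ) (Δ : ℝ≥0) (G : Measure ℝ) (σ θ x : ℝ) : ℝ :=
  1 / (σ * (Δ : ℝ) ^ (1 / β)) *
    ∫ y, stableDensity β ((x - θ * y) / (σ * (Δ : ℝ) ^ (1 / β))) ∂G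

/-- `∂_σ p_Δ(x)`. -/
def dSigma (β : ℝ) (Δ : ℝ≥0) (G : Measure ℝ) (σ θ x : ℝ) : ℝ :=
  deriv (fun s => density β Δ G s θ x) σ

/-- `∂_θ p_Δ(x)`. -/
def dTheta (β : ℝ) (Δ : ℝ≥0) (G : Measure ℝ) (σ θ x : ℝ) : ℝ :=
  deriv (fun r => density β Δ G σ r x) θ

/-- The entry `I_Δ^{σσ}` of the Fisher information matrix of one observation of `X_Δ`. -/
def infoSS (β : ℝ) (Δ : ℝ≥0) (G : Measure ℝ) (σ θ : ℝ) : ℝ :=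
  ∫ x, dSigma β Δ G σ θ x ^ 2 / density β Δ G σ θ x

/-- The entry `I_Δ^{σθ}`. -/
def infoST (β : ℝ) (Δ : ℝ≥0) (G : Measure ℝ) (σ θ : ℝ) : ℝ :=
  ∫ x, dSigma β Δ G σ θ x * dTheta β Δ G σ θ x / density β Δ G σ θ x

/-- The entry `I_Δ^{θθ}`. -/
def infoTT (β : ℝ) (Δ : ℝ≥0) (G : Measure ℝ) (σ θ : ℝ) : ℝ :=
  ∫ x, dTheta β Δ G σ θ x ^ 2 / density β Δ G σ θ x

/-- The model with density `density β Δ G` is regular at `(σ, θ)`: the density is positive and has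
partial derivatives in `σ` and `θ`, and the integrals that define the `(σ, θ)` block of the Fisher
information matrix converge. -/
structure HasFisherInfo (β : ℝ) (Δ : ℝ≥0) (G : Measure ℝ) (σ θ : ℝ) : Prop where
  pos : ∀ x, 0 < density β Δ G σ θ x
  diff_sigma : ∀ x, DifferentiableAt ℝ (fun s => density β Δ G s θ x) σ
  diff_theta : ∀ x, DifferentiableAt ℝ (fun r => density β Δ G σ r x) θ
  integrable_SS : Integrable (fun x => dSigma β Δ G σ θ x ^ 2 / density β Δ G σ θ x)
  integrable_ST :
    Integrable (fun x => dSigma β Δ G σ θ x * dTheta β Δ G σ θ x / density β Δ G σ θ x)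
  integrable_TT : Integrable (fun x => dTheta β Δ G σ θ x ^ 2 / density β Δ G σ θ x)

/-- The integrand `(u f'(u) + f(u))² / f(u)` of the multiplicative Fisher information; it is `0`
where `f` vanishes. -/
def multIntegrand (f : ℝ → ℝ) (u : ℝ) : ℝ := (u * deriv f u + f u) ^ 2 / f u

/-- The multiplicative Fisher information `𝓛` of the law with density `f`. -/
def multInfo (f : ℝ → ℝ) : ℝ := ∫ u, multIntegrand f u

/-- The integrand of the lower bound for `β < 2`. -/
def lowerIntegrand (β σ θ lam : ℝ) (f : ℝ → ℝ) (x : ℝ) : ℝ :=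
  (x * deriv f x + f x) ^ 2 /
    (lam * f x + tailConst β * σ ^ β / (|θ| ^ β * |x| ^ (1 + β)))

end LevyFisher

end

/-!
Write `s = σ Δ ^ {1/β}` for the scale of the stable part, `L = λ Δ` for the mean number of jumps and
`k(u) = u f'(u) + f(u) = (u f(u))'`. The law of `Y_Δ` is the Poisson mixture of the convolution
powers of the jump law (`IsCompoundPoisson.map_eq`), so that the density `p` of the observation is a
mixture of smooth densities (`mixDensity`). Its two scores are again convolutions:
`- σ ∂_σ p` is the convolution of the law of `θ Y_Δ` with the rescaled function `h_β + w h_β'`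
(`scoreMix`), and `- θ ∂_θ p` is `L` times the convolution of `p` with `k` on the scale `θ`
(`jumpScoreMix`). The latter is read off from the characteristic function
`exp (L (φ(θ u) - 1))` of the jumps: an integration by parts, in which `u f(u) → 0` removes the
boundary terms, shows that `r ∂_r φ(r u)` is minus the Fourier transform of `k`, without any moment
of `f` (`IsJumpDensity.hasDerivAt_fourier`).

Upper bounds come from Cauchy-Schwarz under the mixture. Conditionally on the jumps the observation
is a translate of `s W_1`, whence `I^{σσ} ≤ 𝓘(β) / σ²` (`lintegral_scoreMix_sq_div_le`). Conditionally
on the number `N` of jumps the score of `θ` is a sum of `N` terms, whence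
`θ² I^{θθ} ≤ 𝔼 (N²) 𝓛 = (L + L²) 𝓛` (`IsJumpDensity.lintegral_jumpScoreMix_sq_div_le`).

Lower bounds come from Fatou's lemma. On the scale `s`, where no jump is seen, the density and the
score of `σ` converge to those of `W_1`, so that `I^{σσ}` converges and its mass sits at `|x| = O(s)`
(`tendsto_lintegral_scaleDensity`, `exists_eventually_setLIntegral_scaleDensity_le`). In that window
the information on `θ` is only `O(L²)`, and outside it the information on `σ` is small; a last
Cauchy-Schwarz inequality gives `I^{σθ} = o(√L)` (`eventually_abs_cross_le`). On the scale of the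
jumps, `p / L` is asymptotically at most the density of one jump `θ Y` plus the tail of the stable
density divided by `L`, since two or more jumps have probability `O(L²)`; and the convolution of `p`
with `k` converges to `k` in `L¹`, hence almost everywhere along subsequences. This bounds
`I^{θθ} / Δ` from below (`IsJumpDensity.eventually_lt_lintegral_jumpScoreMix`). For `β = 2` the tail
term is absent and the two bounds for `I^{θθ}` agree.

The input on the stable law is the tail `|w| ^ {1+β} h_β(w) → c_β` and the matching bounds for `h_β`
and `h_β'` (`tendsto_stableDensity_tail`, `exists_tail_bounds`), obtained by turning the ray of
integration in the inversion formula by the angle `π / 6`, and the positivity of `h_β`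
(`stableDensity_nonneg`, `stableDensity_pos`).
-/

noncomputable section

namespace LevyFisher

/-! ### The stable density and its derivative -/

/-- The characteristic function `exp (- |u| ^ β / 2)` of the standard stable law. -/
def stableChar (β u : ℝ) : ℝ := Real.exp (-(|u| ^ β / 2))

lemma stableChar_nonneg (β u : ℝ) : 0 ≤ stableChar β u := (Real.exp_pos _).le

lemma continuous_stableChar {β : ℝ} (hβ : 0 < β) : Continuous (stableChar β) := by
  unfold stableChar
  have : Continuous fun u : ℝ => |u| ^ β := continuous_abs.rpow_const fun _ => Or.inr hβ.le
  fun_prop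

lemma integrable_of_even {F : ℝ → ℝ} (hF : ∀ u, F (-u) = F u)
    (hi : IntegrableOn F (Set.Ioi 0)) : Integrable F := by
  have h2 : IntegrableOn F (Set.Iic 0) := by
    have := integrableOn_Iic_iff_integrableOn_Iio (μ := volume) (f := F) (b := 0)
    rw [this]
    have h3 := (Measure.measurePreserving_neg (volume : Measure ℝ)).integrableOn_comp_preimage
      (Homeomorph.neg ℝ).measurableEmbedding (f := F) (s := Set.Ioi 0)
    have : F ∘ Neg.neg = F := funext hF
    rw [this] at h3
    simpa using h3.2 hi
  rw [← integrableOn_univ, ← Set.Iic_union_Ioi (a := (0 : ℝ))]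
  exact h2.union hi

lemma integrable_rpow_mul_stableChar {β q : ℝ} (hβ : 0 < β) (hq : -1 < q) :
    Integrable fun u : ℝ => |u| ^ q * stableChar β u := by
  apply integrable_of_even
  · intro u; simp [stableChar]
  · refine (integrableOn_rpow_mul_exp_neg_mul_rpow hq hβ (b := 1 / 2) (by norm_num)).congr_fun
      (fun x hx => ?_) measurableSet_Ioi
    have : |x| = x := abs_of_pos hx
    simp only [stableChar, this]
    congr 2; ring

lemma integrable_stableChar {β : ℝ} (hβ : 0 < β) : Integrable (stableChar β) := by
  simpa using integrable_rpow_mul_stableChar (q := 0) hβ (by norm_num)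

lemma integrable_abs_mul_stableChar {β : ℝ} (hβ : 0 < β) :
    Integrable fun u : ℝ => |u| * stableChar β u := by
  simpa using integrable_rpow_mul_stableChar (q := 1) hβ (by norm_num)

lemma stableDensity_eq (β w : ℝ) :
    stableDensity β w = (2 * Real.pi)⁻¹ * ∫ u : ℝ, Real.cos (u * w) * stableChar β u := rfl

lemma stableDensity_neg (β w : ℝ) : stableDensity β (-w) = stableDensity β w := by
  simp [stableDensity]

lemma stableDensity_abs (β w : ℝ) : stableDensity β |w| = stableDensity β w := by
  rcases abs_choice w with h | h <;> rw [h]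
  exact stableDensity_neg β w

lemma hasDerivAt_stableDensity {β : ℝ} (hβ : 0 < β) (w : ℝ) :
    HasDerivAt (stableDensity β)
      (-((2 * Real.pi)⁻¹ * ∫ u : ℝ, u * Real.sin (u * w) * stableChar β u)) w := by
  have hc := continuous_stableChar hβ
  have key := hasDerivAt_integral_of_dominated_loc_of_deriv_le (μ := volume)
    (F := fun w u => Real.cos (u * w) * stableChar β u)
    (F' := fun w u => -(u * Real.sin (u * w) * stableChar β u)) (x₀ := w) (s := Set.univ)
    (bound := fun u => |u| * stableChar β u) univ_mem
    (Eventually.of_forall fun x => by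
      apply Continuous.aestronglyMeasurable; fun_prop)
    (by
      refine (integrable_stableChar hβ).bdd_mul (c := 1) (by
        apply Continuous.aestronglyMeasurable; fun_prop)
        (Eventually.of_forall fun u => by simpa using Real.abs_cos_le_one _))
    (by apply Continuous.aestronglyMeasurable; fun_prop)
    (Eventually.of_forall fun u x _ => by
      rw [norm_neg, norm_mul, norm_mul, Real.norm_eq_abs, Real.norm_eq_abs, Real.norm_eq_abs,
        abs_of_nonneg (stableChar_nonneg β u)]
      gcongr
      · exact stableChar_nonneg β u
      · exact mul_le_of_le_one_right (abs_nonneg _) (Real.abs_sin_le_one _))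
    (integrable_abs_mul_stableChar hβ)
    (Eventually.of_forall fun u x _ => by
      have h1 : HasDerivAt (fun x => u * x) u x := by
        simpa using (hasDerivAt_id x).const_mul u
      have := (h1.cos).mul_const (stableChar β u)
      convert! this using 1; ring)
  have h2 := key.2.const_mul (2 * Real.pi)⁻¹
  rw [integral_neg] at h2
  rw [mul_neg] at h2
  exact h2

lemma continuous_stableDensity {β : ℝ} (hβ : 0 < β) : Continuous (stableDensity β) :=
  continuous_iff_continuousAt.2 fun w => (hasDerivAt_stableDensity hβ w).continuousAt

lemma differentiable_stableDensity {β : ℝ} (hβ : 0 < β) : Differentiable ℝ (stableDensity β) :=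
  fun w => (hasDerivAt_stableDensity hβ w).differentiableAt

lemma exists_bound_stableDensity {β : ℝ} (hβ : 0 < β) :
    ∃ B : ℝ, 0 ≤ B ∧ (∀ w, |stableDensity β w| ≤ B) ∧ ∀ w, |deriv (stableDensity β) w| ≤ B := by
  refine ⟨(2 * Real.pi)⁻¹ * (∫ u, stableChar β u) +
    (2 * Real.pi)⁻¹ * ∫ u : ℝ, |u| * stableChar β u, ?_, ?_, ?_⟩
  · have h1 : 0 ≤ ∫ u, stableChar β u := integral_nonneg fun u => stableChar_nonneg β u
    have h2 : 0 ≤ ∫ u : ℝ, |u| * stableChar β u :=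
      integral_nonneg fun u => mul_nonneg (abs_nonneg u) (stableChar_nonneg β u)
    positivity
  · intro w
    have h2 : 0 ≤ ∫ u : ℝ, |u| * stableChar β u :=
      integral_nonneg fun u => mul_nonneg (abs_nonneg u) (stableChar_nonneg β u)
    rw [stableDensity_eq, abs_mul, abs_of_pos (by positivity : 0 < (2 * Real.pi)⁻¹)]
    have : |∫ u : ℝ, Real.cos (u * w) * stableChar β u| ≤ ∫ u, stableChar β u := by
      rw [← Real.norm_eq_abs]
      refine norm_integral_le_of_norm_le (integrable_stableChar hβ)
        (Eventually.of_forall fun u => ?_)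
      rw [norm_mul, Real.norm_eq_abs, Real.norm_eq_abs, abs_of_nonneg (stableChar_nonneg β u)]
      exact mul_le_of_le_one_left (stableChar_nonneg β u) (Real.abs_cos_le_one _)
    have h3 : 0 ≤ (2 * Real.pi)⁻¹ * ∫ u : ℝ, |u| * stableChar β u := by positivity
    have h4 := mul_le_mul_of_nonneg_left this (by positivity : 0 ≤ (2 * Real.pi)⁻¹)
    linarith
  · intro w
    have h1 : 0 ≤ ∫ u, stableChar β u := integral_nonneg fun u => stableChar_nonneg β u
    rw [(hasDerivAt_stableDensity hβ w).deriv, abs_neg, abs_mul,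
      abs_of_pos (by positivity : 0 < (2 * Real.pi)⁻¹)]
    have : |∫ u : ℝ, u * Real.sin (u * w) * stableChar β u| ≤ ∫ u, |u| * stableChar β u := by
      rw [← Real.norm_eq_abs]
      refine norm_integral_le_of_norm_le (integrable_abs_mul_stableChar hβ)
        (Eventually.of_forall fun u => ?_)
      rw [norm_mul, norm_mul, Real.norm_eq_abs, Real.norm_eq_abs, Real.norm_eq_abs,
        abs_of_nonneg (stableChar_nonneg β u)]
      gcongr
      · exact stableChar_nonneg β u
      · exact mul_le_of_le_one_right (abs_nonneg _) (Real.abs_sin_le_one _)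
    have h3 : 0 ≤ (2 * Real.pi)⁻¹ * ∫ u, stableChar β u := by positivity
    have h4 := mul_le_mul_of_nonneg_left this (by positivity : 0 ≤ (2 * Real.pi)⁻¹)
    linarith

/-! ### Contour rotation and the tails of the stable density -/

/-- Rotation of the ray of integration. If `F φ t` stands for `G (t e ^ {i φ}) e ^ {i φ}` with `G`
holomorphic, then `∂_φ F = i ∂_t (t F)`, and the integral of the right-hand side over the ray
vanishes. -/
lemma integral_ray_eq {F D : ℝ → ℝ → ℂ} {α γ : ℝ} (hαγ : α < γ) {b₁ b₂ : ℝ → ℝ}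
    (hFm : ∀ φ, AEStronglyMeasurable (F φ) (volume.restrict (Set.Ioi 0)))
    (hDm : ∀ φ, AEStronglyMeasurable (D φ) (volume.restrict (Set.Ioi 0)))
    (hφ : ∀ φ t, HasDerivAt (fun φ => F φ t) (Complex.I * D φ t) φ)
    (ht : ∀ φ, ∀ t > 0, HasDerivAt (fun t : ℝ => (t : ℂ) * F φ t) (D φ t) t)
    (hF : ∀ φ ∈ Set.Icc α γ, ∀ t > 0, ‖F φ t‖ ≤ b₁ t)
    (hD : ∀ φ ∈ Set.Icc α γ, ∀ t > 0, ‖D φ t‖ ≤ b₂ t)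
    (hb₁ : IntegrableOn b₁ (Set.Ioi 0)) (hb₂ : IntegrableOn b₂ (Set.Ioi 0))
    (htb₁ : IntegrableOn (fun t => t * b₁ t) (Set.Ioi 0))
    (hlim : Tendsto (fun t => t * b₁ t) (𝓝[>] 0) (𝓝 0)) :
    ∫ t in Set.Ioi 0, F α t = ∫ t in Set.Ioi 0, F γ t := by
  have hint : ∀ φ ∈ Set.Icc α γ, IntegrableOn (F φ) (Set.Ioi 0) := fun φ hφ' =>
    hb₁.mono' (hFm φ) ((ae_restrict_iff' measurableSet_Ioi).2 (ae_of_all _ (hF φ hφ')))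
  have hDint : ∀ φ ∈ Set.Icc α γ, IntegrableOn (D φ) (Set.Ioi 0) := fun φ hφ' =>
    hb₂.mono' (hDm φ) ((ae_restrict_iff' measurableSet_Ioi).2 (ae_of_all _ (hD φ hφ')))
  have hnt : ∀ φ ∈ Set.Icc α γ, ∀ t : ℝ, 0 < t → ‖(t : ℂ) * F φ t‖ ≤ t * b₁ t := by
    intro φ hφ' t ht'
    rw [norm_mul, Complex.norm_real, Real.norm_of_nonneg ht'.le]
    exact mul_le_mul_of_nonneg_left (hF φ hφ' t ht') (le_of_lt ht')
  -- `t F` vanishes at both ends of the ray: at `0` by `hlim`, at infinity by integrability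
  have hD0 : ∀ φ ∈ Set.Icc α γ, ∫ t in Set.Ioi 0, D φ t = 0 := by
    intro φ hφ'
    have htF : IntegrableOn (fun t : ℝ => (t : ℂ) * F φ t) (Set.Ioi 0) :=
      htb₁.mono' (Complex.continuous_ofReal.aestronglyMeasurable.mul (hFm φ))
        ((ae_restrict_iff' measurableSet_Ioi).2 (ae_of_all _ (hnt φ hφ')))
    have hinf := tendsto_zero_of_hasDerivAt_of_integrableOn_Ioi (a := 0)
      (fun t ht' => ht φ t ht') (hDint φ hφ') htF
    have h0 : ContinuousWithinAt (fun t : ℝ => (t : ℂ) * F φ t) (Set.Ici 0) 0 := by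
      rw [← continuousWithinAt_Ioi_iff_Ici]
      have : Tendsto (fun t : ℝ => (t : ℂ) * F φ t) (𝓝[>] 0) (𝓝 0) :=
        squeeze_zero_norm' (eventually_nhdsWithin_of_forall fun t ht' => hnt φ hφ' t ht') hlim
      simpa [ContinuousWithinAt] using this
    have := integral_Ioi_of_hasDerivAt_of_tendsto h0 (fun t ht' => ht φ t ht') (hDint φ hφ') hinf
    simpa using this
  have hcont : ContinuousOn (fun φ => ∫ t in Set.Ioi 0, F φ t) (Set.Icc α γ) := by
    refine continuousOn_of_dominated (bound := b₁) (fun φ _ => hFm φ) (fun φ hφ' =>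
      (ae_restrict_iff' measurableSet_Ioi).2 (ae_of_all _ (hF φ hφ'))) hb₁
      (ae_of_all _ fun t φ _ => (hφ φ t).continuousAt.continuousWithinAt)
  have hder : ∀ φ ∈ Set.Ioo α γ, HasDerivAt (fun φ => ∫ t in Set.Ioi 0, F φ t) 0 φ := by
    intro φ hφ'
    have key := hasDerivAt_integral_of_dominated_loc_of_deriv_le
      (μ := volume.restrict (Set.Ioi 0)) (F := F) (F' := fun φ t => Complex.I * D φ t)
      (x₀ := φ) (s := Set.Ioo α γ) (bound := b₂) (isOpen_Ioo.mem_nhds hφ')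
      (Eventually.of_forall hFm) (hint φ (Set.Ioo_subset_Icc_self hφ'))
      ((hDm φ).const_mul Complex.I)
      ((ae_restrict_iff' measurableSet_Ioi).2 (ae_of_all _ fun t ht' ψ hψ => by
        rw [norm_mul, Complex.norm_I, one_mul]
        exact hD ψ (Set.Ioo_subset_Icc_self hψ) t ht'))
      hb₂ (ae_of_all _ fun t ψ _ => hφ ψ t)
    have h2 := key.2
    rw [integral_const_mul, hD0 φ (Set.Ioo_subset_Icc_self hφ'), mul_zero] at h2
    exact h2
  have hconst : ∀ ε ∈ Set.Ioo α γ,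
      ∫ t in Set.Ioi 0, F γ t = ∫ t in Set.Ioi 0, F ε t := by
    intro ε hε
    refine constant_of_has_deriv_right_zero (f := fun φ => ∫ t in Set.Ioi 0, F φ t)
      (hcont.mono (Set.Icc_subset_Icc_left hε.1.le)) (fun φ hφ' => ?_) γ
      (Set.right_mem_Icc.2 hε.2.le)
    exact (hder φ ⟨hε.1.trans_le hφ'.1, hφ'.2⟩).hasDerivWithinAt
  have hlim2 : Tendsto (fun φ => ∫ t in Set.Ioi 0, F φ t) (𝓝[>] α)
      (𝓝 (∫ t in Set.Ioi 0, F α t)) :=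
    (hcont α (Set.left_mem_Icc.2 hαγ.le)).mono_left
      (nhdsWithin_le_of_mem (Icc_mem_nhdsGT hαγ))
  refine tendsto_nhds_unique hlim2 (tendsto_const_nhds.congr' ?_)
  filter_upwards [Ioo_mem_nhdsGT hαγ] with ε hε using hconst ε hε

lemma exp_I_mul (x : ℝ) :
    Complex.exp (Complex.I * x) = Real.cos x + Real.sin x * Complex.I := by
  rw [mul_comm, Complex.exp_mul_I]; push_cast; rfl

lemma norm_exp_I_mul (x : ℝ) : ‖Complex.exp (Complex.I * x)‖ = 1 := by
  rw [mul_comm]; exact Complex.norm_exp_ofReal_mul_I x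

/-- The integrand of `∫ exp (i w z - z ^ β / 2) dz` along the ray of angle `φ`, parametrised by
the modulus `t` of `z`. -/
def rayIntegrand (β w φ t : ℝ) : ℂ :=
  Complex.exp (Complex.I * w * t * Complex.exp (Complex.I * φ)
    - (t ^ β : ℝ) * Complex.exp (Complex.I * (β * φ : ℝ)) / 2 + Complex.I * φ)

lemma norm_rayIntegrand (β w φ t : ℝ) :
    ‖rayIntegrand β w φ t‖ =
      Real.exp (-(w * t * Real.sin φ) - t ^ β * Real.cos (β * φ) / 2) := by
  rw [rayIntegrand, Complex.norm_exp]
  congr 1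
  rw [exp_I_mul, exp_I_mul]
  simp only [Complex.add_re, Complex.sub_re, Complex.mul_re, Complex.mul_im, Complex.I_re,
    Complex.I_im, Complex.ofReal_re, Complex.ofReal_im, Complex.div_ofNat_re, Complex.add_im]
  ring

lemma half_le_cos {β φ : ℝ} (hβ : 0 < β) (hβ2 : β ≤ 2) (hφ : φ ∈ Set.Icc 0 (Real.pi / 6)) :
    1 / 2 ≤ Real.cos (β * φ) := by
  rw [← Real.cos_pi_div_three]
  apply Real.cos_le_cos_of_nonneg_of_le_pi
  · exact mul_nonneg hβ.le hφ.1
  · linarith [Real.pi_pos]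
  · nlinarith [hφ.1, hφ.2]

lemma norm_rayIntegrand_le {β : ℝ} (hβ : 0 < β) (hβ2 : β ≤ 2) {w φ t : ℝ} (hw : 0 ≤ w)
    (hφ : φ ∈ Set.Icc 0 (Real.pi / 6)) (ht : 0 < t) :
    ‖rayIntegrand β w φ t‖ ≤ Real.exp (-(1 / 4) * t ^ β) := by
  rw [norm_rayIntegrand, Real.exp_le_exp]
  have h1 : 0 ≤ Real.sin φ :=
    Real.sin_nonneg_of_nonneg_of_le_pi hφ.1 (by linarith [hφ.2, Real.pi_pos])
  have h2 := half_le_cos hβ hβ2 hφ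
  have h3 : 0 < t ^ β := Real.rpow_pos_of_pos ht β
  have h4 : 0 ≤ w * t * Real.sin φ := by positivity
  nlinarith

/-- The factor by which `-i ∂_φ` multiplies `rayIntegrand`. -/
def rayFactor (β w φ t : ℝ) : ℂ :=
  1 + Complex.I * w * t * Complex.exp (Complex.I * φ)
    - β * (t ^ β : ℝ) * Complex.exp (Complex.I * (β * φ : ℝ)) / 2

lemma norm_rayFactor_le {β w φ t : ℝ} (hβ : 0 < β) (hw : 0 ≤ w) (ht : 0 < t) :
    ‖rayFactor β w φ t‖ ≤ 1 + w * t + β * t ^ β / 2 := by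
  have h3 : 0 < t ^ β := Real.rpow_pos_of_pos ht β
  refine (norm_sub_le _ _).trans (add_le_add ((norm_add_le _ _).trans ?_) ?_)
  · rw [norm_mul, norm_exp_I_mul]
    simp [abs_of_nonneg hw, abs_of_pos ht]
  · rw [norm_div, norm_mul, norm_exp_I_mul]
    simp [abs_of_pos h3, abs_of_pos hβ]

lemma hasDerivAt_rayIntegrand_angle (β w φ t : ℝ) :
    HasDerivAt (fun φ : ℝ => rayIntegrand β w φ t)
      (Complex.I * (rayFactor β w φ t * rayIntegrand β w φ t)) φ := by
  unfold rayIntegrand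
  have h0 : HasDerivAt (fun φ : ℝ => (φ : ℂ)) 1 φ := Complex.ofRealCLM.hasDerivAt
  have h1 : HasDerivAt (fun φ : ℝ => Complex.I * (φ : ℂ)) Complex.I φ := by
    simpa using h0.const_mul Complex.I
  have h2 : HasDerivAt (fun φ : ℝ => Complex.I * ((β * φ : ℝ) : ℂ)) (Complex.I * β) φ := by
    simpa using (h0.const_mul (β : ℂ)).const_mul Complex.I
  have h3 := (((h1.cexp.const_mul (Complex.I * w * t)).sub
    ((h2.cexp.const_mul (((t ^ β : ℝ) : ℂ))).div_const 2)).add h1).cexp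
  refine h3.congr_deriv ?_
  simp only [rayFactor, Pi.add_apply, Pi.sub_apply]
  ring_nf

lemma hasDerivAt_rayIntegrand_modulus (β w φ : ℝ) {t : ℝ} (ht : 0 < t) :
    HasDerivAt (fun t : ℝ => (t : ℂ) * rayIntegrand β w φ t)
      (rayFactor β w φ t * rayIntegrand β w φ t) t := by
  unfold rayIntegrand
  have h0 : HasDerivAt (fun t : ℝ => (t : ℂ)) 1 t := Complex.ofRealCLM.hasDerivAt
  have h1 : HasDerivAt (fun t : ℝ => ((t ^ β : ℝ) : ℂ)) ((β * t ^ (β - 1) : ℝ) : ℂ) t :=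
    (Real.hasDerivAt_rpow_const (Or.inl ht.ne')).ofReal_comp
  have h2 := h0.mul (((((h0.const_mul (Complex.I * w)).mul_const
    (Complex.exp (Complex.I * φ))).sub ((h1.mul_const
    (Complex.exp (Complex.I * (β * φ : ℝ)))).div_const 2)).add_const (Complex.I * φ)).cexp)
  refine h2.congr_deriv ?_
  have h3 : ((t ^ β : ℝ) : ℂ) = t * ((t ^ (β - 1) : ℝ) : ℂ) := by
    rw [← Complex.ofReal_mul, Real.rpow_sub_one ht.ne', mul_div_cancel₀ _ ht.ne']
  simp only [rayFactor, Pi.sub_apply, h3]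
  push_cast
  ring_nf

lemma measurable_rayIntegrand (β w φ : ℝ) : Measurable (rayIntegrand β w φ) := by
  unfold rayIntegrand; fun_prop

lemma measurable_rayFactor (β w φ : ℝ) : Measurable (rayFactor β w φ) := by
  unfold rayFactor; fun_prop

/-- The ray of integration of the inversion formula may be turned by `π / 6`: since `β ≤ 2`, the
real part of `z ^ β` stays above `|z| ^ β / 2` in between. -/
lemma integral_rayIntegrand_eq {β : ℝ} (hβ : 0 < β) (hβ2 : β ≤ 2) {w : ℝ} (hw : 0 ≤ w) :
    ∫ t in Set.Ioi 0, rayIntegrand β w 0 t =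
      ∫ t in Set.Ioi 0, rayIntegrand β w (Real.pi / 6) t := by
  have hi : ∀ q : ℝ, -1 < q →
      IntegrableOn (fun t : ℝ => t ^ q * Real.exp (-(1 / 4) * t ^ β)) (Set.Ioi 0) := fun q hq =>
    integrableOn_rpow_mul_exp_neg_mul_rpow hq hβ (by norm_num)
  have h0 : IntegrableOn (fun t : ℝ => Real.exp (-(1 / 4) * t ^ β)) (Set.Ioi 0) := by
    simpa using hi 0 (by norm_num)
  have h1 : IntegrableOn (fun t : ℝ => t * Real.exp (-(1 / 4) * t ^ β)) (Set.Ioi 0) := by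
    simpa using hi 1 (by norm_num)
  refine integral_ray_eq (D := fun φ t => rayFactor β w φ t * rayIntegrand β w φ t)
    (b₁ := fun t => Real.exp (-(1 / 4) * t ^ β))
    (b₂ := fun t => (1 + w * t + β * t ^ β / 2) * Real.exp (-(1 / 4) * t ^ β))
    (by positivity)
    (fun φ => (measurable_rayIntegrand β w φ).aestronglyMeasurable)
    (fun φ => ((measurable_rayFactor β w φ).mul
      (measurable_rayIntegrand β w φ)).aestronglyMeasurable)
    (hasDerivAt_rayIntegrand_angle β w) (fun φ t ht => hasDerivAt_rayIntegrand_modulus β w φ ht)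
    (fun φ hφ t ht => norm_rayIntegrand_le hβ hβ2 hw hφ ht) (fun φ hφ t ht => ?_) h0 ?_ h1 ?_
  · rw [norm_mul]
    have := Real.rpow_pos_of_pos ht β
    exact mul_le_mul (norm_rayFactor_le hβ hw ht) (norm_rayIntegrand_le hβ hβ2 hw hφ ht)
      (norm_nonneg _) (by have := le_of_lt ht; positivity)
  · refine ((h0.add (h1.const_mul w)).add ((hi β (by linarith)).const_mul (β / 2))).congr_fun
      (fun t _ => ?_) measurableSet_Ioi
    simp only [Pi.add_apply]
    ring
  · have hc : Continuous fun t : ℝ => t * Real.exp (-(1 / 4) * t ^ β) := by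
      have : Continuous fun u : ℝ => u ^ β := continuous_id.rpow_const fun _ => Or.inr hβ.le
      fun_prop
    have := (hc.tendsto 0).mono_left (nhdsWithin_le_nhds (s := Set.Ioi 0))
    simpa using this

/-- Euler's integral along the ray of angle `π / 6`, evaluated by rotating the ray to the
imaginary axis. -/
lemma integral_gamma_ray {q : ℝ} (hq : 1 < q) :
    ∫ v : ℝ in Set.Ioi 0, Complex.exp (Complex.I * v * Complex.exp (Complex.I * (Real.pi / 6 : ℝ))
        + Complex.I * (q * (Real.pi / 6) : ℝ)) * ((v ^ (q - 1) : ℝ) : ℂ) =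
      Complex.exp (Complex.I * (q * (Real.pi / 2) : ℝ)) * Real.Gamma q := by
  have hi : ∀ r : ℝ, -1 < r →
      IntegrableOn (fun t : ℝ => t ^ r * Real.exp (-(1 / 2) * t)) (Set.Ioi 0) := fun r hr => by
    simpa using integrableOn_rpow_mul_exp_neg_mul_rpow (p := 1) (b := 1 / 2) hr one_pos
      (by norm_num)
  have hnorm : ∀ φ t : ℝ, 0 < t → ‖Complex.exp (Complex.I * t * Complex.exp (Complex.I * φ)
        + Complex.I * (q * φ : ℝ)) * ((t ^ (q - 1) : ℝ) : ℂ)‖ =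
        t ^ (q - 1) * Real.exp (-(t * Real.sin φ)) := by
    intro φ t ht
    rw [norm_mul, Complex.norm_real, Real.norm_of_nonneg (Real.rpow_pos_of_pos ht _).le,
      Complex.norm_exp, mul_comm, exp_I_mul]
    congr 2
    simp only [Complex.add_re, Complex.mul_re, Complex.mul_im, Complex.I_re,
      Complex.I_im, Complex.ofReal_re, Complex.ofReal_im, Complex.add_im]
    ring
  have hle : ∀ φ ∈ Set.Icc (Real.pi / 6) (Real.pi / 2), ∀ t : ℝ, 0 < t →
      ‖Complex.exp (Complex.I * t * Complex.exp (Complex.I * φ)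
        + Complex.I * (q * φ : ℝ)) * ((t ^ (q - 1) : ℝ) : ℂ)‖ ≤
        t ^ (q - 1) * Real.exp (-(1 / 2) * t) := by
    intro φ hφ t ht
    rw [hnorm φ t ht]
    have : 1 / 2 ≤ Real.sin φ := by
      rw [← Real.sin_pi_div_six]
      exact Real.sin_le_sin_of_le_of_le_pi_div_two (by linarith [Real.pi_pos]) hφ.2 hφ.1
    have h3 := Real.rpow_pos_of_pos ht (q - 1)
    gcongr
    nlinarith
  have key := integral_ray_eq (α := Real.pi / 6) (γ := Real.pi / 2)
    (F := fun φ t => Complex.exp (Complex.I * t * Complex.exp (Complex.I * φ)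
        + Complex.I * (q * φ : ℝ)) * ((t ^ (q - 1) : ℝ) : ℂ))
    (D := fun φ t => (q + Complex.I * t * Complex.exp (Complex.I * φ)) *
      (Complex.exp (Complex.I * t * Complex.exp (Complex.I * φ)
        + Complex.I * (q * φ : ℝ)) * ((t ^ (q - 1) : ℝ) : ℂ)))
    (b₁ := fun t => t ^ (q - 1) * Real.exp (-(1 / 2) * t))
    (b₂ := fun t => (q + t) * (t ^ (q - 1) * Real.exp (-(1 / 2) * t)))
    (by linarith [Real.pi_pos])
    (fun φ => by apply Measurable.aestronglyMeasurable; fun_prop)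
    (fun φ => by apply Measurable.aestronglyMeasurable; fun_prop)
    (fun φ t => by
      have h0 : HasDerivAt (fun φ : ℝ => (φ : ℂ)) 1 φ := Complex.ofRealCLM.hasDerivAt
      have h1 : HasDerivAt (fun φ : ℝ => Complex.I * (φ : ℂ)) Complex.I φ := by
        simpa using h0.const_mul Complex.I
      have h2 : HasDerivAt (fun φ : ℝ => Complex.I * ((q * φ : ℝ) : ℂ)) (Complex.I * q) φ := by
        simpa using (h0.const_mul (q : ℂ)).const_mul Complex.I
      have h3 := (((h1.cexp.const_mul (Complex.I * t)).add h2).cexp).mul_const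
        ((t ^ (q - 1) : ℝ) : ℂ)
      refine h3.congr_deriv ?_
      simp only [Pi.add_apply]
      ring_nf)
    (fun φ t ht => by
      have h0 : HasDerivAt (fun t : ℝ => (t : ℂ)) 1 t := Complex.ofRealCLM.hasDerivAt
      have h1 : HasDerivAt (fun t : ℝ => ((t ^ (q - 1) : ℝ) : ℂ))
          (((q - 1) * t ^ (q - 1 - 1) : ℝ) : ℂ) t :=
        (Real.hasDerivAt_rpow_const (Or.inl (ne_of_gt ht))).ofReal_comp
      have h2 := h0.mul (((((h0.const_mul Complex.I).mul_const
        (Complex.exp (Complex.I * φ))).add_const (Complex.I * (q * φ : ℝ))).cexp).mul h1)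
      refine h2.congr_deriv ?_
      have h3 : ((t ^ (q - 1) : ℝ) : ℂ) = t * ((t ^ (q - 1 - 1) : ℝ) : ℂ) := by
        rw [← Complex.ofReal_mul, Real.rpow_sub_one (ne_of_gt ht) (q - 1),
          mul_div_cancel₀ _ (ne_of_gt ht)]
      simp only [h3, Pi.mul_apply]
      push_cast
      ring_nf)
    hle
    (fun φ hφ t ht => by
      rw [norm_mul]
      refine mul_le_mul ((norm_add_le _ _).trans ?_) (hle φ hφ t ht) (norm_nonneg _)
        (add_nonneg (by linarith) (le_of_lt ht))
      rw [norm_mul, norm_exp_I_mul]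
      simp [abs_of_pos (show (0:ℝ) < t from ht), abs_of_pos (by linarith : 0 < q)])
    (hi _ (by linarith))
    (by
      refine IntegrableOn.congr_fun (((hi (q - 1) (by linarith)).const_mul q).add
        (hi q (by linarith))) (fun t ht => ?_) measurableSet_Ioi
      have : t ^ q = t * t ^ (q - 1) := by
        rw [Real.rpow_sub_one (ne_of_gt ht), mul_div_cancel₀ _ (ne_of_gt ht)]
      simp only [Pi.add_apply, this]
      ring)
    (by
      refine (hi q (by linarith)).congr_fun (fun t ht => ?_) measurableSet_Ioi
      have : t ^ q = t * t ^ (q - 1) := by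
        rw [Real.rpow_sub_one (ne_of_gt ht), mul_div_cancel₀ _ (ne_of_gt ht)]
      simp only [this]
      ring)
    (by
      have hc : Continuous fun t : ℝ => t * (t ^ (q - 1) * Real.exp (-(1 / 2) * t)) := by
        have : Continuous fun u : ℝ => u ^ (q - 1) :=
          continuous_id.rpow_const fun _ => Or.inr (by linarith)
        fun_prop
      have := (hc.tendsto 0).mono_left (nhdsWithin_le_nhds (s := Set.Ioi 0))
      simpa using this)
  rw [key]
  have e1 : Complex.exp (Complex.I * (Real.pi / 2 : ℝ)) = Complex.I := by
    rw [exp_I_mul]; simp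
  have e2 : ∀ v : ℝ, Complex.exp (Complex.I * v * Complex.exp (Complex.I * (Real.pi / 2 : ℝ))
        + Complex.I * (q * (Real.pi / 2) : ℝ)) * ((v ^ (q - 1) : ℝ) : ℂ) =
      Complex.exp (Complex.I * (q * (Real.pi / 2) : ℝ)) *
        ((v ^ (q - 1) * Real.exp (-(1 * v)) : ℝ) : ℂ) := by
    intro v
    rw [e1, Complex.exp_add]
    have : Complex.I * v * Complex.I = ((-(1 * v) : ℝ) : ℂ) := by
      push_cast
      linear_combination (v : ℂ) * Complex.I_mul_I
    rw [this, Complex.ofReal_mul (v ^ (q - 1)), Complex.ofReal_exp]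
    ring
  simp_rw [e2]
  rw [integral_const_mul, integral_complex_ofReal,
    Real.integral_rpow_mul_exp_neg_mul_Ioi (by linarith) one_pos]
  simp

lemma norm_exp_sub_one_le_of_re_nonpos {z : ℂ} (hz : z.re ≤ 0) : ‖Complex.exp z - 1‖ ≤ ‖z‖ := by
  have hs : Convex ℝ {z : ℂ | z.re ≤ 0} := convex_halfSpace_re_le 0
  have := hs.norm_image_sub_le_of_norm_hasDerivWithin_le (f := Complex.exp) (f' := Complex.exp)
    (C := 1) (x := 0) (y := z) (fun x _ => (Complex.hasDerivAt_exp x).hasDerivWithinAt)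
    (fun x hx => by rw [Complex.norm_exp]; exact Real.exp_le_one_iff.2 hx) (by simp) hz
  simpa using this

/-- The integrand of `∫ exp (i w z) (exp (- z ^ β / 2) - 1) dz` along the ray of angle `π / 6`. -/
def tailKernel (β w t : ℝ) : ℂ :=
  Complex.exp (Complex.I * w * t * Complex.exp (Complex.I * (Real.pi / 6 : ℝ))) *
    (Complex.exp (-((t ^ β : ℝ) * Complex.exp (Complex.I * (β * (Real.pi / 6) : ℝ)) / 2)) - 1) *
    Complex.exp (Complex.I * (Real.pi / 6 : ℝ))

lemma norm_exp_ray (w t : ℝ) :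
    ‖Complex.exp (Complex.I * w * t * Complex.exp (Complex.I * (Real.pi / 6 : ℝ)))‖ =
      Real.exp (-(w / 2 * t)) := by
  rw [Complex.norm_exp, exp_I_mul, Real.sin_pi_div_six]
  congr 1
  simp only [Complex.add_re, Complex.mul_re, Complex.mul_im, Complex.I_re,
    Complex.I_im, Complex.ofReal_re, Complex.ofReal_im, Complex.add_im]
  ring

lemma norm_tailKernel_le {β : ℝ} (hβ : 0 < β) (hβ2 : β ≤ 2) (w : ℝ) {t : ℝ} (ht : 0 < t) :
    ‖tailKernel β w t‖ ≤ t ^ β / 2 * Real.exp (-(w / 2 * t)) := by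
  have h3 := Real.rpow_pos_of_pos ht β
  rw [tailKernel, norm_mul, norm_mul, norm_exp_I_mul, mul_one, norm_exp_ray, mul_comm]
  refine mul_le_mul_of_nonneg_right ?_ (Real.exp_pos _).le
  have hc : 1 / 2 ≤ Real.cos (β * (Real.pi / 6)) :=
    half_le_cos hβ hβ2 ⟨by positivity, le_rfl⟩
  refine (norm_exp_sub_one_le_of_re_nonpos ?_).trans_eq ?_
  · rw [exp_I_mul]
    simp only [Complex.neg_re, Complex.add_re, Complex.mul_re, Complex.I_re,
      Complex.I_im, Complex.ofReal_re, Complex.ofReal_im, Complex.div_ofNat_re]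
    nlinarith
  · rw [norm_neg, norm_div, norm_mul, norm_exp_I_mul]
    simp [abs_of_pos h3]

lemma measurable_tailKernel (β w : ℝ) : Measurable (tailKernel β w) := by
  unfold tailKernel; fun_prop

lemma integrableOn_tailBound {q w : ℝ} (hq : -1 < q) (hw : 0 < w) :
    IntegrableOn (fun t : ℝ => t ^ q / 2 * Real.exp (-(w / 2 * t))) (Set.Ioi 0) := by
  have := (integrableOn_rpow_mul_exp_neg_mul_rpow (p := 1) (b := w / 2) hq one_pos
    (by positivity)).div_const 2
  refine IntegrableOn.congr_fun this (fun t _ => ?_) measurableSet_Ioi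
  simp only [Real.rpow_one, neg_mul]
  ring

lemma integrableOn_tailKernel {β : ℝ} (hβ : 0 < β) (hβ2 : β ≤ 2) {w : ℝ} (hw : 0 < w) :
    IntegrableOn (tailKernel β w) (Set.Ioi 0) :=
  (integrableOn_tailBound (q := β) (by linarith) hw).mono'
    (measurable_tailKernel β w).aestronglyMeasurable
    ((ae_restrict_iff' measurableSet_Ioi).2 (ae_of_all _ fun _ ht =>
      norm_tailKernel_le hβ hβ2 w ht))

/-- The stable density as an absolutely convergent integral over a rotated ray. The term `-1` in
`tailKernel` contributes the purely imaginary quantity `i / w`. -/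
lemma stableDensity_eq_tailKernel {β : ℝ} (hβ : 0 < β) (hβ2 : β ≤ 2) {w : ℝ} (hw : 0 < w) :
    stableDensity β w = Real.pi⁻¹ * (∫ t in Set.Ioi 0, tailKernel β w t).re := by
  have h1 : ∫ u : ℝ, Real.cos (u * w) * stableChar β u =
      2 * ∫ u in Set.Ioi (0 : ℝ), Real.cos (u * w) * Real.exp (-(u ^ β / 2)) := by
    rw [← integral_comp_abs (f := fun u => Real.cos (u * w) * Real.exp (-(u ^ β / 2)))]
    congr 1; ext u
    rw [stableChar]
    rcases abs_cases u with h | h <;> simp [h.1]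
  have hray : IntegrableOn (rayIntegrand β w 0) (Set.Ioi 0) := by
    have h0 : IntegrableOn (fun t : ℝ => Real.exp (-(1 / 4) * t ^ β)) (Set.Ioi 0) := by
      simpa using integrableOn_rpow_mul_exp_neg_mul_rpow (s := 0) (b := 1 / 4) (by norm_num) hβ
        (by norm_num)
    exact h0.mono' (measurable_rayIntegrand β w 0).aestronglyMeasurable
      ((ae_restrict_iff' measurableSet_Ioi).2 (ae_of_all _ fun t ht =>
        norm_rayIntegrand_le hβ hβ2 hw.le ⟨le_rfl, by positivity⟩ ht))
  have h2 : ∫ u in Set.Ioi (0 : ℝ), Real.cos (u * w) * Real.exp (-(u ^ β / 2)) =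
      (∫ t in Set.Ioi 0, rayIntegrand β w 0 t).re := by
    rw [← Complex.reCLM_apply, ← Complex.reCLM.integral_comp_comm hray]
    refine setIntegral_congr_fun measurableSet_Ioi fun t _ => ?_
    have : rayIntegrand β w 0 t =
        Complex.exp (((t * w : ℝ) : ℂ) * Complex.I) * ((Real.exp (-(t ^ β / 2)) : ℝ) : ℂ) := by
      rw [rayIntegrand, Complex.ofReal_exp, ← Complex.exp_add]
      congr 1
      push_cast
      simp
      ring
    rw [Complex.reCLM_apply, this, Complex.re_mul_ofReal, Complex.exp_ofReal_mul_I_re]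
  have hexp : IntegrableOn (fun t : ℝ => Complex.exp
      (Complex.I * w * Complex.exp (Complex.I * (Real.pi / 6 : ℝ)) * t)) (Set.Ioi 0) := by
    refine integrableOn_exp_mul_complex_Ioi ?_ 0
    rw [exp_I_mul, Real.sin_pi_div_six]
    simp only [Complex.add_re, Complex.mul_re, Complex.mul_im, Complex.I_re,
      Complex.I_im, Complex.ofReal_re, Complex.ofReal_im, Complex.add_im]
    linarith
  have h3 : ∫ t in Set.Ioi 0, rayIntegrand β w (Real.pi / 6) t =
      (∫ t in Set.Ioi 0, tailKernel β w t) + Complex.I / w := by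
    have e1 : ∀ t : ℝ, rayIntegrand β w (Real.pi / 6) t = tailKernel β w t +
        Complex.exp (Complex.I * w * Complex.exp (Complex.I * (Real.pi / 6 : ℝ)) * t) *
          Complex.exp (Complex.I * (Real.pi / 6 : ℝ)) := by
      intro t
      rw [rayIntegrand, tailKernel, Complex.exp_add, sub_eq_add_neg, Complex.exp_add]
      rw [show Complex.I * w * Complex.exp (Complex.I * (Real.pi / 6 : ℝ)) * t =
        Complex.I * w * t * Complex.exp (Complex.I * (Real.pi / 6 : ℝ)) by ring]
      ring
    simp_rw [e1]
    rw [integral_add (integrableOn_tailKernel hβ hβ2 hw) (hexp.mul_const _),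
      integral_mul_const, integral_exp_mul_complex_Ioi]
    · have hne := Complex.exp_ne_zero (Complex.I * (Real.pi / 6 : ℝ))
      have hw' : (w : ℂ) ≠ 0 := by exact_mod_cast hw.ne'
      congr 1
      simp only [Complex.ofReal_zero, mul_zero, Complex.exp_zero]
      field_simp
      rw [Complex.I_sq]
    · rw [exp_I_mul, Real.sin_pi_div_six]
      simp only [Complex.add_re, Complex.mul_re, Complex.mul_im, Complex.I_re,
        Complex.I_im, Complex.ofReal_re, Complex.ofReal_im, Complex.add_im]
      linarith
  rw [stableDensity_eq, h1, h2, integral_rayIntegrand_eq hβ hβ2 hw.le, h3, Complex.add_re,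
    Complex.div_ofReal_re]
  simp
  ring

/-- The constant in the tail of the stable density, in a form valid for `β = 2` as well. -/
def tailLimit (β : ℝ) : ℝ := Real.Gamma (β + 1) * Real.sin (β * Real.pi / 2) / (2 * Real.pi)

/-- The tail of the stable density, including the Gaussian case, where the limit is `0`. After the
change of variable `t = v / w` the rotated integral converges by dominated convergence to a Gamma
integral. -/
lemma tendsto_stableDensity_tail {β : ℝ} (hβ : 0 < β) (hβ2 : β ≤ 2) :
    Tendsto (fun w => w ^ (1 + β) * stableDensity β w) atTop (𝓝 (tailLimit β)) := by
  set a : ℂ := Complex.exp (Complex.I * (Real.pi / 6 : ℝ)) with ha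
  set b : ℂ := Complex.exp (Complex.I * (β * (Real.pi / 6) : ℝ)) with hb
  have h1 : ∀ w : ℝ, 0 < w → w ^ (1 + β) * stableDensity β w =
      Real.pi⁻¹ * (∫ v in Set.Ioi 0, ((w ^ β : ℝ) : ℂ) * tailKernel β w (w⁻¹ * v)).re := by
    intro w hw
    have := integral_comp_mul_left_Ioi (tailKernel β w) 0 (inv_pos.2 hw)
    rw [integral_const_mul, this, stableDensity_eq_tailKernel hβ hβ2 hw, mul_zero, inv_inv,
      Real.rpow_add hw, Real.rpow_one, Complex.re_ofReal_mul, Complex.real_smul,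
      Complex.re_ofReal_mul]
    ring
  have h2 : Tendsto (fun w : ℝ => ∫ v in Set.Ioi 0, ((w ^ β : ℝ) : ℂ) * tailKernel β w (w⁻¹ * v))
      atTop (𝓝 (∫ v : ℝ in Set.Ioi 0,
        -(Complex.exp (Complex.I * v * a) * ((v ^ β : ℝ) : ℂ) * a * b / 2))) := by
    refine tendsto_integral_filter_of_dominated_convergence
      (fun v => v ^ β / 2 * Real.exp (-(1 / 2 * v))) ?_ ?_
      (integrableOn_tailBound (by linarith) one_pos) ?_
    · refine Eventually.of_forall fun w => Measurable.aestronglyMeasurable ?_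
      exact ((measurable_tailKernel β w).comp (measurable_const_mul w⁻¹)).const_mul _
    · filter_upwards [eventually_gt_atTop 0] with w hw
      refine (ae_restrict_iff' measurableSet_Ioi).2 (ae_of_all _ fun v hv => ?_)
      have hv' : 0 < w⁻¹ * v := mul_pos (inv_pos.2 hw) hv
      have h3 := Real.rpow_pos_of_pos hw β
      rw [norm_mul, Complex.norm_real, Real.norm_of_nonneg h3.le]
      refine (mul_le_mul_of_nonneg_left (norm_tailKernel_le hβ hβ2 w hv') h3.le).trans_eq ?_
      rw [Real.mul_rpow (inv_pos.2 hw).le (le_of_lt hv), Real.inv_rpow hw.le]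
      have e : w / 2 * (w⁻¹ * v) = 1 / 2 * v := by field_simp
      rw [e]
      field_simp
    · refine (ae_restrict_iff' measurableSet_Ioi).2 (ae_of_all _ fun v hv => ?_)
      have hv : 0 < v := hv
      -- the difference quotient of `exp` at `0`, along `z = - w ^ (- β) v ^ β b / 2`
      set c : ℂ := -((v ^ β : ℝ) * b / 2) with hc
      have hz : Tendsto (fun w : ℝ => ((w ^ (-β) : ℝ) : ℂ)) atTop (𝓝[≠] 0) := by
        refine tendsto_nhdsWithin_iff.2 ⟨?_, ?_⟩
        · have := (Complex.continuous_ofReal.tendsto 0).comp (tendsto_rpow_neg_atTop hβ)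
          simpa [Function.comp_def] using this
        · filter_upwards [eventually_gt_atTop 0] with w hw
          exact Complex.ofReal_ne_zero.2 (Real.rpow_pos_of_pos hw _).ne'
      have hd : HasDerivAt (fun z : ℂ => Complex.exp (z * c)) c 0 := by
        have := ((hasDerivAt_id (0 : ℂ)).mul_const c).cexp
        simpa using this
      have hlim := (hasDerivAt_iff_tendsto_slope.1 hd).comp hz
      have hlim2 := (hlim.const_mul (Complex.exp (Complex.I * v * a))).mul_const a
      refine (hlim2.congr' ?_).trans_eq (by rw [hc]; ring_nf)
      filter_upwards [eventually_gt_atTop 0] with w hw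
      have hwβ : ((w ^ β : ℝ) : ℂ) ≠ 0 :=
        Complex.ofReal_ne_zero.2 (Real.rpow_pos_of_pos hw _).ne'
      have hw0 : (w : ℂ) ≠ 0 := Complex.ofReal_ne_zero.2 hw.ne'
      have e1 : (((w⁻¹ * v) ^ β : ℝ) : ℂ) * b / 2 = -(((w ^ (-β) : ℝ) : ℂ) * c) := by
        rw [Real.mul_rpow (inv_pos.2 hw).le hv.le, Real.inv_rpow hw.le, Real.rpow_neg hw.le, hc]
        push_cast
        ring
      have e2 : Complex.I * w * ((w⁻¹ * v : ℝ) : ℂ) * a = Complex.I * v * a := by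
        push_cast
        field_simp
      simp only [Function.comp, slope, tailKernel, vsub_eq_sub, sub_zero, smul_eq_mul, zero_mul,
        Complex.exp_zero]
      rw [← ha, ← hb, e1, e2, neg_neg, Real.rpow_neg hw.le]
      push_cast
      rw [inv_inv]
      ring
  have h3 : ∫ v : ℝ in Set.Ioi 0,
        -(Complex.exp (Complex.I * v * a) * ((v ^ β : ℝ) : ℂ) * a * b / 2) =
      -(Complex.exp (Complex.I * ((β + 1) * (Real.pi / 2) : ℝ)) * Real.Gamma (β + 1) / 2) := by
    rw [← integral_gamma_ray (q := β + 1) (by linarith), ← integral_div, ← integral_neg]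
    congr 1; ext v
    have : Complex.exp (Complex.I * ((β + 1) * (Real.pi / 6) : ℝ)) = b * a := by
      rw [ha, hb, ← Complex.exp_add]; congr 1; push_cast; ring
    rw [Complex.exp_add, this, add_sub_cancel_right]
    ring
  have h4 := ((Complex.continuous_re.tendsto _).comp h2).const_mul Real.pi⁻¹
  refine (h4.congr' ?_).trans_eq ?_
  · filter_upwards [eventually_gt_atTop 0] with w hw
    rw [h1 w hw]; rfl
  · rw [h3, exp_I_mul]
    congr 1
    have : Real.cos ((β + 1) * (Real.pi / 2)) = -Real.sin (β * Real.pi / 2) := by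
      rw [← Real.cos_add_pi_div_two]; congr 1; ring
    rw [this, tailLimit]
    simp only [Complex.neg_re, Complex.div_ofNat_re, Complex.re_mul_ofReal, Complex.add_re,
      Complex.ofReal_re, Complex.mul_I_re, Complex.ofReal_im]
    field_simp
    ring

lemma integral_tailBound {q w : ℝ} (hq : -1 < q) (hw : 0 < w) :
    ∫ t in Set.Ioi (0 : ℝ), t ^ q / 2 * Real.exp (-(w / 2 * t)) =
      w ^ (-(q + 1)) * ((2 : ℝ) ^ q * Real.Gamma (q + 1)) := by
  have h := Real.integral_rpow_mul_exp_neg_mul_Ioi (a := q + 1) (r := w / 2) (by linarith)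
    (by positivity)
  have e : ∀ t : ℝ, t ^ q / 2 * Real.exp (-(w / 2 * t)) =
      2⁻¹ * (t ^ (q + 1 - 1) * Real.exp (-(w / 2 * t))) := by
    intro t; rw [add_sub_cancel_right]; ring
  simp_rw [e]
  rw [integral_const_mul, h, one_div, inv_div, Real.div_rpow (by norm_num) hw.le,
    Real.rpow_neg hw.le, Real.rpow_add_one (by norm_num : (2 : ℝ) ≠ 0)]
  ring

lemma abs_stableDensity_le_tail {β : ℝ} (hβ : 0 < β) (hβ2 : β ≤ 2) {w : ℝ} (hw : 0 < w) :
    |stableDensity β w| ≤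
      Real.pi⁻¹ * ((2 : ℝ) ^ β * Real.Gamma (β + 1)) * w ^ (-(1 + β)) := by
  rw [stableDensity_eq_tailKernel hβ hβ2 hw, abs_mul, abs_of_pos (by positivity : 0 < Real.pi⁻¹),
    mul_assoc]
  refine mul_le_mul_of_nonneg_left ((Complex.abs_re_le_norm _).trans ?_) (by positivity)
  have := norm_integral_le_of_norm_le (μ := volume.restrict (Set.Ioi 0)) (f := tailKernel β w)
    (integrableOn_tailBound (q := β) (by linarith) hw)
    ((ae_restrict_iff' measurableSet_Ioi).2 (ae_of_all _ fun t ht =>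
      norm_tailKernel_le hβ hβ2 w ht))
  rw [integral_tailBound (by linarith) hw] at this
  rw [mul_comm, add_comm 1 β]
  exact this

lemma abs_deriv_stableDensity_le_tail {β : ℝ} (hβ : 0 < β) (hβ2 : β ≤ 2) {w : ℝ} (hw : 0 < w) :
    |w * deriv (stableDensity β) w| ≤
      Real.pi⁻¹ * ((2 : ℝ) ^ (β + 1) * Real.Gamma (β + 2)) * w ^ (-(1 + β)) := by
  set a : ℂ := Complex.exp (Complex.I * (Real.pi / 6 : ℝ)) with ha
  have hbd : ∀ v t : ℝ, 0 < t → ‖Complex.I * t * a * tailKernel β v t‖ ≤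
      t ^ (β + 1) / 2 * Real.exp (-(v / 2 * t)) := by
    intro v t ht
    rw [norm_mul, norm_mul, norm_mul, ha, norm_exp_I_mul, Complex.norm_I, Complex.norm_real,
      Real.norm_of_nonneg ht.le, Real.rpow_add_one ht.ne']
    refine (mul_le_mul_of_nonneg_left (norm_tailKernel_le hβ hβ2 v ht) (by positivity)).trans_eq ?_
    ring
  have key := hasDerivAt_integral_of_dominated_loc_of_deriv_le
    (μ := volume.restrict (Set.Ioi 0)) (F := fun v t => tailKernel β v t)
    (F' := fun v t => Complex.I * t * a * tailKernel β v t)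
    (x₀ := w) (s := Set.Ioi (w / 2))
    (bound := fun t => t ^ (β + 1) / 2 * Real.exp (-(w / 2 / 2 * t)))
    (isOpen_Ioi.mem_nhds (by simpa using hw))
    (Eventually.of_forall fun v => (measurable_tailKernel β v).aestronglyMeasurable)
    (integrableOn_tailKernel hβ hβ2 hw)
    (by
      apply Measurable.aestronglyMeasurable
      have := measurable_tailKernel β w
      fun_prop)
    ((ae_restrict_iff' measurableSet_Ioi).2 (ae_of_all _ fun t ht v hv => by
      have ht : 0 < t := ht
      have hv : w / 2 < v := hv
      refine (hbd v t ht).trans ?_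
      have := Real.rpow_pos_of_pos ht (β + 1)
      gcongr))
    (integrableOn_tailBound (by linarith) (by positivity))
    (ae_of_all _ fun t v _ => by
      have h0 : HasDerivAt (fun v : ℝ => (v : ℂ)) 1 v := Complex.ofRealCLM.hasDerivAt
      have h1 := ((((h0.const_mul Complex.I).mul_const (t : ℂ)).mul_const a).cexp.mul_const
        (Complex.exp (-((t ^ β : ℝ) * Complex.exp (Complex.I * (β * (Real.pi / 6) : ℝ)) / 2)) - 1)
        ).mul_const a
      refine h1.congr_deriv ?_
      rw [tailKernel]
      ring)
  have h2 : HasDerivAt (stableDensity β)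
      (Real.pi⁻¹ * (∫ t in Set.Ioi 0, Complex.I * t * a * tailKernel β w t).re) w := by
    have h3 : HasDerivAt (fun v => Real.pi⁻¹ * (∫ t in Set.Ioi 0, tailKernel β v t).re)
        (Real.pi⁻¹ * (∫ t in Set.Ioi 0, Complex.I * t * a * tailKernel β w t).re) w :=
      (Complex.reCLM.hasFDerivAt.comp_hasDerivAt w key.2).const_mul Real.pi⁻¹
    refine h3.congr_of_eventuallyEq ?_
    filter_upwards [eventually_gt_nhds hw] with v hv
      using stableDensity_eq_tailKernel hβ hβ2 hv
  rw [h2.deriv, abs_mul, abs_mul, abs_of_pos (by positivity : 0 < Real.pi⁻¹), abs_of_pos hw]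
  have h4 : |(∫ t in Set.Ioi 0, Complex.I * t * a * tailKernel β w t).re| ≤
      w ^ (-(β + 1 + 1)) * ((2 : ℝ) ^ (β + 1) * Real.Gamma (β + 1 + 1)) := by
    refine (Complex.abs_re_le_norm _).trans ?_
    have := norm_integral_le_of_norm_le (μ := volume.restrict (Set.Ioi 0))
      (f := fun t : ℝ => Complex.I * t * a * tailKernel β w t)
      (integrableOn_tailBound (q := β + 1) (by linarith) hw)
      ((ae_restrict_iff' measurableSet_Ioi).2 (ae_of_all _ fun t ht => hbd w t ht))
    rwa [integral_tailBound (by linarith) hw] at this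
  have h5 : w ^ (-(1 + β)) = w * w ^ (-(β + 1 + 1)) := by
    rw [show -(β + 1 + 1) = -(1 + β) - 1 by ring, Real.rpow_sub_one hw.ne',
      mul_div_cancel₀ _ hw.ne']
  calc w * (Real.pi⁻¹ * |(∫ t in Set.Ioi 0, Complex.I * t * a * tailKernel β w t).re|)
      ≤ w * (Real.pi⁻¹ * (w ^ (-(β + 1 + 1)) *
        ((2 : ℝ) ^ (β + 1) * Real.Gamma (β + 1 + 1)))) := by gcongr
    _ = _ := by rw [h5, show β + 1 + 1 = β + 2 by ring]; ring

lemma deriv_stableDensity_neg (β w : ℝ) :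
    deriv (stableDensity β) (-w) = -deriv (stableDensity β) w := by
  have h : (fun w => stableDensity β (-w)) = stableDensity β := funext (stableDensity_neg β)
  have := deriv_comp_neg (stableDensity β) (-w)
  rw [h, neg_neg] at this
  exact this

/-- The function `ρ = h_β + w h_β' = (w h_β)'`, the score of the scale model times its density. -/
def scaleScore (β w : ℝ) : ℝ := stableDensity β w + w * deriv (stableDensity β) w

lemma scaleScore_neg (β w : ℝ) : scaleScore β (-w) = scaleScore β w := by
  rw [scaleScore, stableDensity_neg, deriv_stableDensity_neg, scaleScore]; ring

lemma exists_tail_bounds {β : ℝ} (hβ : 0 < β) (hβ2 : β ≤ 2) :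
    ∃ C : ℝ, 0 < C ∧ (∀ w, 1 ≤ |w| → |stableDensity β w| ≤ C * |w| ^ (-(1 + β))) ∧
      ∀ w, 1 ≤ |w| → |scaleScore β w| ≤ C * |w| ^ (-(1 + β)) := by
  set A := Real.pi⁻¹ * ((2 : ℝ) ^ β * Real.Gamma (β + 1))
  set B := Real.pi⁻¹ * ((2 : ℝ) ^ (β + 1) * Real.Gamma (β + 2))
  have hA : 0 < A := by
    have := Real.Gamma_pos_of_pos (by linarith : 0 < β + 1); positivity
  have hB : 0 < B := by
    have := Real.Gamma_pos_of_pos (by linarith : 0 < β + 2); positivity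
  have h1 : ∀ w : ℝ, stableDensity β |w| = stableDensity β w := fun w => by
    rcases abs_cases w with h | h
    · rw [h.1]
    · rw [h.1, stableDensity_neg]
  have h2 : ∀ w : ℝ, scaleScore β |w| = scaleScore β w := fun w => by
    rcases abs_cases w with h | h
    · rw [h.1]
    · rw [h.1, scaleScore_neg]
  refine ⟨A + B, by positivity, fun w hw => ?_, fun w hw => ?_⟩
  · rw [← h1 w]
    have hw0 : 0 < |w| := by linarith
    have := Real.rpow_pos_of_pos hw0 (-(1 + β))
    refine (abs_stableDensity_le_tail hβ hβ2 hw0).trans ?_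
    gcongr; linarith
  · rw [← h2 w, scaleScore]
    have hw0 : 0 < |w| := by linarith
    refine (abs_add_le _ _).trans ?_
    rw [add_mul]
    exact add_le_add (abs_stableDensity_le_tail hβ hβ2 hw0)
      (abs_deriv_stableDensity_le_tail hβ hβ2 hw0)

lemma exists_bound_scaleScore {β : ℝ} (hβ : 0 < β) (hβ2 : β ≤ 2) :
    ∃ B : ℝ, 0 < B ∧ ∀ w, |scaleScore β w| ≤ B := by
  obtain ⟨C, hC, -, hC2⟩ := exists_tail_bounds hβ hβ2
  obtain ⟨B, hB, hB1, hB2⟩ := exists_bound_stableDensity hβ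
  refine ⟨C + 2 * B, by positivity, fun w => ?_⟩
  rcases le_total 1 |w| with h | h
  · have : |w| ^ (-(1 + β)) ≤ 1 := Real.rpow_le_one_of_one_le_of_nonpos h (by linarith)
    nlinarith [hC2 w h]
  · rw [scaleScore]
    refine (abs_add_le _ _).trans ?_
    rw [abs_mul]
    have := mul_le_mul h (hB2 w) (abs_nonneg _) zero_le_one
    linarith [hB1 w]

lemma measurable_scaleScore {β : ℝ} (hβ : 0 < β) : Measurable (scaleScore β) :=
  (continuous_stableDensity hβ).measurable.add (measurable_id.mul (measurable_deriv _))

lemma integrable_stableDensity {β : ℝ} (hβ : 0 < β) (hβ2 : β ≤ 2) :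
    Integrable (stableDensity β) := by
  obtain ⟨C, hC, hC1, -⟩ := exists_tail_bounds hβ hβ2
  obtain ⟨B, hB, hB1, -⟩ := exists_bound_stableDensity hβ
  have hi : Integrable fun w : ℝ => (1 + ‖w‖) ^ (-(1 + β)) :=
    integrable_one_add_norm (by simpa using hβ)
  refine (hi.const_mul ((C + B) * 2 ^ (1 + β))).mono'
    (continuous_stableDensity hβ).aestronglyMeasurable (ae_of_all _ fun w => ?_)
  rw [Real.norm_eq_abs, Real.norm_eq_abs, mul_assoc, Real.rpow_neg (by positivity), ← div_eq_mul_inv,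
    ← Real.div_rpow (by norm_num) (by positivity)]
  rcases le_total 1 |w| with h | h
  · refine (hC1 w h).trans ?_
    have h1 : |w| ^ (-(1 + β)) = (1 / |w|) ^ (1 + β) := by
      rw [Real.rpow_neg (abs_nonneg w), one_div, Real.inv_rpow (abs_nonneg w)]
    rw [h1]
    have h2 : 1 / |w| ≤ 2 / (1 + |w|) := by
      rw [div_le_div_iff₀ (by linarith) (by positivity)]; linarith
    have h3 : (1 / |w|) ^ (1 + β) ≤ (2 / (1 + |w|)) ^ (1 + β) := by gcongr
    have h4 : (0 : ℝ) ≤ (2 / (1 + |w|)) ^ (1 + β) := by positivity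
    nlinarith
  · refine (hB1 w).trans ?_
    have h2 : (1 : ℝ) ≤ (2 / (1 + |w|)) ^ (1 + β) := by
      apply Real.one_le_rpow _ (by linarith)
      rw [le_div_iff₀ (by positivity)]; linarith
    nlinarith

/-! ### Fourier inversion -/

lemma ofReal_stableDensity {β : ℝ} (hβ : 0 < β) (w : ℝ) :
    (stableDensity β w : ℂ) =
      (2 * Real.pi : ℂ)⁻¹ * ∫ u : ℝ, Complex.exp (-(u * w * Complex.I)) * stableChar β u := by
  have hc := continuous_stableChar hβ
  have hi := integrable_stableChar hβ
  have hcos : Integrable fun u : ℝ => Real.cos (u * w) * stableChar β u :=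
    hi.bdd_mul (c := 1) (by apply Continuous.aestronglyMeasurable; fun_prop)
      (Eventually.of_forall fun u => by simpa using Real.abs_cos_le_one _)
  have hsin : Integrable fun u : ℝ => Real.sin (u * w) * stableChar β u :=
    hi.bdd_mul (c := 1) (by apply Continuous.aestronglyMeasurable; fun_prop)
      (Eventually.of_forall fun u => by simpa using Real.abs_sin_le_one _)
  have h0 : ∫ u : ℝ, Real.sin (u * w) * stableChar β u = 0 := by
    have := integral_neg_eq_self (fun u : ℝ => Real.sin (u * w) * stableChar β u) volume
    have e : ∀ u : ℝ, Real.sin (-u * w) * stableChar β (-u) =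
        -(Real.sin (u * w) * stableChar β u) := by
      intro u; simp [stableChar]
    simp_rw [e] at this
    rw [integral_neg] at this
    linarith
  have e : ∀ u : ℝ, Complex.exp (-(u * w * Complex.I)) * stableChar β u =
      ((Real.cos (u * w) * stableChar β u : ℝ) : ℂ) -
        ((Real.sin (u * w) * stableChar β u : ℝ) : ℂ) * Complex.I := by
    intro u
    have : -((u : ℂ) * w * Complex.I) = ((-(u * w) : ℝ) : ℂ) * Complex.I := by push_cast; ring
    rw [this, Complex.exp_mul_I, ← Complex.ofReal_cos, ← Complex.ofReal_sin, Real.cos_neg,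
      Real.sin_neg]
    push_cast
    ring
  simp_rw [e]
  rw [integral_sub hcos.ofReal (hsin.ofReal.mul_const _), integral_mul_const,
    integral_complex_ofReal, integral_complex_ofReal, h0, stableDensity_eq]
  push_cast
  ring

lemma integral_exp_mul_stableDensity {β : ℝ} (hβ : 0 < β) (hβ2 : β ≤ 2) (u : ℝ) :
    ∫ w : ℝ, Complex.exp (u * w * Complex.I) * stableDensity β w = stableChar β u := by
  have hpi := Real.pi_pos
  have hF : FourierTransform.fourier (fun u : ℝ => (stableChar β u : ℂ)) =
      fun w : ℝ => ((2 * Real.pi * stableDensity β (2 * Real.pi * w) : ℝ) : ℂ) := by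
    ext w
    rw [Real.fourier_real_eq_integral_exp_smul]
    push_cast
    rw [ofReal_stableDensity hβ, mul_inv_cancel_left₀ (by
      simp [Real.pi_ne_zero])]
    congr 1; ext v
    rw [smul_eq_mul]
    congr 2
    push_cast
    ring
  have hFi : Integrable (FourierTransform.fourier (fun u : ℝ => (stableChar β u : ℂ))) := by
    rw [hF]
    exact (((integrable_stableDensity hβ hβ2).comp_mul_left' (by positivity)).const_mul
      (2 * Real.pi)).ofReal
  have h1 := (Complex.continuous_ofReal.comp (continuous_stableChar hβ)).fourierInv_fourier_eq
    (integrable_stableChar hβ).ofReal hFi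
  have h2 := congrFun h1 u
  have h3 : (Complex.ofReal ∘ stableChar β) = fun u : ℝ => (stableChar β u : ℂ) := rfl
  rw [h3, hF, Real.fourierInv_eq'] at h2
  simp only at h2
  rw [← h2]
  have h4 := Measure.integral_comp_mul_left
    (fun w : ℝ => Complex.exp (u * w * Complex.I) * stableDensity β w) (2 * Real.pi)
  rw [abs_of_pos (by positivity), Complex.real_smul, eq_comm, Complex.ofReal_inv,
    inv_mul_eq_iff_eq_mul₀ (by exact_mod_cast (by positivity : (2 * Real.pi) ≠ 0))] at h4
  rw [h4, ← integral_const_mul]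
  congr 1; ext v
  rw [smul_eq_mul]
  have e : ((2 * Real.pi * inner ℝ v u : ℝ) : ℂ) * Complex.I =
      u * ((2 * Real.pi * v : ℝ) : ℂ) * Complex.I := by
    simp only [RCLike.inner_apply, conj_trivial]
    push_cast; ring
  rw [← e]
  push_cast
  ring

/-- The density `z ↦ s⁻¹ h_β (z / s)` of `s W_1`. -/
def scaledDensity (β s z : ℝ) : ℝ := 1 / s * stableDensity β (z / s)

lemma continuous_scaledDensity {β : ℝ} (hβ : 0 < β) (s : ℝ) : Continuous (scaledDensity β s) := by
  unfold scaledDensity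
  have := continuous_stableDensity hβ
  fun_prop

lemma integrable_scaledDensity {β s : ℝ} (hβ : 0 < β) (hβ2 : β ≤ 2) (hs : 0 < s) :
    Integrable (scaledDensity β s) :=
  ((integrable_stableDensity hβ hβ2).comp_div hs.ne').const_mul _

lemma integral_exp_mul_scaledDensity {β s : ℝ} (hβ : 0 < β) (hβ2 : β ≤ 2) (hs : 0 < s) (u : ℝ) :
    ∫ w : ℝ, Complex.exp (u * w * Complex.I) * scaledDensity β s w = stableChar β (s * u) := by
  have hs' : (s : ℂ) ≠ 0 := by exact_mod_cast hs.ne'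
  rw [← integral_exp_mul_stableDensity hβ hβ2 (s * u)]
  have := Measure.integral_comp_div
    (fun w : ℝ => Complex.exp ((s * u : ℝ) * w * Complex.I) * stableDensity β w) s
  rw [abs_of_pos hs, Complex.real_smul, eq_comm, ← eq_inv_mul_iff_mul_eq₀ hs'] at this
  rw [this, ← integral_const_mul]
  congr 1; ext w
  rw [scaledDensity]
  have e : ((s * u : ℝ) : ℂ) * ((w / s : ℝ) : ℂ) = u * w := by
    push_cast; field_simp
  rw [e]
  push_cast
  rw [one_div]
  ring

lemma integrable_stableChar_mul {β s : ℝ} (hβ : 0 < β) (hs : 0 < s) :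
    Integrable fun u => stableChar β (s * u) :=
  (integrable_stableChar hβ).comp_mul_left' hs.ne'

lemma ofReal_scaledDensity {β s : ℝ} (hβ : 0 < β) (hs : 0 < s) (z : ℝ) :
    (scaledDensity β s z : ℂ) =
      (2 * Real.pi : ℂ)⁻¹ *
        ∫ u : ℝ, Complex.exp (-(u * z * Complex.I)) * stableChar β (s * u) := by
  have hs' : (s : ℂ) ≠ 0 := by exact_mod_cast hs.ne'
  have := Measure.integral_comp_mul_left
    (fun u : ℝ => Complex.exp (-(u * (z / s : ℝ) * Complex.I)) * stableChar β u) s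
  rw [abs_of_pos (inv_pos.2 hs), Complex.real_smul] at this
  rw [scaledDensity]
  push_cast [ofReal_stableDensity hβ]
  have e : ∀ u : ℝ, Complex.exp (-(u * z * Complex.I)) * stableChar β (s * u) =
      Complex.exp (-(((s * u : ℝ) : ℂ) * (z / s : ℝ) * Complex.I)) * stableChar β (s * u) := by
    intro u
    congr 3
    push_cast
    field_simp
  simp_rw [e]
  rw [this]
  push_cast
  ring

/-- Fourier inversion for the convolution of a stable law and a finite measure. -/
lemma ofReal_integral_scaledDensity {β s : ℝ} (hβ : 0 < β) (hs : 0 < s) (M : Measure ℝ)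
    [IsFiniteMeasure M] (r x : ℝ) :
    ((∫ y, scaledDensity β s (x - r * y) ∂M : ℝ) : ℂ) =
      (2 * Real.pi : ℂ)⁻¹ * ∫ u : ℝ, Complex.exp (-(u * x * Complex.I)) *
        stableChar β (s * u) * charFun M (r * u) := by
  rw [← integral_complex_ofReal]
  simp_rw [ofReal_scaledDensity hβ hs]
  rw [integral_const_mul, integral_integral_swap]
  · congr 2; ext u
    rw [charFun_apply_real, ← integral_const_mul]
    congr 1; ext y
    have e : Complex.exp (-(u * (x - r * y : ℝ) * Complex.I)) =
        Complex.exp (-(u * x * Complex.I)) * Complex.exp ((r * u : ℝ) * y * Complex.I) := by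
      rw [← Complex.exp_add]; congr 1; push_cast; ring
    rw [e]; ring
  · have h1 : Integrable (fun p : ℝ × ℝ => (1 : ℝ) * stableChar β (s * p.2)) (M.prod volume) :=
      (integrable_const (1 : ℝ)).mul_prod (integrable_stableChar_mul hβ hs)
    refine h1.mono' ?_ (ae_of_all _ fun p => ?_)
    · apply Continuous.aestronglyMeasurable
      have := continuous_stableChar hβ
      simp only [Function.uncurry_def]
      fun_prop
    · simp only [Function.uncurry_def]
      rw [norm_mul, Complex.norm_real, Real.norm_of_nonneg (stableChar_nonneg _ _)]
      have : -((p.2 : ℂ) * ((x - r * p.1 : ℝ) : ℂ) * Complex.I) =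
          ((-(p.2 * (x - r * p.1)) : ℝ) : ℂ) * Complex.I := by push_cast; ring
      rw [this, Complex.norm_exp_ofReal_mul_I]

lemma charFun_withDensity_ofReal {p : ℝ → ℝ} (hp : Measurable p) (u : ℝ) :
    charFun (volume.withDensity fun x => ENNReal.ofReal (p x)) u =
      ∫ x : ℝ, Complex.exp (u * x * Complex.I) * (max (p x) 0 : ℝ) := by
  rw [charFun_apply_real, integral_withDensity_eq_integral_toReal_smul
    hp.ennreal_ofReal (ae_of_all _ fun _ => ENNReal.ofReal_lt_top)]
  congr 1; ext x
  rw [ENNReal.toReal_ofReal', Complex.real_smul, mul_comm]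

/-- The stable density is nonnegative as soon as `exp (- |u| ^ β / 2)` is a characteristic
function: the law `ν`, increased by the negative part of the density, has the same characteristic
function as the positive part. -/
lemma stableDensity_nonneg {β : ℝ} (hβ : 0 < β) (hβ2 : β ≤ 2) {ν : Measure ℝ}
    [IsProbabilityMeasure ν] (hν : ∀ u, charFun ν u = stableChar β u) (w : ℝ) :
    0 ≤ stableDensity β w := by
  have hi := integrable_stableDensity hβ hβ2
  have hm := (continuous_stableDensity hβ).measurable
  have hmn : Measurable fun x => -stableDensity β x := hm.neg
  have hineg : Integrable fun x => -stableDensity β x := hi.neg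
  set Mp : Measure ℝ := volume.withDensity fun x => ENNReal.ofReal (stableDensity β x)
  set Mn : Measure ℝ := volume.withDensity fun x => ENNReal.ofReal (-stableDensity β x)
  have : IsFiniteMeasure Mp := isFiniteMeasure_withDensity_ofReal hi.2
  have : IsFiniteMeasure Mn := isFiniteMeasure_withDensity_ofReal hi.neg.2
  have hexp : ∀ u : ℝ, ∀ {q : ℝ → ℝ}, Integrable q →
      Integrable fun x : ℝ => Complex.exp (u * x * Complex.I) * (q x : ℂ) := by
    intro u q hq
    refine hq.ofReal.bdd_mul (c := 1) (by apply Continuous.aestronglyMeasurable; fun_prop)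
      (ae_of_all _ fun x => ?_)
    rw [← Complex.ofReal_mul, Complex.norm_exp_ofReal_mul_I]
  have heq : ν + Mn = Mp := by
    apply Measure.ext_of_charFun
    ext u
    have h1 : charFun (ν + Mn) u = charFun ν u + charFun Mn u := by
      simp only [charFun_apply_real]
      refine integral_add_measure ?_ ?_ <;>
      · refine (integrable_const (1 : ℝ)).mono' (by
          apply Continuous.aestronglyMeasurable; fun_prop) (ae_of_all _ fun x => ?_)
        rw [← Complex.ofReal_mul, Complex.norm_exp_ofReal_mul_I]
    rw [h1, hν, charFun_withDensity_ofReal hmn, charFun_withDensity_ofReal hm,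
      ← integral_exp_mul_stableDensity hβ hβ2, ← integral_add (hexp u hi) (hexp u hineg.pos_part)]
    congr 1; ext x
    rw [← mul_add, ← Complex.ofReal_add]
    congr 2
    rcases le_total 0 (stableDensity β x) with h | h
    · rw [max_eq_left h, max_eq_right (by linarith)]; ring
    · rw [max_eq_right h, max_eq_left (by linarith)]; ring
  -- the set where the density is negative is open and null, hence empty
  by_contra hneg
  push Not at hneg
  set A : Set ℝ := {x | stableDensity β x < 0}
  have hA : IsOpen A := isOpen_lt (continuous_stableDensity hβ) continuous_const
  have hp0 : Mp A = 0 := by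
    rw [withDensity_apply _ hA.measurableSet]
    refine setLIntegral_eq_zero hA.measurableSet fun x hx => ?_
    exact ENNReal.ofReal_of_nonpos (le_of_lt hx)
  have hn0 : Mn A = 0 := by
    rw [← heq, Measure.add_apply] at hp0
    exact (add_eq_zero.1 hp0).2
  rw [withDensity_apply_eq_zero hmn.ennreal_ofReal] at hn0
  have hA0 : volume A = 0 := by
    refine measure_mono_null (fun x (hx : stableDensity β x < 0) => ?_) hn0
    exact ⟨by simpa using hx, hx⟩
  exact (hA.measure_pos volume ⟨w, hneg⟩).ne' hA0

lemma stableDensity_two (w : ℝ) :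
    stableDensity 2 w = (√(2 * Real.pi))⁻¹ * Real.exp (-(w ^ 2 / 2)) := by
  have hpi := Real.pi_pos
  apply Complex.ofReal_injective
  rw [ofReal_stableDensity (by norm_num)]
  have h := fourierIntegral_gaussian (b := 1 / 2) (by norm_num) (-w : ℂ)
  have e : ∀ u : ℝ, Complex.exp (-(u * w * Complex.I)) * (stableChar 2 u : ℂ) =
      Complex.exp (Complex.I * (-w) * u) * Complex.exp (-(1 / 2) * (u : ℂ) ^ 2) := by
    intro u
    rw [stableChar, Complex.ofReal_exp]
    congr 1
    · congr 1; ring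
    · congr 1
      have : |u| ^ (2 : ℝ) = u ^ 2 := by
        rw [show (2 : ℝ) = ((2 : ℕ) : ℝ) by norm_num, Real.rpow_natCast, sq_abs]
      rw [this]; push_cast; ring
  simp_rw [e]
  rw [h]
  have h2 : ((Real.pi : ℂ) / (1 / 2)) ^ (1 / 2 : ℂ) = ((√(2 * Real.pi) : ℝ) : ℂ) := by
    rw [Real.sqrt_eq_rpow, Complex.ofReal_cpow (by positivity)]
    push_cast
    congr 1
    ring
  have h3 : (2 * Real.pi : ℂ) = ((√(2 * Real.pi) : ℝ) : ℂ) * ((√(2 * Real.pi) : ℝ) : ℂ) := by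
    rw [← Complex.ofReal_mul, Real.mul_self_sqrt (by positivity)]; push_cast; ring
  have h4 : ((√(2 * Real.pi) : ℝ) : ℂ) ≠ 0 :=
    Complex.ofReal_ne_zero.2 (by positivity)
  rw [h2, h3, mul_inv, mul_assoc, inv_mul_cancel_left₀ h4]
  push_cast
  congr 2
  ring

lemma tailLimit_pos {β : ℝ} (hβ : 0 < β) (hβ2 : β < 2) : 0 < tailLimit β := by
  have hpi := Real.pi_pos
  have h1 : 0 < Real.sin (β * Real.pi / 2) := Real.sin_pos_of_pos_of_lt_pi (by positivity) (by nlinarith)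
  have h2 := Real.Gamma_pos_of_pos (by linarith : 0 < β + 1)
  unfold tailLimit
  positivity

lemma tailLimit_two : tailLimit 2 = 0 := by
  simp [tailLimit]

/-- The two forms of the constant `c_β` agree by Euler's reflection formula. -/
lemma tailConst_eq_tailLimit {β : ℝ} (hβ : 0 < β) (hβ2 : β < 2) : tailConst β = tailLimit β := by
  have hpi := Real.pi_pos
  by_cases h1 : β = 1
  · subst h1
    rw [tailConst, if_pos rfl, tailLimit]
    have : Real.Gamma (1 + 1) = 1 := by
      rw [Real.Gamma_add_one one_ne_zero, Real.Gamma_one]; norm_num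
    rw [this]
    simp
  · rw [tailConst, if_neg h1, tailLimit]
    have hs : Real.sin (Real.pi * β) =
        2 * Real.sin (β * Real.pi / 2) * Real.cos (β * Real.pi / 2) := by
      rw [← Real.sin_two_mul]; congr 1; ring
    have hne : Real.sin (Real.pi * β) ≠ 0 := by
      rw [Ne, Real.sin_eq_zero_iff]
      rintro ⟨n, hn⟩
      have hn' : (n : ℝ) = β := by
        have := mul_right_cancel₀ hpi.ne' (hn.trans (mul_comm _ _)); exact this
      have h3 : (0 : ℝ) < n := hn' ▸ hβ
      have h4 : (n : ℝ) < 2 := hn' ▸ hβ2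
      have h5 : n = 1 := by
        have h3' : 0 < n := by exact_mod_cast h3
        have h4' : n < 2 := by exact_mod_cast h4
        omega
      apply h1; rw [← hn', h5]; norm_num
    have hcos : Real.cos (β * Real.pi / 2) ≠ 0 := fun h => hne (by rw [hs, h, mul_zero])
    have hr := Real.Gamma_mul_Gamma_one_sub β
    have hG : Real.Gamma (2 - β) = (1 - β) * Real.Gamma (1 - β) := by
      rw [show 2 - β = (1 - β) + 1 by ring, Real.Gamma_add_one (sub_ne_zero.2 (Ne.symm h1))]
    have hG1 : Real.Gamma (β + 1) = β * Real.Gamma β := Real.Gamma_add_one hβ.ne'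
    have hΓ := Real.Gamma_pos_of_pos hβ
    have hG2 : Real.Gamma (1 - β) = Real.pi / Real.sin (Real.pi * β) / Real.Gamma β := by
      rw [← hr]; field_simp
    have h1' : 1 - β ≠ 0 := sub_ne_zero.2 (Ne.symm h1)
    have hsin : Real.sin (β * Real.pi / 2) ≠ 0 := fun h => hne (by rw [hs, h]; ring)
    rw [hG, hG1, hG2, hs]
    field_simp
    ring

lemma exists_stableDensity_ge_tail {β : ℝ} (hβ : 0 < β) (hβ2 : β < 2) :
    ∃ R : ℝ, 1 ≤ R ∧ ∀ w, R ≤ |w| →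
      tailLimit β / 2 * |w| ^ (-(1 + β)) ≤ stableDensity β w := by
  have hc := tailLimit_pos hβ hβ2
  have h := (tendsto_stableDensity_tail hβ hβ2.le).eventually
    (eventually_ge_nhds (show tailLimit β / 2 < tailLimit β by linarith))
  obtain ⟨R, hR⟩ := eventually_atTop.1 h
  refine ⟨max R 1, le_max_right _ _, fun w hw => ?_⟩
  have hw0 : 0 < |w| := by linarith [le_max_right R 1]
  have := hR |w| ((le_max_left _ _).trans hw)
  rw [stableDensity_abs] at this
  have hp := Real.rpow_pos_of_pos hw0 (1 + β)
  rw [Real.rpow_neg hw0.le, ← div_eq_mul_inv, div_le_iff₀ hp]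
  linarith

/-- For `β < 2` the law is the convolution of two scaled copies of itself, whose densities are
positive in the tails; hence the density is positive everywhere. -/
lemma stableDensity_pos {β : ℝ} (hβ : 0 < β) (hβ2 : β ≤ 2) (hnn : ∀ w, 0 ≤ stableDensity β w)
    (w : ℝ) : 0 < stableDensity β w := by
  rcases hβ2.eq_or_lt with rfl | hlt
  · rw [stableDensity_two]; have := Real.pi_pos; positivity
  -- the scale with `2 * s ^ β = 1`, so that two independent copies of `s W_1` add up to `W_1`
  set s : ℝ := (2 : ℝ) ^ (-β⁻¹) with hs
  have hs0 : 0 < s := by positivity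
  have hnn' : ∀ z, 0 ≤ scaledDensity β s z := fun z => mul_nonneg (by positivity) (hnn _)
  have hci := integrable_scaledDensity hβ hβ2 hs0
  have hcc := continuous_scaledDensity hβ s
  set M : Measure ℝ := volume.withDensity fun x => ENNReal.ofReal (scaledDensity β s x)
  have : IsFiniteMeasure M := isFiniteMeasure_withDensity_ofReal hci.2
  have hM : ∀ u, charFun M u = stableChar β (s * u) := by
    intro u
    rw [charFun_withDensity_ofReal hcc.measurable, ← integral_exp_mul_scaledDensity hβ hβ2 hs0]
    congr 1; ext x; rw [max_eq_left (hnn' x)]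
  have hconv : ∫ y, scaledDensity β s (w - 1 * y) ∂M = stableDensity β w := by
    apply Complex.ofReal_injective
    rw [ofReal_integral_scaledDensity hβ hs0, ofReal_stableDensity hβ]
    congr 2; ext u
    rw [hM, one_mul, mul_assoc]
    congr 1
    rw [← Complex.ofReal_mul]
    congr 1
    simp only [stableChar]
    rw [← Real.exp_add, abs_mul, abs_of_pos hs0, Real.mul_rpow hs0.le (abs_nonneg u), hs,
      ← Real.rpow_mul (by norm_num), neg_mul, inv_mul_cancel₀ hβ.ne', Real.rpow_neg_one]
    congr 1; ring
  have hconv2 : ∫ y, scaledDensity β s (w - 1 * y) ∂M =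
      ∫ y, scaledDensity β s y * scaledDensity β s (w - y) := by
    rw [integral_withDensity_eq_integral_toReal_smul hcc.measurable.ennreal_ofReal
      (ae_of_all _ fun _ => ENNReal.ofReal_lt_top)]
    congr 1; ext y
    rw [ENNReal.toReal_ofReal (hnn' y), smul_eq_mul, one_mul]
  rw [← hconv, hconv2]
  have hcont : Continuous fun y => scaledDensity β s y * scaledDensity β s (w - y) := by fun_prop
  obtain ⟨B, hB, hB1, -⟩ := exists_bound_stableDensity hβ
  have hint : Integrable fun y => scaledDensity β s y * scaledDensity β s (w - y) := by
    refine hci.mul_bdd (c := 1 / s * B) (by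
      apply Continuous.aestronglyMeasurable; fun_prop) (ae_of_all _ fun y => ?_)
    rw [scaledDensity, norm_mul, Real.norm_of_nonneg (by positivity : 0 ≤ 1 / s)]
    exact mul_le_mul_of_nonneg_left (hB1 _) (by positivity)
  rw [integral_pos_iff_support_of_nonneg (fun y => mul_nonneg (hnn' y) (hnn' _)) hint]
  refine hcont.isOpen_support.measure_pos _ ?_
  obtain ⟨R, hR1, hR⟩ := exists_stableDensity_ge_tail hβ hlt
  have hpos : ∀ z, R ≤ |z / s| → 0 < scaledDensity β s z := by
    intro z hz
    have h0 : 0 < |z / s| := by linarith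
    have := hR _ hz
    have h1 := Real.rpow_pos_of_pos h0 (-(1 + β))
    have h2 := tailLimit_pos hβ hlt
    have h3 : 0 < stableDensity β (z / s) := lt_of_lt_of_le (by positivity) this
    exact mul_pos (by positivity) h3
  -- a point at which both factors are evaluated in their tails
  refine ⟨s * R + |w|, (mul_pos (hpos _ ?_) (hpos _ ?_)).ne'⟩
  · rw [abs_div, abs_of_pos hs0, le_div_iff₀ hs0]
    have := le_abs_self (s * R + |w|)
    have := abs_nonneg w
    linarith
  · rw [abs_div, abs_of_pos hs0, le_div_iff₀ hs0]
    have := neg_le_abs (w - (s * R + |w|))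
    have := le_abs_self w
    linarith

lemma scaleIntegrand_eq (β w : ℝ) :
    scaleIntegrand β w = scaleScore β w ^ 2 / stableDensity β w := rfl

/-- For `β = 2` the integrand is a polynomial times the Gaussian density; for `β < 2` it is at most
a multiple of the density. -/
lemma integrable_scaleIntegrand {β : ℝ} (hβ : 0 < β) (hβ2 : β ≤ 2)
    (hpos : ∀ w, 0 < stableDensity β w) : Integrable (scaleIntegrand β) := by
  have hmeas : Measurable (scaleIntegrand β) :=
    ((measurable_scaleScore hβ).pow_const 2).div (continuous_stableDensity hβ).measurable
  rcases hβ2.eq_or_lt with rfl | hlt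
  · have hd : ∀ w, scaleScore 2 w = (1 - w ^ 2) * stableDensity 2 w := by
      intro w
      have h1 : HasDerivAt (stableDensity 2) (-w * stableDensity 2 w) w := by
        have e : stableDensity 2 = fun w => (√(2 * Real.pi))⁻¹ * Real.exp (-(w ^ 2 / 2)) :=
          funext stableDensity_two
        have h2 : HasDerivAt (fun w : ℝ => -(w ^ 2 / 2)) (-w) w := by
          refine (((hasDerivAt_pow 2 w).div_const 2).neg).congr_deriv ?_
          norm_num
        rw [e]
        refine (h2.exp.const_mul _).congr_deriv ?_
        ring
      rw [scaleScore, h1.deriv]; ring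
    have e : scaleIntegrand 2 = fun w => (√(2 * Real.pi))⁻¹ *
        ((|w| ^ (0 : ℝ) * stableChar 2 w) - 2 * (|w| ^ (2 : ℝ) * stableChar 2 w)
          + |w| ^ (4 : ℝ) * stableChar 2 w) := by
      ext w
      have h2 : |w| ^ (2 : ℝ) = w ^ 2 := by
        rw [show (2 : ℝ) = ((2 : ℕ) : ℝ) by norm_num, Real.rpow_natCast, sq_abs]
      have h4 : |w| ^ (4 : ℝ) = w ^ 4 := by
        rw [show (4 : ℝ) = ((4 : ℕ) : ℝ) by norm_num, Real.rpow_natCast,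
          Even.pow_abs (by decide)]
      have hne := (hpos w).ne'
      have h5 : scaleIntegrand 2 w = (1 - w ^ 2) ^ 2 * stableDensity 2 w := by
        rw [scaleIntegrand_eq, hd]; field_simp
      rw [h5, stableDensity_two, stableChar, h2, h4, Real.rpow_zero]
      ring
    rw [e]
    exact ((((integrable_rpow_mul_stableChar two_pos (by norm_num)).sub
      ((integrable_rpow_mul_stableChar two_pos (by norm_num)).const_mul 2)).add
      (integrable_rpow_mul_stableChar two_pos (by norm_num))).const_mul _)
  · obtain ⟨R, hR1, hR⟩ := exists_stableDensity_ge_tail hβ hlt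
    obtain ⟨C, hC, -, hC2⟩ := exists_tail_bounds hβ hβ2
    obtain ⟨B, hB, hB1⟩ := exists_bound_scaleScore hβ hβ2
    have hc := tailLimit_pos hβ hlt
    obtain ⟨w0, -, hw0⟩ := (isCompact_Icc (a := -R) (b := R)).exists_isMinOn
      ⟨0, by constructor <;> linarith⟩ (continuous_stableDensity hβ).continuousOn
    set m := stableDensity β w0 with hm
    have hm0 : 0 < m := hpos w0
    -- `ρ / h_β` is bounded, because `ρ` and `h_β` have tails of the same order
    have hle : ∀ w, |scaleScore β w| ≤ (B / m + 2 * C / tailLimit β) * stableDensity β w := by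
      intro w
      rw [add_mul]
      have hp := hpos w
      rcases le_total R |w| with h | h
      · have h1 := hC2 w (hR1.trans h)
        have h2 := hR w h
        have h3 : 2 * C / tailLimit β * (tailLimit β / 2 * |w| ^ (-(1 + β))) =
            C * |w| ^ (-(1 + β)) := by field_simp
        have h4 : C * |w| ^ (-(1 + β)) ≤ 2 * C / tailLimit β * stableDensity β w := by
          rw [← h3]; gcongr
        have h5 : 0 ≤ B / m * stableDensity β w := by positivity
        linarith
      · have h1 : m ≤ stableDensity β w := hw0 (abs_le.1 h)
        have h2 : B ≤ B / m * stableDensity β w := by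
          rw [div_mul_eq_mul_div, le_div_iff₀ hm0]; gcongr
        have h5 : 0 ≤ 2 * C / tailLimit β * stableDensity β w := by positivity
        linarith [hB1 w]
    refine ((integrable_stableDensity hβ hβ2).const_mul
      ((B / m + 2 * C / tailLimit β) ^ 2)).mono' hmeas.aestronglyMeasurable
      (ae_of_all _ fun w => ?_)
    have hp := hpos w
    rw [scaleIntegrand_eq, Real.norm_of_nonneg (by positivity), div_le_iff₀ hp, ← sq_abs]
    calc |scaleScore β w| ^ 2 ≤ ((B / m + 2 * C / tailLimit β) * stableDensity β w) ^ 2 := by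
          gcongr; exact hle w
      _ = _ := by ring

/-! ### The compound Poisson law -/

/-- The `n`-fold convolution power of a measure on `ℝ`. -/
def iterConv (μ : Measure ℝ) : ℕ → Measure ℝ
  | 0 => Measure.dirac 0
  | n + 1 => Measure.conv μ (iterConv μ n)

instance isProbabilityMeasure_iterConv (μ : Measure ℝ) [IsProbabilityMeasure μ] (n : ℕ) :
    IsProbabilityMeasure (iterConv μ n) := by
  induction n with
  | zero => rw [iterConv]; infer_instance
  | succ n ih => rw [iterConv]; infer_instance

lemma charFun_iterConv (μ : Measure ℝ) [IsProbabilityMeasure μ] (n : ℕ) (u : ℝ) :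
    charFun (iterConv μ n) u = charFun μ u ^ n := by
  induction n with
  | zero => simp [iterConv, charFun_dirac]
  | succ n ih => rw [iterConv, charFun_conv, ih, pow_succ']

/-- The Poisson weights of mean `L`. -/
def poissonWeight (L : ℝ) (n : ℕ) : ℝ := Real.exp (-L) * (L ^ n / n.factorial)

lemma poissonWeight_nonneg {L : ℝ} (hL : 0 ≤ L) (n : ℕ) : 0 ≤ poissonWeight L n := by
  unfold poissonWeight; positivity

lemma poissonWeight_zero (L : ℝ) : poissonWeight L 0 = Real.exp (-L) := by simp [poissonWeight]

lemma succ_mul_poissonWeight_succ (L : ℝ) (n : ℕ) :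
    (n + 1) * poissonWeight L (n + 1) = L * poissonWeight L n := by
  have : ((n : ℝ) + 1) ≠ 0 := by positivity
  have h2 : (n.factorial : ℝ) ≠ 0 := by positivity
  rw [poissonWeight, poissonWeight, Nat.factorial_succ]
  push_cast
  field_simp
  ring

lemma hasSum_poissonWeight (L : ℝ) : HasSum (poissonWeight L) 1 := by
  have h : HasSum (fun n : ℕ => L ^ n / n.factorial) (Real.exp L) := by
    rw [Real.exp_eq_exp_ℝ]; exact NormedSpace.expSeries_div_hasSum_exp L
  have := h.mul_left (Real.exp (-L))
  rwa [← Real.exp_add, neg_add_cancel, Real.exp_zero] at this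

lemma hasSum_nat_mul_poissonWeight (L : ℝ) : HasSum (fun n : ℕ => n * poissonWeight L n) L := by
  rw [← hasSum_nat_add_iff' 1]
  have : (fun n : ℕ => ((n + 1 : ℕ) : ℝ) * poissonWeight L (n + 1)) =
      fun n => L * poissonWeight L n := by
    ext n; push_cast; exact succ_mul_poissonWeight_succ L n
  rw [this]
  simpa using (hasSum_poissonWeight L).mul_left L

lemma hasSum_sq_mul_poissonWeight (L : ℝ) :
    HasSum (fun n : ℕ => ((n : ℝ) + 1) ^ 2 * poissonWeight L (n + 1)) (L + L ^ 2) := by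
  have e : (fun n : ℕ => ((n : ℝ) + 1) ^ 2 * poissonWeight L (n + 1)) =
      fun n => L * (n * poissonWeight L n + poissonWeight L n) := by
    ext n; rw [sq, mul_assoc, succ_mul_poissonWeight_succ]; ring
  rw [e]
  have := ((hasSum_nat_mul_poissonWeight L).add (hasSum_poissonWeight L)).mul_left L
  convert! this using 1; ring

/-- The compound Poisson law with `L` expected jumps of law `μ`. -/
def compoundPoisson (L : ℝ) (μ : Measure ℝ) : Measure ℝ :=
  Measure.sum fun n => ENNReal.ofReal (poissonWeight L n) • iterConv μ n

lemma lintegral_compoundPoisson (L : ℝ) (μ : Measure ℝ) (φ : ℝ → ENNReal) :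
    ∫⁻ y, φ y ∂compoundPoisson L μ =
      ∑' n, ENNReal.ofReal (poissonWeight L n) * ∫⁻ y, φ y ∂iterConv μ n := by
  rw [compoundPoisson, lintegral_sum_measure]
  simp_rw [lintegral_smul_measure, smul_eq_mul]

lemma isProbabilityMeasure_compoundPoisson {L : ℝ} (hL : 0 ≤ L) (μ : Measure ℝ)
    [IsProbabilityMeasure μ] : IsProbabilityMeasure (compoundPoisson L μ) := by
  constructor
  have h := lintegral_compoundPoisson L μ fun _ => 1
  simp only [lintegral_const, one_mul, measure_univ, mul_one] at h
  rw [h, ← ENNReal.ofReal_tsum_of_nonneg (poissonWeight_nonneg hL) (hasSum_poissonWeight L).summable,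
    (hasSum_poissonWeight L).tsum_eq, ENNReal.ofReal_one]

lemma integrable_exp_mul_I (ν : Measure ℝ) [IsFiniteMeasure ν] (u : ℝ) :
    Integrable (fun x : ℝ => Complex.exp (u * x * Complex.I)) ν := by
  refine (integrable_const (1 : ℝ)).mono' (by
    apply Continuous.aestronglyMeasurable; fun_prop) (ae_of_all _ fun x => ?_)
  rw [← Complex.ofReal_mul, Complex.norm_exp_ofReal_mul_I]

lemma charFun_compoundPoisson {L : ℝ} (hL : 0 ≤ L) (μ : Measure ℝ) [IsProbabilityMeasure μ]
    (u : ℝ) : charFun (compoundPoisson L μ) u = Complex.exp (L * (charFun μ u - 1)) := by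
  have := isProbabilityMeasure_compoundPoisson hL μ
  have h1 := hasSum_integral_measure (f := fun x : ℝ => Complex.exp (u * x * Complex.I))
    (μ := fun n => ENNReal.ofReal (poissonWeight L n) • iterConv μ n)
    (integrable_exp_mul_I (compoundPoisson L μ) u)
  have h2 : HasSum (fun n : ℕ => Complex.exp (-L) * ((L * charFun μ u) ^ n / n.factorial))
      (Complex.exp (-L) * Complex.exp (L * charFun μ u)) := by
    refine HasSum.mul_left _ ?_
    rw [Complex.exp_eq_exp_ℂ]; exact NormedSpace.expSeries_div_hasSum_exp _
  rw [← Complex.exp_add] at h2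
  rw [charFun_apply_real, compoundPoisson]
  refine h1.unique ?_
  convert! h2 using 1
  · ext n
    rw [integral_smul_measure, ENNReal.toReal_ofReal (poissonWeight_nonneg hL n),
      ← charFun_apply_real, charFun_iterConv, poissonWeight, Complex.real_smul]
    push_cast
    ring
  · congr 1; ring

/-- The drift of the triple cancels the truncation term. -/
lemma levyExponent_compoundPoisson {lam : ℝ} (hlam : 0 ≤ lam) (μ : Measure ℝ)
    [IsProbabilityMeasure μ] (u : ℝ) :
    levyExponent (lam * ∫ x in {y : ℝ | |y| ≤ 1}, x ∂μ) 0 (ENNReal.ofReal lam • μ) u =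
      lam * (charFun μ u - 1) := by
  have hA : MeasurableSet {y : ℝ | |y| ≤ 1} := measurableSet_le measurable_abs measurable_const
  have hind : Integrable (Set.indicator {y : ℝ | |y| ≤ 1}
      (fun y : ℝ => Complex.I * u * y)) μ := by
    refine (integrable_const |u|).mono' (Measurable.aestronglyMeasurable
      (Measurable.indicator (by fun_prop) hA)) (ae_of_all _ fun x => ?_)
    by_cases hx : x ∈ {y : ℝ | |y| ≤ 1}
    · rw [Set.indicator_of_mem hx]
      simp only [norm_mul, Complex.norm_I, Complex.norm_real, Real.norm_eq_abs, one_mul]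
      exact mul_le_of_le_one_right (abs_nonneg u) hx
    · rw [Set.indicator_of_notMem hx, norm_zero]; exact abs_nonneg u
  have hexp : Integrable (fun x : ℝ => Complex.exp (Complex.I * u * x)) μ := by
    convert! integrable_exp_mul_I μ u using 3; ring
  have h1 : ∫ x : ℝ, Complex.exp (Complex.I * u * x) ∂μ = charFun μ u := by
    rw [charFun_apply_real]; congr 1; ext x; congr 1; ring
  have hexp1 : Integrable (fun x : ℝ => Complex.exp (Complex.I * u * x) - 1) μ :=
    hexp.sub (integrable_const 1)
  rw [levyExponent, integral_smul_measure, ENNReal.toReal_ofReal hlam,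
    integral_sub hexp1 hind, integral_sub hexp (integrable_const 1), h1,
    integral_indicator hA, integral_const_mul, integral_complex_ofReal]
  simp only [integral_const, Complex.real_smul, probReal_univ]
  push_cast
  ring

lemma IsCompoundPoisson.map_eq {Ω : Type*} [MeasurableSpace Ω] {P : Measure Ω}
    [IsProbabilityMeasure P] {lam : ℝ} (hlam : 0 ≤ lam) {μ : Measure ℝ} [IsProbabilityMeasure μ]
    {Y : ℝ≥0 → Ω → ℝ} (hY : IsCompoundPoisson P lam μ Y) (t : ℝ≥0) :
    P.map (Y t) = compoundPoisson (lam * t) μ := by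
  have := isProbabilityMeasure_compoundPoisson (mul_nonneg hlam t.coe_nonneg) μ
  have := Measure.isProbabilityMeasure_map (μ := P) (hY.measurable t).aemeasurable
  apply Measure.ext_of_charFun
  ext u
  rw [hY.charFun_eq, levyExponent_compoundPoisson hlam,
    charFun_compoundPoisson (mul_nonneg hlam t.coe_nonneg)]
  push_cast
  congr 1; ring

/-! ### The jump density -/

/-- The regularity of the density of the jumps. -/
structure IsJumpDensity (f : ℝ → ℝ) : Prop where
  nonneg : ∀ u, 0 ≤ f u
  integrable : Integrable f
  differentiable : Differentiable ℝ f
  tendsto_mul : Tendsto (fun u => u * f u) (cocompact ℝ) (𝓝 0)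
  integrable_multIntegrand : Integrable (multIntegrand f)

/-- The derivative `k(u) = u f'(u) + f(u)` of `u f(u)`: the score of the scale family of `f`, times
the density. -/
def multScore (f : ℝ → ℝ) (u : ℝ) : ℝ := u * deriv f u + f u

lemma multIntegrand_eq (f : ℝ → ℝ) (u : ℝ) : multIntegrand f u = multScore f u ^ 2 / f u := rfl

/-- The Fourier transform of `multScore f`, with the sign convention of `charFun`. -/
def scoreFourier (f : ℝ → ℝ) (v : ℝ) : ℂ :=
  ∫ y : ℝ, Complex.exp (v * y * Complex.I) * multScore f y

lemma norm_exp_mul_I (v y : ℝ) : ‖Complex.exp (v * y * Complex.I)‖ = 1 := by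
  rw [← Complex.ofReal_mul, Complex.norm_exp_ofReal_mul_I]

lemma norm_scoreFourier_le (f : ℝ → ℝ) (v : ℝ) :
    ‖scoreFourier f v‖ ≤ ∫ y, |multScore f y| := by
  refine (norm_integral_le_integral_norm _).trans_eq ?_
  congr 1; ext y
  rw [norm_mul, norm_exp_mul_I, one_mul, Complex.norm_real, Real.norm_eq_abs]

lemma integrable_exp_mul {f : ℝ → ℝ} (hf : Integrable f) (v : ℝ) :
    Integrable fun y : ℝ => Complex.exp (v * y * Complex.I) * (f y : ℂ) :=
  hf.ofReal.bdd_mul (c := 1) (by apply Continuous.aestronglyMeasurable; fun_prop)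
    (ae_of_all _ fun y => (norm_exp_mul_I v y).le)

namespace IsJumpDensity

variable {f : ℝ → ℝ}

lemma multIntegrand_nonneg (hf : IsJumpDensity f) (u : ℝ) : 0 ≤ multIntegrand f u :=
  div_nonneg (sq_nonneg _) (hf.nonneg u)

/-- At a zero of the nonnegative function `f` its derivative vanishes too. -/
lemma multScore_eq_zero (hf : IsJumpDensity f) {u : ℝ} (hu : f u = 0) : multScore f u = 0 := by
  have : IsLocalMin f u := Eventually.of_forall fun v => by rw [hu]; exact hf.nonneg v
  rw [multScore, this.deriv_eq_zero, hu]; ring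

lemma multScore_sq (hf : IsJumpDensity f) (u : ℝ) :
    multScore f u ^ 2 = f u * multIntegrand f u := by
  rcases eq_or_ne (f u) 0 with h | h
  · rw [hf.multScore_eq_zero h, h]; ring
  · rw [multIntegrand_eq, mul_div_cancel₀ _ h]

lemma measurable_multScore (hf : IsJumpDensity f) : Measurable (multScore f) :=
  (measurable_id.mul (measurable_deriv f)).add hf.differentiable.continuous.measurable

lemma measurable_multIntegrand (hf : IsJumpDensity f) : Measurable (multIntegrand f) :=
  (hf.measurable_multScore.pow_const 2).div hf.differentiable.continuous.measurable

/-- By `k ^ 2 = f * (k ^ 2 / f)`, the function `|k|` is at most the sum of the two factors. -/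
lemma integrable_multScore (hf : IsJumpDensity f) : Integrable (multScore f) := by
  refine (hf.integrable.add hf.integrable_multIntegrand).mono'
    hf.measurable_multScore.aestronglyMeasurable (ae_of_all _ fun u => ?_)
  have h1 := hf.nonneg u
  have h2 := hf.multIntegrand_nonneg u
  rw [Real.norm_eq_abs, Pi.add_apply]
  refine abs_le_of_sq_le_sq ?_ (by positivity)
  rw [hf.multScore_sq]
  nlinarith [mul_nonneg h1 h2, sq_nonneg (f u), sq_nonneg (multIntegrand f u)]

lemma exists_bound (hf : IsJumpDensity f) : ∃ M, 0 ≤ M ∧ ∀ u, f u ≤ M := by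
  have h1 := hf.tendsto_mul.eventually (Metric.ball_mem_nhds (0 : ℝ) one_pos)
  obtain ⟨K, hK, hK1⟩ := mem_cocompact.1 h1
  obtain ⟨M, hM⟩ := (hK.union (isCompact_Icc (a := (-1 : ℝ)) (b := 1))).exists_bound_of_continuousOn
    hf.differentiable.continuous.continuousOn
  refine ⟨max M 1, by positivity, fun u => ?_⟩
  by_cases hu : u ∈ K ∪ Set.Icc (-1 : ℝ) 1
  · exact (Real.le_norm_self _).trans ((hM u hu).trans (le_max_left _ _))
  · rw [Set.mem_union, not_or] at hu
    have h2 : |u * f u| < 1 := by simpa using hK1 hu.1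
    have h3 : 1 < |u| := by
      by_contra h; exact hu.2 (abs_le.1 (not_lt.1 h))
    rw [abs_mul, abs_of_nonneg (hf.nonneg u)] at h2
    have := hf.nonneg u
    exact le_max_of_le_right (by nlinarith)

lemma hasDerivAt_id_mul (hf : IsJumpDensity f) (u : ℝ) :
    HasDerivAt (fun u => u * f u) (multScore f u) u := by
  refine ((hasDerivAt_id u).mul (hf.differentiable u).hasDerivAt).congr_deriv ?_
  simp only [multScore, id]; ring

/-- Truncated form of `∂_r ∫ exp (i r v y) f(y) dy = - r⁻¹ ∫ exp (i r v y) k(y) dy`, by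
integration by parts. -/
lemma hasDerivAt_truncated (hf : IsJumpDensity f) {r : ℝ} (hr : r ≠ 0) (v R : ℝ) :
    HasDerivAt (fun r : ℝ => ∫ y in (-R)..R, Complex.exp ((r * v : ℝ) * y * Complex.I) * (f y : ℂ))
      ((r : ℂ)⁻¹ * (Complex.exp ((r * v : ℝ) * R * Complex.I) * ((R * f R : ℝ) : ℂ) -
        Complex.exp ((r * v : ℝ) * (-R : ℝ) * Complex.I) * ((-R * f (-R) : ℝ) : ℂ) -
        ∫ y in (-R)..R, Complex.exp ((r * v : ℝ) * y * Complex.I) * multScore f y)) r := by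
  have hfc := hf.differentiable.continuous
  have hr' : (r : ℂ) ≠ 0 := Complex.ofReal_ne_zero.2 hr
  have key := intervalIntegral.hasDerivAt_integral_of_dominated_loc_of_deriv_le
    (μ := volume) (a := -R) (b := R) (x₀ := r) (s := Set.univ)
    (F := fun (r : ℝ) (y : ℝ) => Complex.exp ((r * v : ℝ) * y * Complex.I) * (f y : ℂ))
    (F' := fun (r : ℝ) (y : ℝ) =>
      Complex.exp ((r * v : ℝ) * y * Complex.I) * (v * y * Complex.I) * (f y : ℂ))
    (bound := fun y => |v * y| * |f y|) univ_mem
    (Eventually.of_forall fun r => by apply Continuous.aestronglyMeasurable; fun_prop)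
    (by apply Continuous.intervalIntegrable; fun_prop)
    (by apply Continuous.aestronglyMeasurable; fun_prop)
    (ae_of_all _ fun y _ r _ => by
      rw [norm_mul, norm_mul, norm_exp_mul_I, one_mul, ← Complex.ofReal_mul]
      simp)
    (by apply Continuous.intervalIntegrable; fun_prop)
    (ae_of_all _ fun y _ r _ => by
      have h0 : HasDerivAt (fun r : ℝ => ((r * v : ℝ) : ℂ)) v r := by
        simpa using ((hasDerivAt_id r).mul_const v).ofReal_comp
      refine ((((h0.mul_const (y : ℂ)).mul_const Complex.I).cexp).mul_const
        (f y : ℂ)).congr_deriv ?_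
      ring)
  refine key.2.congr_deriv ?_
  have hd : ∀ y : ℝ, HasDerivAt
      (fun y : ℝ => Complex.exp ((r * v : ℝ) * y * Complex.I) * ((y * f y : ℝ) : ℂ))
      (r * (Complex.exp ((r * v : ℝ) * y * Complex.I) * (v * y * Complex.I) * (f y : ℂ)) +
        Complex.exp ((r * v : ℝ) * y * Complex.I) * multScore f y) y := by
    intro y
    have h0 : HasDerivAt (fun y : ℝ => (y : ℂ)) 1 y := Complex.ofRealCLM.hasDerivAt
    refine ((((h0.const_mul ((r * v : ℝ) : ℂ)).mul_const Complex.I).cexp).mul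
      (hf.hasDerivAt_id_mul y).ofReal_comp).congr_deriv ?_
    push_cast
    ring
  have hi1 : IntervalIntegrable (fun y : ℝ =>
      (r : ℂ) * (Complex.exp ((r * v : ℝ) * y * Complex.I) * (v * y * Complex.I) * (f y : ℂ)))
      volume (-R) R := by apply Continuous.intervalIntegrable; fun_prop
  have hi2 : IntervalIntegrable (fun y : ℝ =>
      Complex.exp ((r * v : ℝ) * y * Complex.I) * multScore f y) volume (-R) R :=
    (integrable_exp_mul hf.integrable_multScore (r * v)).intervalIntegrable
  have hftc := intervalIntegral.integral_eq_sub_of_hasDerivAt (fun y _ => hd y) (hi1.add hi2)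
  rw [intervalIntegral.integral_add hi1 hi2, intervalIntegral.integral_const_mul] at hftc
  rw [eq_inv_mul_iff_mul_eq₀ hr', ← hftc]
  ring

/-- Scaling a jump law differentiates its Fourier transform into that of the score, without any
moment assumption. -/
lemma hasDerivAt_fourier (hf : IsJumpDensity f) {r : ℝ} (hr : r ≠ 0) (v : ℝ) :
    HasDerivAt (fun r : ℝ => ∫ y : ℝ, Complex.exp ((r * v : ℝ) * y * Complex.I) * (f y : ℂ))
      (-((r : ℂ)⁻¹ * scoreFourier f (r * v))) r := by
  set δ := |r| / 2 with hδ
  have hδ0 : 0 < δ := by have := abs_pos.2 hr; positivity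
  set S : Set ℝ := {x | δ < |x|} with hS
  have hSo : IsOpen S := isOpen_lt continuous_const continuous_abs
  have hrS : r ∈ S := by
    have := abs_pos.2 hr
    change |r| / 2 < |r|
    linarith
  have hS0 : ∀ x ∈ S, x ≠ 0 := fun x hx h0 => by
    have : δ < |x| := hx
    rw [h0, abs_zero] at this; linarith
  refine hasDerivAt_of_tendstoUniformlyOn (l := atTop) (s := S) hSo
    (f := fun R : ℝ => fun r : ℝ =>
      ∫ y in (-R)..R, Complex.exp ((r * v : ℝ) * y * Complex.I) * (f y : ℂ))
    (f' := fun R : ℝ => fun r : ℝ =>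
      ((r : ℂ)⁻¹ * (Complex.exp ((r * v : ℝ) * R * Complex.I) * ((R * f R : ℝ) : ℂ) -
        Complex.exp ((r * v : ℝ) * (-R : ℝ) * Complex.I) * ((-R * f (-R) : ℝ) : ℂ) -
        ∫ y in (-R)..R, Complex.exp ((r * v : ℝ) * y * Complex.I) * multScore f y)))
    (g' := fun r : ℝ => -((r : ℂ)⁻¹ * scoreFourier f (r * v)))
    ?_ (Eventually.of_forall fun R x hx => hf.hasDerivAt_truncated (hS0 x hx) v R)
    (fun x _ => intervalIntegral_tendsto_integral
      (integrable_exp_mul hf.integrable (x * v)) tendsto_neg_atTop_atBot tendsto_id) hrS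
  have hk := hf.integrable_multScore
  have hka : Integrable fun y => |multScore f y| := hk.abs
  have hbd : ∀ R : ℝ, 0 ≤ R → ∀ x ∈ S,
      dist (-((x : ℂ)⁻¹ * scoreFourier f (x * v)))
        ((x : ℂ)⁻¹ * (Complex.exp ((x * v : ℝ) * R * Complex.I) * ((R * f R : ℝ) : ℂ) -
        Complex.exp ((x * v : ℝ) * (-R : ℝ) * Complex.I) * ((-R * f (-R) : ℝ) : ℂ) -
        ∫ y in (-R)..R, Complex.exp ((x * v : ℝ) * y * Complex.I) * multScore f y)) ≤
      δ⁻¹ * (|R * f R| + |-R * f (-R)| +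
        ((∫ y, |multScore f y|) - ∫ y in (-R)..R, |multScore f y|)) := by
    intro R hR x hx
    have hx' : δ < |x| := hx
    rw [dist_comm, dist_eq_norm, sub_neg_eq_add, ← mul_add, norm_mul, norm_inv, Complex.norm_real,
      Real.norm_eq_abs]
    refine mul_le_mul (inv_anti₀ hδ0 hx'.le) ?_ (norm_nonneg _) (by positivity)
    have e : scoreFourier f (x * v) -
        ∫ y in (-R)..R, Complex.exp ((x * v : ℝ) * y * Complex.I) * multScore f y =
        ∫ y in (Set.Ioc (-R) R)ᶜ, Complex.exp ((x * v : ℝ) * y * Complex.I) * multScore f y := by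
      rw [scoreFourier, intervalIntegral.integral_of_le (by linarith),
        ← integral_add_compl measurableSet_Ioc (integrable_exp_mul hk (x * v))]
      ring
    have e2 : (∫ y, |multScore f y|) - ∫ y in (-R)..R, |multScore f y| =
        ∫ y in (Set.Ioc (-R) R)ᶜ, |multScore f y| := by
      rw [intervalIntegral.integral_of_le (by linarith),
        ← integral_add_compl measurableSet_Ioc hka]
      ring
    rw [sub_add_eq_add_sub, add_sub_assoc, e, e2]
    refine (norm_add_le _ _).trans (add_le_add ((norm_sub_le _ _).trans_eq ?_) ?_)
    · rw [norm_mul, norm_mul, norm_exp_mul_I, norm_exp_mul_I, one_mul, one_mul, Complex.norm_real,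
        Complex.norm_real, Real.norm_eq_abs, Real.norm_eq_abs]
    · refine (norm_integral_le_integral_norm _).trans_eq ?_
      congr 1; ext y
      rw [norm_mul, norm_exp_mul_I, one_mul, Complex.norm_real, Real.norm_eq_abs]
  have hlim : Tendsto (fun R : ℝ => δ⁻¹ * (|R * f R| + |-R * f (-R)| +
        ((∫ y, |multScore f y|) - ∫ y in (-R)..R, |multScore f y|))) atTop (𝓝 0) := by
    have h1 : Tendsto (fun R : ℝ => R * f R) atTop (𝓝 0) :=
      hf.tendsto_mul.mono_left atTop_le_cocompact
    have h2 : Tendsto (fun R : ℝ => -R * f (-R)) atTop (𝓝 0) :=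
      (hf.tendsto_mul.mono_left atBot_le_cocompact).comp tendsto_neg_atTop_atBot
    have h3 := intervalIntegral_tendsto_integral hka tendsto_neg_atTop_atBot tendsto_id
    have := ((h1.abs.add h2.abs).add (h3.const_sub (∫ y, |multScore f y|))).const_mul δ⁻¹
    simpa using this
  rw [Metric.tendstoUniformlyOn_iff]
  intro ε hε
  filter_upwards [hlim.eventually (gt_mem_nhds hε), eventually_ge_atTop 0] with R hR hR0 x hx
  exact (hbd R hR0 x hx).trans_lt hR

end IsJumpDensity

/-! ### The density of the observation and its derivatives -/

/-- The density at `x` of `s W_1 + r Y`, where `Y` has law `G`. -/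
def mixDensity (β s r : ℝ) (G : Measure ℝ) (x : ℝ) : ℝ := ∫ y, scaledDensity β s (x - r * y) ∂G

lemma density_eq_mixDensity (β : ℝ) (Δ : ℝ≥0) (G : Measure ℝ) (σ θ x : ℝ) :
    density β Δ G σ θ x = mixDensity β (σ * (Δ : ℝ) ^ (1 / β)) θ G x := by
  simp only [density, mixDensity, scaledDensity]
  rw [integral_const_mul]

section

variable {β s : ℝ}

lemma exists_bound_scaledDensity (hβ : 0 < β) (s : ℝ) :
    ∃ B : ℝ, 0 ≤ B ∧ ∀ z, |scaledDensity β s z| ≤ B := by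
  obtain ⟨B, hB, hB1, -⟩ := exists_bound_stableDensity hβ
  refine ⟨|1 / s| * B, by positivity, fun z => ?_⟩
  rw [scaledDensity, abs_mul]
  exact mul_le_mul_of_nonneg_left (hB1 _) (abs_nonneg _)

lemma integrable_scaledDensity_sub (hβ : 0 < β) (s r x : ℝ) (G : Measure ℝ) [IsFiniteMeasure G] :
    Integrable (fun y => scaledDensity β s (x - r * y)) G := by
  obtain ⟨B, -, hB⟩ := exists_bound_scaledDensity hβ s
  have := continuous_scaledDensity hβ s
  exact (integrable_const B).mono' (by apply Continuous.aestronglyMeasurable; fun_prop)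
    (ae_of_all _ fun y => hB _)

lemma exists_bound_mixDensity (hβ : 0 < β) (s r : ℝ) (G : Measure ℝ) [IsProbabilityMeasure G] :
    ∃ B : ℝ, 0 ≤ B ∧ ∀ x, |mixDensity β s r G x| ≤ B := by
  obtain ⟨B, hB0, hB⟩ := exists_bound_scaledDensity hβ s
  refine ⟨B, hB0, fun x => ?_⟩
  have := norm_integral_le_of_norm_le_const (μ := G) (f := fun y => scaledDensity β s (x - r * y))
    (ae_of_all _ fun y => hB (x - r * y))
  simpa [mixDensity] using this

lemma continuous_mixDensity (hβ : 0 < β) (s r : ℝ) (G : Measure ℝ) [IsFiniteMeasure G] :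
    Continuous (mixDensity β s r G) := by
  obtain ⟨B, -, hB⟩ := exists_bound_scaledDensity hβ s
  have := continuous_scaledDensity hβ s
  exact continuous_of_dominated (bound := fun _ => B)
    (fun x => by apply Continuous.aestronglyMeasurable; fun_prop)
    (fun x => ae_of_all _ fun y => hB _) (integrable_const B)
    (ae_of_all _ fun y => by fun_prop)

lemma scaledDensity_pos (hpos : ∀ w, 0 < stableDensity β w) (hs : 0 < s) (z : ℝ) :
    0 < scaledDensity β s z := mul_pos (by positivity) (hpos _)

lemma mixDensity_pos (hβ : 0 < β) (hpos : ∀ w, 0 < stableDensity β w) (hs : 0 < s) (r : ℝ)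
    (G : Measure ℝ) [IsProbabilityMeasure G] (x : ℝ) : 0 < mixDensity β s r G x := by
  rw [mixDensity, integral_pos_iff_support_of_nonneg
    (fun y => (scaledDensity_pos hpos hs _).le) (integrable_scaledDensity_sub hβ s r x G)]
  have : Function.support (fun y => scaledDensity β s (x - r * y)) = Set.univ :=
    Set.eq_univ_of_forall fun y => (scaledDensity_pos hpos hs _).ne'
  rw [this]
  simp

lemma ofReal_mixDensity (hβ : 0 < β) (hpos : ∀ w, 0 < stableDensity β w) (hs : 0 < s) (r : ℝ)
    (G : Measure ℝ) [IsProbabilityMeasure G] (x : ℝ) :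
    ENNReal.ofReal (mixDensity β s r G x) =
      ∫⁻ y, ENNReal.ofReal (scaledDensity β s (x - r * y)) ∂G :=
  ofReal_integral_eq_lintegral_ofReal (integrable_scaledDensity_sub hβ s r x G)
    (ae_of_all _ fun _ => (scaledDensity_pos hpos hs _).le)

lemma integral_scaledDensity (hβ : 0 < β) (hβ2 : β ≤ 2) (hs : 0 < s) :
    ∫ z, scaledDensity β s z = 1 := by
  have h := integral_exp_mul_scaledDensity hβ hβ2 hs 0
  simp only [Complex.ofReal_zero, zero_mul, Complex.exp_zero, one_mul, mul_zero] at h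
  rw [integral_complex_ofReal] at h
  have h2 := Complex.ofReal_injective h
  rw [h2, stableChar, abs_zero, Real.zero_rpow hβ.ne']
  simp

lemma lintegral_scaledDensity (hβ : 0 < β) (hβ2 : β ≤ 2) (hpos : ∀ w, 0 < stableDensity β w)
    (hs : 0 < s) : ∫⁻ z, ENNReal.ofReal (scaledDensity β s z) = 1 := by
  rw [← ofReal_integral_eq_lintegral_ofReal (integrable_scaledDensity hβ hβ2 hs)
    (ae_of_all _ fun z => (scaledDensity_pos hpos hs z).le), integral_scaledDensity hβ hβ2 hs,
    ENNReal.ofReal_one]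

lemma lintegral_lintegral_scaledDensity (hβ : 0 < β) (hβ2 : β ≤ 2)
    (hpos : ∀ w, 0 < stableDensity β w) (hs : 0 < s) (r : ℝ) (G : Measure ℝ)
    [IsProbabilityMeasure G] :
    ∫⁻ x, ∫⁻ y, ENNReal.ofReal (scaledDensity β s (x - r * y)) ∂G = 1 := by
  have hc := continuous_scaledDensity hβ s
  rw [lintegral_lintegral_swap (by
    apply Measurable.aemeasurable; simp only [Function.uncurry_def]
    exact ENNReal.measurable_ofReal.comp (by fun_prop))]
  have : ∀ y : ℝ, ∫⁻ x, ENNReal.ofReal (scaledDensity β s (x - r * y)) = 1 := fun y => by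
    rw [lintegral_sub_right_eq_self (fun x => ENNReal.ofReal (scaledDensity β s x)) (r * y)]
    exact lintegral_scaledDensity hβ hβ2 hpos hs
  simp [this]

lemma lintegral_mixDensity (hβ : 0 < β) (hβ2 : β ≤ 2)
    (hpos : ∀ w, 0 < stableDensity β w) (hs : 0 < s) (r : ℝ) (G : Measure ℝ)
    [IsProbabilityMeasure G] : ∫⁻ x, ENNReal.ofReal (mixDensity β s r G x) = 1 := by
  simp_rw [ofReal_mixDensity hβ hpos hs]
  exact lintegral_lintegral_scaledDensity hβ hβ2 hpos hs r G

lemma integrable_mixDensity (hβ : 0 < β) (hβ2 : β ≤ 2)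
    (hpos : ∀ w, 0 < stableDensity β w) (hs : 0 < s) (r : ℝ) (G : Measure ℝ)
    [IsProbabilityMeasure G] : Integrable (mixDensity β s r G) := by
  refine ⟨(continuous_mixDensity hβ s r G).aestronglyMeasurable, ?_⟩
  rw [hasFiniteIntegral_iff_ofReal (ae_of_all _ fun x => (mixDensity_pos hβ hpos hs r G x).le),
    lintegral_mixDensity hβ hβ2 hpos hs]
  exact ENNReal.one_lt_top

/-- The Fourier transform of the mixture density. -/
lemma integral_exp_mul_mixDensity (hβ : 0 < β) (hβ2 : β ≤ 2)
    (hpos : ∀ w, 0 < stableDensity β w) (hs : 0 < s) (r : ℝ) (G : Measure ℝ)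
    [IsProbabilityMeasure G] (u : ℝ) :
    ∫ x : ℝ, Complex.exp (u * x * Complex.I) * mixDensity β s r G x =
      stableChar β (s * u) * charFun G (r * u) := by
  have hc := continuous_scaledDensity hβ s
  have h1 : ∀ x : ℝ, Complex.exp (u * x * Complex.I) * mixDensity β s r G x =
      ∫ y, Complex.exp (u * x * Complex.I) * scaledDensity β s (x - r * y) ∂G := by
    intro x
    rw [integral_const_mul, mixDensity, integral_complex_ofReal]
  simp_rw [h1]
  rw [integral_integral_swap]
  · have h2 : ∀ y : ℝ, ∫ x : ℝ, Complex.exp (u * x * Complex.I) * scaledDensity β s (x - r * y) =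
        stableChar β (s * u) * Complex.exp ((r * u : ℝ) * y * Complex.I) := by
      intro y
      have e : ∀ x : ℝ, Complex.exp (u * x * Complex.I) * scaledDensity β s (x - r * y) =
          Complex.exp ((r * u : ℝ) * y * Complex.I) *
          (fun z : ℝ => Complex.exp (u * z * Complex.I) * scaledDensity β s z) (x - r * y) := by
        intro x
        simp only
        rw [← mul_assoc, ← Complex.exp_add]
        congr 2; push_cast; ring
      simp_rw [e]
      rw [integral_const_mul, integral_sub_right_eq_self
        (fun z : ℝ => Complex.exp (u * z * Complex.I) * scaledDensity β s z) (r * y),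
        integral_exp_mul_scaledDensity hβ hβ2 hs, mul_comm]
    simp_rw [h2]
    rw [integral_const_mul, charFun_apply_real]
  · have hm : Continuous (Function.uncurry fun (x y : ℝ) =>
        Complex.exp (u * x * Complex.I) * (scaledDensity β s (x - r * y) : ℂ)) := by
      simp only [Function.uncurry_def]; fun_prop
    refine (integrable_prod_iff' hm.aestronglyMeasurable).2 ⟨ae_of_all _ fun y => ?_, ?_⟩
    · exact ((integrable_scaledDensity hβ hβ2 hs).comp_sub_right (r * y)).ofReal.bdd_mul (c := 1)
        (by apply Continuous.aestronglyMeasurable; fun_prop)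
        (ae_of_all _ fun x => (norm_exp_mul_I u x).le)
    · have e : ∀ y : ℝ, ∫ x : ℝ, ‖Complex.exp (u * x * Complex.I) *
          (scaledDensity β s (x - r * y) : ℂ)‖ = 1 := by
        intro y
        rw [← integral_scaledDensity hβ hβ2 hs,
          ← integral_sub_right_eq_self (scaledDensity β s) (r * y)]
        congr 1; ext x
        rw [norm_mul, norm_exp_mul_I, one_mul, Complex.norm_real,
          Real.norm_of_nonneg (scaledDensity_pos hpos hs _).le]
      simp only [Function.uncurry_apply_pair, e]
      exact integrable_const 1

/-- The convolution of `ρ` (in place of `h_β`) with the law of `r Y`. -/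
def scoreMix (β s r : ℝ) (G : Measure ℝ) (x : ℝ) : ℝ :=
  ∫ y, 1 / s * scaleScore β ((x - r * y) / s) ∂G

lemma hasDerivAt_scaledDensity (hβ : 0 < β) (hs : s ≠ 0) (z : ℝ) :
    HasDerivAt (fun s => scaledDensity β s z) (-(1 / s) * (1 / s * scaleScore β (z / s))) s := by
  have h1 : HasDerivAt (fun s : ℝ => 1 / s) (-(1 / s ^ 2)) s := by
    simpa using hasDerivAt_inv hs
  have h2 : HasDerivAt (fun s : ℝ => z / s) (z * -(1 / s ^ 2)) s := by
    simpa [div_eq_mul_inv] using (hasDerivAt_inv hs).const_mul z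
  have h3 := h1.mul (((differentiable_stableDensity hβ (z / s)).hasDerivAt).comp s h2)
  refine h3.congr_deriv ?_
  simp only [Function.comp, scaleScore]
  field_simp
  ring

lemma hasDerivAt_mixDensity_scale (hβ : 0 < β) (hβ2 : β ≤ 2) (hs : 0 < s) (r : ℝ)
    (G : Measure ℝ) [IsProbabilityMeasure G] (x : ℝ) :
    HasDerivAt (fun s => mixDensity β s r G x) (-(1 / s) * scoreMix β s r G x) s := by
  obtain ⟨B, hB0, hB⟩ := exists_bound_scaleScore hβ hβ2
  have hρ := measurable_scaleScore hβ
  have key := hasDerivAt_integral_of_dominated_loc_of_deriv_le (μ := G)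
    (F := fun s y => scaledDensity β s (x - r * y))
    (F' := fun s y => -(1 / s) * (1 / s * scaleScore β ((x - r * y) / s))) (x₀ := s)
    (s := Set.Ioi (s / 2)) (bound := fun _ => 1 / (s / 2) * (1 / (s / 2) * B))
    (isOpen_Ioi.mem_nhds (by simpa using hs))
    (Eventually.of_forall fun t => by
      have := continuous_scaledDensity hβ t
      apply Continuous.aestronglyMeasurable; fun_prop)
    (integrable_scaledDensity_sub hβ s r x G)
    (by apply Measurable.aestronglyMeasurable; fun_prop)
    (ae_of_all _ fun y t ht => by
      have ht : s / 2 < t := ht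
      have ht0 : 0 < t := lt_trans (by positivity) ht
      rw [norm_mul, norm_mul, norm_neg, Real.norm_of_nonneg (by positivity : 0 ≤ 1 / t),
        Real.norm_eq_abs]
      have := hB ((x - r * y) / t)
      gcongr)
    (integrable_const _)
    (ae_of_all _ fun y t ht => by
      have ht0 : 0 < t := lt_trans (by positivity) (show s / 2 < t from ht)
      exact hasDerivAt_scaledDensity hβ ht0.ne' (x - r * y))
  refine key.2.congr_deriv ?_
  rw [integral_const_mul]; rfl

end

section

variable {β s : ℝ} {f : ℝ → ℝ}

/-- The law with density `f`. -/
def jumpLaw (f : ℝ → ℝ) : Measure ℝ := volume.withDensity fun u => ENNReal.ofReal (f u)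

lemma IsJumpDensity.charFun_jumpLaw (hf : IsJumpDensity f) (u : ℝ) :
    charFun (jumpLaw f) u = ∫ y : ℝ, Complex.exp (u * y * Complex.I) * (f y : ℂ) := by
  rw [jumpLaw, charFun_withDensity_ofReal hf.differentiable.continuous.measurable]
  congr 1; ext x; rw [max_eq_left (hf.nonneg x)]

lemma IsJumpDensity.continuous_scoreFourier (hf : IsJumpDensity f) :
    Continuous (scoreFourier f) := by
  refine continuous_of_dominated (bound := fun y => |multScore f y|) (fun v => ?_)
    (fun v => ae_of_all _ fun y => ?_) hf.integrable_multScore.abs (ae_of_all _ fun y => ?_)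
  · exact (integrable_exp_mul hf.integrable_multScore v).aestronglyMeasurable
  · rw [norm_mul, norm_exp_mul_I, one_mul, Complex.norm_real, Real.norm_eq_abs]
  · fun_prop

lemma IsJumpDensity.hasDerivAt_charFun_compoundPoisson (hf : IsJumpDensity f)
    [IsProbabilityMeasure (jumpLaw f)] {L : ℝ} (hL : 0 ≤ L) {r : ℝ} (hr : r ≠ 0) (v : ℝ) :
    HasDerivAt (fun r : ℝ => charFun (compoundPoisson L (jumpLaw f)) (r * v))
      (-((L / r : ℝ) : ℂ) * (charFun (compoundPoisson L (jumpLaw f)) (r * v) *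
        scoreFourier f (r * v))) r := by
  have h1 : HasDerivAt (fun r : ℝ => charFun (jumpLaw f) (r * v))
      (-((r : ℂ)⁻¹ * scoreFourier f (r * v))) r := by
    have := hf.hasDerivAt_fourier hr v
    refine this.congr_of_eventuallyEq (Eventually.of_forall fun r => ?_)
    exact hf.charFun_jumpLaw (r * v)
  have h2 := ((h1.sub_const 1).const_mul (L : ℂ)).cexp
  simp_rw [charFun_compoundPoisson hL]
  refine h2.congr_deriv ?_
  push_cast
  ring

/-- The derivative of the density in `θ` is `- L / θ` times its convolution with the score `k` of
the jump density: differentiating the Fourier transform `exp (L (φ_μ (θ u) - 1))` brings down one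
factor `∂_θ φ_μ (θ u)`. -/
lemma IsJumpDensity.hasDerivAt_mixDensity_jump (hf : IsJumpDensity f)
    [IsProbabilityMeasure (jumpLaw f)] (hβ : 0 < β) (hs : 0 < s)
    {L : ℝ} (hL : 0 ≤ L) {θ : ℝ} (hθ : θ ≠ 0) (x : ℝ) :
    HasDerivAt (fun r => mixDensity β s r (compoundPoisson L (jumpLaw f)) x)
      (-(L / θ) * ∫ w, mixDensity β s θ (compoundPoisson L (jumpLaw f)) (x - θ * w) *
        multScore f w) θ := by
  have := isProbabilityMeasure_compoundPoisson hL (jumpLaw f)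
  set G := compoundPoisson L (jumpLaw f) with hG
  have hg := continuous_stableChar hβ
  have hgi := integrable_stableChar_mul hβ hs
  have hκ := hf.continuous_scoreFourier
  have hφ : Measurable (charFun G) := measurable_charFun
  set A := ∫ y, |multScore f y| with hA
  have hA0 : 0 ≤ A := integral_nonneg fun y => abs_nonneg _
  have hθ0 := abs_pos.2 hθ
  have hS : {r : ℝ | |θ| / 2 < |r|} ∈ 𝓝 θ :=
    (isOpen_lt continuous_const continuous_abs).mem_nhds (by
      change |θ| / 2 < |θ|; linarith)
  have key := hasDerivAt_integral_of_dominated_loc_of_deriv_le (μ := volume)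
    (F := fun (r u : ℝ) => Complex.exp (-(u * x * Complex.I)) * stableChar β (s * u) *
      charFun G (r * u))
    (F' := fun (r u : ℝ) => Complex.exp (-(u * x * Complex.I)) * stableChar β (s * u) *
      (-((L / r : ℝ) : ℂ) * (charFun G (r * u) * scoreFourier f (r * u))))
    (x₀ := θ) (s := {r : ℝ | |θ| / 2 < |r|})
    (bound := fun u => stableChar β (s * u) * (L / (|θ| / 2) * A)) hS
    (Eventually.of_forall fun r => by apply Measurable.aestronglyMeasurable; fun_prop)
    (by
      refine hgi.mono' (by apply Measurable.aestronglyMeasurable; fun_prop)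
        (ae_of_all _ fun u => ?_)
      rw [norm_mul, norm_mul, Complex.norm_real, Real.norm_of_nonneg (stableChar_nonneg _ _)]
      have e : -((u : ℂ) * x * Complex.I) = ((-u : ℝ) : ℂ) * x * Complex.I := by push_cast; ring
      rw [e, norm_exp_mul_I, one_mul]
      exact mul_le_of_le_one_right (stableChar_nonneg _ _) (norm_charFun_le_one _))
    (by apply Measurable.aestronglyMeasurable; fun_prop)
    (ae_of_all _ fun u r hr => by
      have hr : |θ| / 2 < |r| := hr
      rw [norm_mul, norm_mul, Complex.norm_real, Real.norm_of_nonneg (stableChar_nonneg _ _)]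
      have e : -((u : ℂ) * x * Complex.I) = ((-u : ℝ) : ℂ) * x * Complex.I := by push_cast; ring
      rw [e, norm_exp_mul_I, one_mul]
      refine mul_le_mul_of_nonneg_left ?_ (stableChar_nonneg _ _)
      rw [norm_mul, norm_mul, norm_neg, Complex.norm_real, Real.norm_eq_abs, abs_div,
        abs_of_nonneg hL]
      have h1 : ‖charFun G (r * u)‖ ≤ 1 := norm_charFun_le_one _
      have h2 := norm_scoreFourier_le f (r * u)
      have h3 : ‖charFun G (r * u)‖ * ‖scoreFourier f (r * u)‖ ≤ A :=
        (mul_le_of_le_one_left (norm_nonneg _) h1).trans h2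
      gcongr)
    (hgi.mul_const _)
    (ae_of_all _ fun u r hr => by
      have hr : |θ| / 2 < |r| := hr
      have hr0 : r ≠ 0 := abs_pos.1 (lt_trans (by positivity) hr)
      exact (hf.hasDerivAt_charFun_compoundPoisson hL hr0 u).const_mul _)
  have h1 := key.2.const_mul (2 * Real.pi : ℂ)⁻¹
  have h2 : HasDerivAt (fun r => ((mixDensity β s r G x : ℝ) : ℂ)) _ θ :=
    h1.congr_of_eventuallyEq (Eventually.of_forall fun r =>
      ofReal_integral_scaledDensity hβ hs G r x)
  have h3 := Complex.reCLM.hasFDerivAt.comp_hasDerivAt θ h2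
  have h4 : HasDerivAt (fun r => mixDensity β s r G x) _ θ := h3
  refine h4.congr_deriv ?_
  -- the convolution on the right-hand side in Fourier form
  have h5 : ((∫ w, mixDensity β s θ G (x - θ * w) * multScore f w : ℝ) : ℂ) =
      (2 * Real.pi : ℂ)⁻¹ * ∫ u : ℝ, Complex.exp (-(u * x * Complex.I)) * stableChar β (s * u) *
        (charFun G (θ * u) * scoreFourier f (θ * u)) := by
    rw [← integral_complex_ofReal]
    have e1 : ∀ w : ℝ, ((mixDensity β s θ G (x - θ * w) * multScore f w : ℝ) : ℂ) =
        (2 * Real.pi : ℂ)⁻¹ * ∫ u : ℝ, Complex.exp (-(u * (x - θ * w : ℝ) * Complex.I)) *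
          stableChar β (s * u) * charFun G (θ * u) * multScore f w := by
      intro w
      rw [integral_mul_const, ← mul_assoc, ← ofReal_integral_scaledDensity hβ hs G θ (x - θ * w),
        Complex.ofReal_mul]
      rfl
    simp_rw [e1]
    rw [integral_const_mul, integral_integral_swap]
    · congr 2; ext u
      rw [scoreFourier, ← mul_assoc, ← integral_const_mul]
      congr 1; ext w
      have e : Complex.exp (-(u * (x - θ * w : ℝ) * Complex.I)) =
          Complex.exp (-(u * x * Complex.I)) * Complex.exp ((θ * u : ℝ) * w * Complex.I) := by
        rw [← Complex.exp_add]; congr 1; push_cast; ring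
      rw [e]; ring
    · have hi : Integrable (fun p : ℝ × ℝ => multScore f p.1 * stableChar β (s * p.2))
          (volume.prod volume) := hf.integrable_multScore.mul_prod hgi
      have hk := hf.measurable_multScore
      refine hi.norm.mono' ?_ (ae_of_all _ fun p => ?_)
      · apply Measurable.aestronglyMeasurable
        simp only [Function.uncurry_def]
        fun_prop
      · simp only [Function.uncurry_def]
        have e : -((p.2 : ℂ) * (x - θ * p.1 : ℝ) * Complex.I) =
          ((-p.2 : ℝ) : ℂ) * (x - θ * p.1 : ℝ) * Complex.I := by push_cast; ring
        rw [norm_mul, norm_mul, norm_mul, norm_mul, e, norm_exp_mul_I, one_mul,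
          Complex.norm_real, Complex.norm_real, mul_comm ‖multScore f p.1‖]
        refine mul_le_mul_of_nonneg_right ?_ (norm_nonneg _)
        exact mul_le_of_le_one_right (norm_nonneg _) (norm_charFun_le_one _)
  rw [Complex.reCLM_apply]
  have e2 : ∀ u : ℝ, Complex.exp (-(u * x * Complex.I)) * stableChar β (s * u) *
      (-((L / θ : ℝ) : ℂ) * (charFun G (θ * u) * scoreFourier f (θ * u))) =
      -((L / θ : ℝ) : ℂ) * (Complex.exp (-(u * x * Complex.I)) * stableChar β (s * u) *
        (charFun G (θ * u) * scoreFourier f (θ * u))) := fun u => by ring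
  simp_rw [e2]
  rw [integral_const_mul, mul_left_comm, ← h5, ← Complex.ofReal_neg, ← Complex.ofReal_mul,
    Complex.ofReal_re]

end

/-! ### Upper bounds for the information -/

/-- Cauchy-Schwarz in a form without square roots. -/
lemma sq_lintegral_le_of_sq_le_mul {α : Type*} [MeasurableSpace α] {ν : Measure α}
    {A B C : α → ENNReal} (hB : AEMeasurable B ν) (hC : AEMeasurable C ν)
    (h : ∀ a, A a ^ 2 ≤ B a * C a) : (∫⁻ a, A a ∂ν) ^ 2 ≤ (∫⁻ a, B a ∂ν) * ∫⁻ a, C a ∂ν := by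
  have h1 : ∀ a, A a ≤ ((fun a => B a ^ (1 / 2 : ℝ)) * fun a => C a ^ (1 / 2 : ℝ)) a := by
    intro a
    rw [Pi.mul_apply, ← ENNReal.mul_rpow_of_nonneg _ _ (by norm_num)]
    have := ENNReal.rpow_le_rpow (h a) (by norm_num : (0 : ℝ) ≤ 1 / 2)
    rwa [← ENNReal.rpow_natCast, ← ENNReal.rpow_mul, show ((2 : ℕ) : ℝ) * (1 / 2) = 1 by norm_num,
      ENNReal.rpow_one] at this
  have h2 := (lintegral_mono h1).trans (ENNReal.lintegral_mul_le_Lp_mul_Lq ν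
    Real.HolderConjugate.two_two (hB.pow_const _) (hC.pow_const _))
  have h3 : ∀ b : ENNReal, (b ^ (1 / 2 : ℝ)) ^ (2 : ℝ) = b := fun b => by
    rw [← ENNReal.rpow_mul]; norm_num
  simp only [h3] at h2
  rw [← ENNReal.mul_rpow_of_nonneg _ _ (by norm_num)] at h2
  have h4 := ENNReal.rpow_le_rpow h2 (by norm_num : (0 : ℝ) ≤ 2)
  rw [h3] at h4
  simpa using h4

lemma sq_tsum_le_of_sq_le_mul {A B C : ℕ → ENNReal} (h : ∀ n, A n ^ 2 ≤ B n * C n) :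
    (∑' n, A n) ^ 2 ≤ (∑' n, B n) * ∑' n, C n := by
  have := sq_lintegral_le_of_sq_le_mul (ν := Measure.count) (A := A) (B := B) (C := C)
    (measurable_of_countable _).aemeasurable (measurable_of_countable _).aemeasurable h
  simpa [lintegral_count] using this

section

variable {β s : ℝ} {f : ℝ → ℝ}

lemma measurable_scoreMix (hβ : 0 < β) (s r : ℝ) (G : Measure ℝ) [IsFiniteMeasure G] :
    Measurable (scoreMix β s r G) := by
  have := measurable_scaleScore hβ
  have h : StronglyMeasurable (Function.uncurry fun x y : ℝ =>
      1 / s * scaleScore β ((x - r * y) / s)) := by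
    apply Measurable.stronglyMeasurable; simp only [Function.uncurry_def]; fun_prop
  exact h.integral_prod_right.measurable

/-- Data processing for the scale parameter, pointwise in the observation. -/
lemma ofReal_scoreMix_sq_div_le (hβ : 0 < β) (hpos : ∀ w, 0 < stableDensity β w)
    (hs : 0 < s) (r : ℝ) (G : Measure ℝ) [IsProbabilityMeasure G] (x : ℝ) :
    ENNReal.ofReal (scoreMix β s r G x ^ 2 / mixDensity β s r G x) ≤
      ∫⁻ y, ENNReal.ofReal (1 / s * scaleIntegrand β ((x - r * y) / s)) ∂G := by
  have hp := mixDensity_pos hβ hpos hs r G x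
  have hρ := measurable_scaleScore hβ
  have hh := (continuous_stableDensity hβ).measurable
  have hsi : Measurable (scaleIntegrand β) := (hρ.pow_const 2).div hh
  have hsd := (continuous_scaledDensity hβ s).measurable
  rw [ENNReal.ofReal_div_of_pos hp]
  refine ENNReal.div_le_of_le_mul ?_
  have h1 := sq_lintegral_le_of_sq_le_mul (ν := G)
    (A := fun y => ENNReal.ofReal |1 / s * scaleScore β ((x - r * y) / s)|)
    (B := fun y => ENNReal.ofReal (scaledDensity β s (x - r * y)))
    (C := fun y => ENNReal.ofReal (1 / s * scaleIntegrand β ((x - r * y) / s)))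
    (by apply Measurable.aemeasurable; fun_prop) (by apply Measurable.aemeasurable; fun_prop)
    (fun y => by
      have hw := hpos ((x - r * y) / s)
      rw [← ENNReal.ofReal_pow (abs_nonneg _), ← ENNReal.ofReal_mul
        (scaledDensity_pos hpos hs _).le, sq_abs]
      apply ENNReal.ofReal_le_ofReal
      rw [scaledDensity, scaleIntegrand_eq]
      apply le_of_eq
      field_simp)
  rw [← ofReal_mixDensity hβ hpos hs, mul_comm] at h1
  refine le_trans ?_ h1
  rw [← sq_abs, ENNReal.ofReal_pow (abs_nonneg _)]
  gcongr
  simp_rw [← Real.enorm_eq_ofReal_abs]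
  exact enorm_integral_le_lintegral_enorm _

/-- The observation carries no more information on the scale than `s W_1` does. -/
lemma lintegral_scoreMix_sq_div_le (hβ : 0 < β) (hβ2 : β ≤ 2)
    (hpos : ∀ w, 0 < stableDensity β w) (hs : 0 < s) (r : ℝ) (G : Measure ℝ)
    [IsProbabilityMeasure G] :
    ∫⁻ x, ENNReal.ofReal (scoreMix β s r G x ^ 2 / mixDensity β s r G x) ≤
      ENNReal.ofReal (scaleInfo β) := by
  have hρ := measurable_scaleScore hβ
  have hh := (continuous_stableDensity hβ).measurable
  have hsi : Measurable (scaleIntegrand β) := (hρ.pow_const 2).div hh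
  have hnn : ∀ w, 0 ≤ scaleIntegrand β w := fun w => div_nonneg (sq_nonneg _) (hpos w).le
  refine (lintegral_mono (ofReal_scoreMix_sq_div_le hβ hpos hs r G)).trans_eq ?_
  rw [lintegral_lintegral_swap (by
    apply Measurable.aemeasurable; simp only [Function.uncurry_def]
    fun_prop)]
  have : ∀ y : ℝ, ∫⁻ x, ENNReal.ofReal (1 / s * scaleIntegrand β ((x - r * y) / s)) =
      ENNReal.ofReal (scaleInfo β) := fun y => by
    rw [lintegral_sub_right_eq_self
      (fun x => ENNReal.ofReal (1 / s * scaleIntegrand β (x / s))) (r * y),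
      ← ofReal_integral_eq_lintegral_ofReal
      (((integrable_scaleIntegrand hβ hβ2 hpos).comp_div hs.ne').const_mul _)
      (ae_of_all _ fun x => mul_nonneg (by positivity) (hnn _)),
      integral_const_mul, Measure.integral_comp_div, abs_of_pos hs, scaleInfo, smul_eq_mul,
      ← mul_assoc, one_div_mul_cancel hs.ne', one_mul]
  simp_rw [this]
  simp

/-- The density of `s W_1 + θ S_n`, with `S_n` a sum of `n` jumps. -/
def stepDensity (β s θ : ℝ) (μ : Measure ℝ) (n : ℕ) (x : ℝ) : ENNReal :=
  ∫⁻ y, ENNReal.ofReal (scaledDensity β s (x - θ * y)) ∂iterConv μ n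

lemma measurable_stepDensity (hβ : 0 < β) (s θ : ℝ) (μ : Measure ℝ) [IsProbabilityMeasure μ]
    (n : ℕ) : Measurable (stepDensity β s θ μ n) := by
  have hsd := (continuous_scaledDensity hβ s).measurable
  have h : Measurable (Function.uncurry fun x y : ℝ =>
      ENNReal.ofReal (scaledDensity β s (x - θ * y))) := by
    simp only [Function.uncurry_def]; fun_prop
  exact h.lintegral_prod_right'

/-- Conditioning on the last jump. -/
lemma IsJumpDensity.stepDensity_succ (hf : IsJumpDensity f) [IsProbabilityMeasure (jumpLaw f)]
    (hβ : 0 < β) (s θ : ℝ) (n : ℕ) (x : ℝ) :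
    stepDensity β s θ (jumpLaw f) (n + 1) x =
      ∫⁻ w, stepDensity β s θ (jumpLaw f) n (x - θ * w) * ENNReal.ofReal (f w) := by
  have hsd := (continuous_scaledDensity hβ s).measurable
  have hm := measurable_stepDensity hβ s θ (jumpLaw f) n
  have hfm := hf.differentiable.continuous.measurable
  rw [stepDensity, iterConv, Measure.lintegral_conv (by fun_prop)]
  have e : ∀ w : ℝ, ∫⁻ y, ENNReal.ofReal (scaledDensity β s (x - θ * (w + y)))
      ∂iterConv (jumpLaw f) n = stepDensity β s θ (jumpLaw f) n (x - θ * w) := by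
    intro w; rw [stepDensity]; congr 1; ext y; congr 2; ring
  simp_rw [e]
  nth_rewrite 1 [jumpLaw]
  rw [lintegral_withDensity_eq_lintegral_mul _ hfm.ennreal_ofReal (by fun_prop)]
  congr 1; ext w
  rw [Pi.mul_apply, mul_comm]

lemma ofReal_mixDensity_eq_tsum (hβ : 0 < β) (hpos : ∀ w, 0 < stableDensity β w) (hs : 0 < s)
    (θ : ℝ) {L : ℝ} (hL : 0 ≤ L) (μ : Measure ℝ) [IsProbabilityMeasure μ] (x : ℝ) :
    ENNReal.ofReal (mixDensity β s θ (compoundPoisson L μ) x) =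
      ∑' n, ENNReal.ofReal (poissonWeight L n) * stepDensity β s θ μ n x := by
  have := isProbabilityMeasure_compoundPoisson hL μ
  rw [ofReal_mixDensity hβ hpos hs, lintegral_compoundPoisson]
  rfl

/-- The convolution of the density of the observation with the score of the jump density. -/
def jumpScoreMix (β s θ L : ℝ) (f : ℝ → ℝ) (x : ℝ) : ℝ :=
  ∫ w, mixDensity β s θ (compoundPoisson L (jumpLaw f)) (x - θ * w) * multScore f w

lemma IsJumpDensity.measurable_jumpScoreMix (hf : IsJumpDensity f)
    [IsProbabilityMeasure (jumpLaw f)] (hβ : 0 < β) (s θ : ℝ) {L : ℝ} (hL : 0 ≤ L) :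
    Measurable (jumpScoreMix β s θ L f) := by
  have := isProbabilityMeasure_compoundPoisson hL (jumpLaw f)
  have h1 := (continuous_mixDensity hβ s θ (compoundPoisson L (jumpLaw f))).measurable
  have h2 := hf.measurable_multScore
  have h : StronglyMeasurable (Function.uncurry fun x w : ℝ =>
      mixDensity β s θ (compoundPoisson L (jumpLaw f)) (x - θ * w) * multScore f w) := by
    apply Measurable.stronglyMeasurable; simp only [Function.uncurry_def]; fun_prop
  exact h.integral_prod_right.measurable

/-- Cauchy-Schwarz over the number of jumps and the last jump. Conditionally on `n + 1` jumps, the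
score is a sum of `n + 1` terms, whence the weights `(n + 1) ^ 2`. -/
lemma IsJumpDensity.ofReal_jumpScoreMix_sq_div_le (hf : IsJumpDensity f)
    [IsProbabilityMeasure (jumpLaw f)] (hβ : 0 < β)
    (hpos : ∀ w, 0 < stableDensity β w) (hs : 0 < s) (θ : ℝ) {L : ℝ} (hL : 0 ≤ L) (x : ℝ) :
    ENNReal.ofReal ((L * jumpScoreMix β s θ L f x) ^ 2 /
        mixDensity β s θ (compoundPoisson L (jumpLaw f)) x) ≤
      ∑' n : ℕ, ENNReal.ofReal (((n : ℝ) + 1) ^ 2 * poissonWeight L (n + 1)) *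
        ∫⁻ w, stepDensity β s θ (jumpLaw f) n (x - θ * w) *
          ENNReal.ofReal (multIntegrand f w) := by
  have := isProbabilityMeasure_compoundPoisson hL (jumpLaw f)
  have hp := mixDensity_pos hβ hpos hs θ (compoundPoisson L (jumpLaw f)) x
  have hkm := hf.measurable_multScore
  have him := hf.measurable_multIntegrand
  have hfm := hf.differentiable.continuous.measurable
  have hqm := measurable_stepDensity hβ s θ (jumpLaw f)
  set E : ℕ → ENNReal := fun n =>
    ∫⁻ w, stepDensity β s θ (jumpLaw f) n (x - θ * w) * ENNReal.ofReal |multScore f w| with hE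
  set C : ℕ → ENNReal := fun n =>
    ∫⁻ w, stepDensity β s θ (jumpLaw f) n (x - θ * w) * ENNReal.ofReal (multIntegrand f w) with hC
  have hEC : ∀ n, E n ^ 2 ≤ stepDensity β s θ (jumpLaw f) (n + 1) x * C n := by
    intro n
    rw [hf.stepDensity_succ hβ]
    have := hqm n
    refine sq_lintegral_le_of_sq_le_mul (by apply Measurable.aemeasurable; fun_prop)
      (by apply Measurable.aemeasurable; fun_prop) fun w => ?_
    rw [mul_pow, ← ENNReal.ofReal_pow (abs_nonneg _), sq_abs, hf.multScore_sq,
      ENNReal.ofReal_mul (hf.nonneg w)]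
    apply le_of_eq; ring
  have hS : ENNReal.ofReal |L * jumpScoreMix β s θ L f x| ≤
      ∑' n : ℕ, ENNReal.ofReal (((n : ℝ) + 1) * poissonWeight L (n + 1)) * E n := by
    rw [abs_mul, abs_of_nonneg hL, ENNReal.ofReal_mul hL]
    have h1 : ENNReal.ofReal |jumpScoreMix β s θ L f x| ≤
        ∑' n : ℕ, ENNReal.ofReal (poissonWeight L n) * E n := by
      rw [← Real.enorm_eq_ofReal_abs]
      refine (enorm_integral_le_lintegral_enorm _).trans_eq ?_
      have e : ∀ w, ‖mixDensity β s θ (compoundPoisson L (jumpLaw f)) (x - θ * w) *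
          multScore f w‖ₑ = ∑' n : ℕ, ENNReal.ofReal (poissonWeight L n) *
            (stepDensity β s θ (jumpLaw f) n (x - θ * w) * ENNReal.ofReal |multScore f w|) := by
        intro w
        rw [enorm_mul, Real.enorm_of_nonneg
          (mixDensity_pos hβ hpos hs θ (compoundPoisson L (jumpLaw f)) _).le,
          ofReal_mixDensity_eq_tsum hβ hpos hs θ hL, Real.enorm_eq_ofReal_abs,
          ← ENNReal.tsum_mul_right]
        simp_rw [mul_assoc]
      simp_rw [e]
      rw [lintegral_tsum fun n => by
        have := hqm n
        apply Measurable.aemeasurable; fun_prop]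
      congr 1; ext n
      have := hqm n
      rw [lintegral_const_mul _ (by fun_prop)]
    refine (mul_le_mul_right h1 _).trans_eq ?_
    rw [← ENNReal.tsum_mul_left]
    congr 1; ext n
    rw [← mul_assoc, ← ENNReal.ofReal_mul hL, succ_mul_poissonWeight_succ]
  rw [ENNReal.ofReal_div_of_pos hp]
  refine ENNReal.div_le_of_le_mul ?_
  rw [← sq_abs, ENNReal.ofReal_pow (abs_nonneg _)]
  refine (pow_le_pow_left' hS 2).trans ((sq_tsum_le_of_sq_le_mul
    (B := fun n => ENNReal.ofReal (poissonWeight L (n + 1)) *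
      stepDensity β s θ (jumpLaw f) (n + 1) x)
    (C := fun n => ENNReal.ofReal (((n : ℝ) + 1) ^ 2 * poissonWeight L (n + 1)) * C n)
    fun n => ?_).trans ?_)
  · have hw := poissonWeight_nonneg hL (n + 1)
    rw [mul_pow, ← ENNReal.ofReal_pow (by positivity)]
    calc ENNReal.ofReal ((((n : ℝ) + 1) * poissonWeight L (n + 1)) ^ 2) * E n ^ 2
        ≤ ENNReal.ofReal ((((n : ℝ) + 1) * poissonWeight L (n + 1)) ^ 2) *
          (stepDensity β s θ (jumpLaw f) (n + 1) x * C n) := by gcongr; exact hEC n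
      _ = _ := by
        rw [show (((n : ℝ) + 1) * poissonWeight L (n + 1)) ^ 2 =
          poissonWeight L (n + 1) * (((n : ℝ) + 1) ^ 2 * poissonWeight L (n + 1)) by ring,
          ENNReal.ofReal_mul hw]
        ring
  · rw [mul_comm]
    gcongr
    rw [ofReal_mixDensity_eq_tsum hβ hpos hs θ hL]
    exact ENNReal.tsum_comp_le_tsum_of_injective (add_left_injective 1) _

/-- The information on the jump scale is at most `𝔼 (N ^ 2) 𝓛`, with `N` the Poisson number of
jumps. -/
lemma IsJumpDensity.lintegral_jumpScoreMix_sq_div_le (hf : IsJumpDensity f)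
    [IsProbabilityMeasure (jumpLaw f)] (hβ : 0 < β) (hβ2 : β ≤ 2)
    (hpos : ∀ w, 0 < stableDensity β w) (hs : 0 < s) (θ : ℝ) {L : ℝ} (hL : 0 ≤ L) :
    ∫⁻ x, ENNReal.ofReal ((L * jumpScoreMix β s θ L f x) ^ 2 /
        mixDensity β s θ (compoundPoisson L (jumpLaw f)) x) ≤
      ENNReal.ofReal ((L + L ^ 2) * multInfo f) := by
  have him := hf.measurable_multIntegrand
  have hqm := measurable_stepDensity hβ s θ (jumpLaw f)
  have hI : ∀ n, ∫⁻ x, ∫⁻ w, stepDensity β s θ (jumpLaw f) n (x - θ * w) *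
      ENNReal.ofReal (multIntegrand f w) = ENNReal.ofReal (multInfo f) := by
    intro n
    have := hqm n
    rw [lintegral_lintegral_swap (by
      apply Measurable.aemeasurable; simp only [Function.uncurry_def]; fun_prop)]
    have e : ∀ w : ℝ, ∫⁻ x, stepDensity β s θ (jumpLaw f) n (x - θ * w) *
        ENNReal.ofReal (multIntegrand f w) = ENNReal.ofReal (multIntegrand f w) := by
      intro w
      rw [lintegral_mul_const _ (by fun_prop),
        lintegral_sub_right_eq_self (stepDensity β s θ (jumpLaw f) n) (θ * w)]
      have := lintegral_lintegral_scaledDensity hβ hβ2 hpos hs θ (iterConv (jumpLaw f) n)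
      simp only [stepDensity]
      rw [this, one_mul]
    simp_rw [e]
    rw [multInfo, ofReal_integral_eq_lintegral_ofReal hf.integrable_multIntegrand
      (ae_of_all _ hf.multIntegrand_nonneg)]
  refine (lintegral_mono fun x =>
    hf.ofReal_jumpScoreMix_sq_div_le hβ hpos hs θ hL x).trans_eq ?_
  have hm2 : ∀ n, Measurable fun x => ∫⁻ w, stepDensity β s θ (jumpLaw f) n (x - θ * w) *
      ENNReal.ofReal (multIntegrand f w) := by
    intro n
    have := hqm n
    have h : Measurable (Function.uncurry fun x w : ℝ =>
        stepDensity β s θ (jumpLaw f) n (x - θ * w) * ENNReal.ofReal (multIntegrand f w)) := by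
      simp only [Function.uncurry_def]; fun_prop
    exact h.lintegral_prod_right'
  rw [lintegral_tsum fun n => ((hm2 n).const_mul _).aemeasurable]
  simp_rw [lintegral_const_mul _ (hm2 _), hI]
  rw [ENNReal.tsum_mul_right, ← ENNReal.ofReal_tsum_of_nonneg
    (fun n => by have := poissonWeight_nonneg hL (n + 1); positivity)
    (hasSum_sq_mul_poissonWeight L).summable, (hasSum_sq_mul_poissonWeight L).tsum_eq,
    ← ENNReal.ofReal_mul (by positivity)]

end

/-! ### Lower semicontinuity and approximate identities -/

/-- Fatou's lemma along a filter, when pointwise lower semicontinuity is only available almost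
everywhere along a subsequence of each sequence. -/
lemma eventually_lt_lintegral {ι α : Type*} [MeasurableSpace α] {ν : Measure α} {l : Filter ι}
    [l.IsCountablyGenerated] {F : ι → α → ENNReal} {F₀ : α → ENNReal}
    (hF : ∀ᶠ t in l, Measurable (F t))
    (h : ∀ u : ℕ → ι, Tendsto u atTop l → ∃ φ : ℕ → ℕ, StrictMono φ ∧
      ∀ᵐ x ∂ν, F₀ x ≤ liminf (fun n => F (u (φ n)) x) atTop)
    {c : ENNReal} (hc : c < ∫⁻ x, F₀ x ∂ν) : ∀ᶠ t in l, c < ∫⁻ x, F t x ∂ν := by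
  by_contra hcon
  have hfr : ∃ᶠ t in l, ∫⁻ x, F t x ∂ν ≤ c := by
    refine fun hev => hcon (hev.mono fun t ht => not_le.1 ht)
  obtain ⟨u, hu, hu2⟩ := exists_seq_forall_of_frequently (hfr.and_eventually hF)
  obtain ⟨φ, -, hφ⟩ := h u hu
  have h1 : ∫⁻ x, F₀ x ∂ν ≤ c := calc
    ∫⁻ x, F₀ x ∂ν ≤ ∫⁻ x, liminf (fun n => F (u (φ n)) x) atTop ∂ν := lintegral_mono_ae hφ
    _ ≤ liminf (fun n => ∫⁻ x, F (u (φ n)) x ∂ν) atTop :=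
      lintegral_liminf_le fun n => (hu2 (φ n)).2
    _ ≤ c := by
      refine (liminf_le_liminf (v := fun _ => c)
        (Eventually.of_forall fun n => (hu2 (φ n)).1)).trans_eq ?_
      exact liminf_const c
  exact (hc.trans_le h1).false

lemma eventually_lt_lintegral_of_tendsto {ι α : Type*} [MeasurableSpace α] {ν : Measure α}
    {l : Filter ι} [l.IsCountablyGenerated] {F : ι → α → ENNReal} {F₀ : α → ENNReal}
    (hF : ∀ᶠ t in l, Measurable (F t))
    (h : ∀ x, Tendsto (fun t => F t x) l (𝓝 (F₀ x)))
    {c : ENNReal} (hc : c < ∫⁻ x, F₀ x ∂ν) : ∀ᶠ t in l, c < ∫⁻ x, F t x ∂ν :=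
  eventually_lt_lintegral hF (fun _ hu => ⟨id, strictMono_id, ae_of_all _ fun x =>
    ((h x).comp hu).liminf_eq.ge⟩) hc

lemma lintegral_comp_mul_left {F : ℝ → ENNReal} (hF : Measurable F) {a : ℝ} (ha : a ≠ 0) :
    ∫⁻ z, F (a * z) = ENNReal.ofReal |a⁻¹| * ∫⁻ z, F z := by
  have h := lintegral_map (μ := volume) hF (measurable_const_mul a)
  rw [Real.map_volume_mul_left ha, lintegral_smul_measure, smul_eq_mul] at h
  exact h.symm

lemma lintegral_comp_sub_mul {F : ℝ → ENNReal} (hF : Measurable F) {a : ℝ} (ha : a ≠ 0) (x : ℝ) :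
    ∫⁻ z, F (x - a * z) = ENNReal.ofReal |a⁻¹| * ∫⁻ z, F z := by
  rw [lintegral_comp_mul_left (F := fun z => F (x - z)) (by fun_prop) ha,
    lintegral_sub_left_eq_self F x]

/-- The densities of `s W_1` form an approximate identity as `s → 0`. -/
lemma tendsto_lintegral_scaledDensity_mul {β : ℝ} (hβ : 0 < β) (hβ2 : β ≤ 2)
    (hpos : ∀ w, 0 < stableDensity β w) {ι : Type*} {l : Filter ι} [l.IsCountablyGenerated]
    {s : ι → ℝ} (hs : ∀ᶠ t in l, 0 < s t) (hs0 : Tendsto s l (𝓝 0)) {T : ℝ → ENNReal}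
    (hT : Measurable T) {C : ENNReal} (hC : C ≠ ⊤) (hTC : ∀ y, T y ≤ C)
    (hcont : ContinuousAt T 0) :
    Tendsto (fun t => ∫⁻ y, ENNReal.ofReal (scaledDensity β (s t) y) * T y) l (𝓝 (T 0)) := by
  have hh := (continuous_stableDensity hβ).measurable
  have h1 : ∫⁻ z, ENNReal.ofReal (stableDensity β z) = 1 := by
    simpa [scaledDensity] using lintegral_scaledDensity hβ hβ2 hpos one_pos
  have h2 : ∀ᶠ t in l, ∫⁻ z, ENNReal.ofReal (stableDensity β z) * T (s t * z) =
      ∫⁻ y, ENNReal.ofReal (scaledDensity β (s t) y) * T y := by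
    filter_upwards [hs] with t ht
    have hsd := (continuous_scaledDensity hβ (s t)).measurable
    have := lintegral_comp_mul_left
      (F := fun y => ENNReal.ofReal (scaledDensity β (s t) y) * T y) (by fun_prop) ht.ne'
    rw [abs_of_pos (inv_pos.2 ht)] at this
    have e : ∀ z, ENNReal.ofReal (scaledDensity β (s t) (s t * z)) * T (s t * z) =
        ENNReal.ofReal (s t)⁻¹ * (ENNReal.ofReal (stableDensity β z) * T (s t * z)) := by
      intro z
      rw [scaledDensity, mul_div_cancel_left₀ _ ht.ne', one_div,
        ENNReal.ofReal_mul (inv_pos.2 ht).le, mul_assoc]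
    simp_rw [e] at this
    rw [lintegral_const_mul _ (by fun_prop)] at this
    exact (ENNReal.mul_right_inj (by simpa using ht) ENNReal.ofReal_ne_top).1 this
  refine Tendsto.congr' h2 ?_
  have h3 : T 0 = ∫⁻ z, ENNReal.ofReal (stableDensity β z) * T 0 := by
    rw [lintegral_mul_const _ (by fun_prop), h1, one_mul]
  rw [h3]
  refine tendsto_lintegral_filter_of_dominated_convergence
    (fun z => ENNReal.ofReal (stableDensity β z) * C)
    (Eventually.of_forall fun t => by fun_prop)
    (Eventually.of_forall fun t => ae_of_all _ fun z => by gcongr; exact hTC _) ?_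
    (ae_of_all _ fun z => ?_)
  · rw [lintegral_mul_const _ (by fun_prop), h1, one_mul]; exact hC
  · refine ENNReal.Tendsto.const_mul ?_ (Or.inr ENNReal.ofReal_ne_top)
    have h4 : Tendsto (fun t => s t * z) l (𝓝 0) := by simpa using hs0.mul_const z
    exact hcont.tendsto.comp h4

/-- Translations act continuously on `L¹`. -/
lemma tendsto_lintegral_translate_sub {k : ℝ → ℝ} (hk : Integrable k) :
    Tendsto (fun y : ℝ => ∫⁻ x, ‖k (x - y) - k x‖ₑ) (𝓝 0) (𝓝 0) := by
  have hk1 : MemLp k 1 := memLp_one_iff_integrable.2 hk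
  have : Fact ((1 : ENNReal) ≠ ⊤) := ⟨ENNReal.one_ne_top⟩
  have hc : Continuous fun y : ℝ => DomAddAct.mk (-y) +ᵥ hk1.toLp k :=
    (DomAddAct.continuous_mk.comp continuous_neg).vadd continuous_const
  have h1 := (hc.edist (continuous_const (y := hk1.toLp k))).tendsto 0
  have e : ∀ y : ℝ, edist (DomAddAct.mk (-y) +ᵥ hk1.toLp k) (hk1.toLp k) =
      ∫⁻ x, ‖k (x - y) - k x‖ₑ := by
    intro y
    rw [DomAddAct.mk_vadd_toLp, Lp.edist_toLp_toLp, eLpNorm_one_eq_lintegral_enorm]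
    congr 1; ext x
    simp only [Pi.sub_apply, vadd_eq_add, neg_add_eq_sub]
  simp_rw [e] at h1
  simpa using h1

/-- A nonzero value requires a jump. -/
lemma compoundPoisson_compl_le {L : ℝ} (hL : 0 ≤ L) (μ : Measure ℝ) [IsProbabilityMeasure μ] :
    compoundPoisson L μ {0}ᶜ ≤ ENNReal.ofReal L := by
  have := isProbabilityMeasure_compoundPoisson hL μ
  have h1 : ENNReal.ofReal (Real.exp (-L)) ≤ compoundPoisson L μ {0} := by
    have := Measure.le_sum (fun n => ENNReal.ofReal (poissonWeight L n) • iterConv μ n) 0 {0}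
    rw [Measure.smul_apply, iterConv, poissonWeight_zero] at this
    simpa [compoundPoisson] using this
  rw [prob_compl_eq_one_sub (measurableSet_singleton 0)]
  refine (tsub_le_tsub_left h1 1).trans ?_
  rw [← ENNReal.ofReal_one, ← ENNReal.ofReal_sub _ (Real.exp_pos _).le]
  apply ENNReal.ofReal_le_ofReal
  have := Real.add_one_le_exp (-L)
  linarith

lemma lintegral_compoundPoisson_le {L : ℝ} (hL : 0 ≤ L) (μ : Measure ℝ) [IsProbabilityMeasure μ]
    {Φ : ℝ → ENNReal} {C : ENNReal} (hΦ : ∀ y, Φ y ≤ C) :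
    ∫⁻ y, Φ y ∂compoundPoisson L μ ≤ Φ 0 + C * ENNReal.ofReal L := by
  have := isProbabilityMeasure_compoundPoisson hL μ
  rw [← lintegral_add_compl _ (measurableSet_singleton (0 : ℝ))]
  refine add_le_add ?_ ?_
  · rw [lintegral_singleton]
    exact mul_le_of_le_one_right' prob_le_one
  · refine (lintegral_mono hΦ).trans ?_
    rw [setLIntegral_const]
    gcongr
    exact compoundPoisson_compl_le hL μ

lemma abs_integral_compoundPoisson_sub_le {L : ℝ} (hL : 0 ≤ L) (μ : Measure ℝ)
    [IsProbabilityMeasure μ] {φ : ℝ → ℝ} (hφ : Measurable φ) {B : ℝ} (hB : ∀ y, |φ y| ≤ B) :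
    |∫ y, φ y ∂compoundPoisson L μ - φ 0| ≤ 2 * B * L := by
  have := isProbabilityMeasure_compoundPoisson hL μ
  have hB0 : 0 ≤ B := (abs_nonneg _).trans (hB 0)
  have hi : Integrable φ (compoundPoisson L μ) :=
    (integrable_const B).mono' hφ.aestronglyMeasurable (ae_of_all _ hB)
  have e : ∫ y, φ y ∂compoundPoisson L μ - φ 0 = ∫ y, (φ y - φ 0) ∂compoundPoisson L μ := by
    rw [integral_sub hi (integrable_const _)]; simp
  rw [e, ← ENNReal.ofReal_le_ofReal_iff (by positivity), ← Real.enorm_eq_ofReal_abs]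
  refine (enorm_integral_le_lintegral_enorm _).trans
    ((lintegral_compoundPoisson_le hL μ (C := ENNReal.ofReal (2 * B)) fun y => ?_).trans ?_)
  · rw [Real.enorm_eq_ofReal_abs]
    apply ENNReal.ofReal_le_ofReal
    exact (abs_sub _ _).trans (by linarith [hB y, hB 0])
  · rw [← ENNReal.ofReal_mul (by positivity)]
    simp

/-! ### The entries `σσ` and `σθ` -/

section

variable {β : ℝ} {f : ℝ → ℝ} {ι : Type*} {l : Filter ι} {s L : ι → ℝ}

lemma tendsto_scaled_scoreMix (hβ : 0 < β) (hβ2 : β ≤ 2) (hs : ∀ᶠ t in l, 0 < s t)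
    (hL : ∀ᶠ t in l, 0 < L t) (hL0 : Tendsto L l (𝓝 0)) (θ : ℝ) (μ : Measure ℝ)
    [IsProbabilityMeasure μ] (w : ℝ) :
    Tendsto (fun t => s t * scoreMix β (s t) θ (compoundPoisson (L t) μ) (s t * w)) l
      (𝓝 (scaleScore β w)) := by
  obtain ⟨B, hB0, hB⟩ := exists_bound_scaleScore hβ hβ2
  have hm := measurable_scaleScore hβ
  rw [tendsto_iff_norm_sub_tendsto_zero]
  refine squeeze_zero' (Eventually.of_forall fun t => norm_nonneg _) ?_
    (by simpa using hL0.const_mul (2 * B))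
  filter_upwards [hs, hL] with t hst hLt
  have := abs_integral_compoundPoisson_sub_le hLt.le μ
    (φ := fun y => scaleScore β ((s t * w - θ * y) / s t)) (by fun_prop) (fun y => hB _)
  rw [scoreMix, integral_const_mul, ← mul_assoc, mul_one_div_cancel hst.ne', one_mul]
  simpa [mul_div_cancel_left₀ _ hst.ne'] using this

lemma tendsto_scaled_mixDensity (hβ : 0 < β) (hs : ∀ᶠ t in l, 0 < s t)
    (hL : ∀ᶠ t in l, 0 < L t) (hL0 : Tendsto L l (𝓝 0)) (θ : ℝ) (μ : Measure ℝ)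
    [IsProbabilityMeasure μ] (w : ℝ) :
    Tendsto (fun t => s t * mixDensity β (s t) θ (compoundPoisson (L t) μ) (s t * w)) l
      (𝓝 (stableDensity β w)) := by
  obtain ⟨B, hB0, hB, -⟩ := exists_bound_stableDensity hβ
  have hm := (continuous_stableDensity hβ).measurable
  rw [tendsto_iff_norm_sub_tendsto_zero]
  refine squeeze_zero' (Eventually.of_forall fun t => norm_nonneg _) ?_
    (by simpa using hL0.const_mul (2 * B))
  filter_upwards [hs, hL] with t hst hLt
  have := abs_integral_compoundPoisson_sub_le hLt.le μ
    (φ := fun y => stableDensity β ((s t * w - θ * y) / s t)) (by fun_prop) (fun y => hB _)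
  simp only [mixDensity, scaledDensity]
  rw [integral_const_mul, ← mul_assoc, mul_one_div_cancel hst.ne', one_mul]
  simpa [mul_div_cancel_left₀ _ hst.ne'] using this

/-- The information density of the scale parameter, before integration over the observation. -/
def scaleDensity (β s θ L : ℝ) (μ : Measure ℝ) (x : ℝ) : ℝ :=
  scoreMix β s θ (compoundPoisson L μ) x ^ 2 / mixDensity β s θ (compoundPoisson L μ) x

lemma measurable_scaleDensity (hβ : 0 < β) (s θ : ℝ) {L : ℝ} (hL : 0 ≤ L) (μ : Measure ℝ)
    [IsProbabilityMeasure μ] : Measurable (scaleDensity β s θ L μ) := by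
  have := isProbabilityMeasure_compoundPoisson hL μ
  exact ((measurable_scoreMix hβ s θ _).pow_const 2).div
    (continuous_mixDensity hβ s θ _).measurable

/-- At the scale `s` the information of the observation is asymptotically at least that of
`s W_1`, on every window. -/
lemma eventually_lt_setLIntegral_scaleDensity [l.IsCountablyGenerated]
    (hβ : 0 < β) (hβ2 : β ≤ 2) (hpos : ∀ w, 0 < stableDensity β w) (hs : ∀ᶠ t in l, 0 < s t)
    (hL : ∀ᶠ t in l, 0 < L t) (hL0 : Tendsto L l (𝓝 0)) (θ : ℝ) (μ : Measure ℝ)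
    [IsProbabilityMeasure μ] {K : Set ℝ} (hK : MeasurableSet K) {c : ENNReal}
    (hc : c < ∫⁻ w in K, ENNReal.ofReal (scaleIntegrand β w)) :
    ∀ᶠ t in l, c < ∫⁻ x in (fun x => x / s t) ⁻¹' K,
      ENNReal.ofReal (scaleDensity β (s t) θ (L t) μ x) := by
  have h1 : ∀ w, Tendsto (fun t => s t * scaleDensity β (s t) θ (L t) μ (s t * w)) l
      (𝓝 (scaleIntegrand β w)) := by
    intro w
    refine (((tendsto_scaled_scoreMix hβ hβ2 hs hL hL0 θ μ w).pow 2).div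
      (tendsto_scaled_mixDensity hβ hs hL hL0 θ μ w) (hpos w).ne').congr' ?_
    filter_upwards [hs, hL] with t hst hLt
    have := isProbabilityMeasure_compoundPoisson hLt.le μ
    have hp := mixDensity_pos hβ hpos hst θ (compoundPoisson (L t) μ) (s t * w)
    rw [scaleDensity, Pi.div_apply]
    field_simp
  have h2 := eventually_lt_lintegral_of_tendsto (ν := volume.restrict K)
    (F := fun t w => ENNReal.ofReal (s t * scaleDensity β (s t) θ (L t) μ (s t * w)))
    (F₀ := fun w => ENNReal.ofReal (scaleIntegrand β w)) (l := l)
    (by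
      filter_upwards [hL] with t hLt
      have := measurable_scaleDensity hβ (s t) θ hLt.le μ
      fun_prop)
    (fun w => (ENNReal.continuous_ofReal.tendsto _).comp (h1 w)) hc
  filter_upwards [h2, hs, hL] with t ht hst hLt
  have hm := measurable_scaleDensity hβ (s t) θ hLt.le μ
  have hS : MeasurableSet ((fun x => x / s t) ⁻¹' K) := by
    have : Measurable fun x : ℝ => x / s t := by fun_prop
    exact this hK
  have h3 := lintegral_comp_mul_left (F := ((fun x => x / s t) ⁻¹' K).indicator
    fun x => ENNReal.ofReal (scaleDensity β (s t) θ (L t) μ x))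
    ((Measurable.ennreal_ofReal hm).indicator hS) hst.ne'
  rw [lintegral_indicator hS, abs_of_pos (inv_pos.2 hst)] at h3
  have e : ∀ w, ((fun x => x / s t) ⁻¹' K).indicator
      (fun x => ENNReal.ofReal (scaleDensity β (s t) θ (L t) μ x)) (s t * w) =
      K.indicator (fun w => ENNReal.ofReal (scaleDensity β (s t) θ (L t) μ (s t * w))) w := by
    intro w
    have hiff : s t * w ∈ (fun x => x / s t) ⁻¹' K ↔ w ∈ K := by
      rw [Set.mem_preimage, mul_div_cancel_left₀ _ hst.ne']
    by_cases hw : w ∈ K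
    · rw [Set.indicator_of_mem (hiff.2 hw), Set.indicator_of_mem hw]
    · rw [Set.indicator_of_notMem (mt hiff.1 hw), Set.indicator_of_notMem hw]
  simp_rw [e] at h3
  rw [lintegral_indicator hK] at h3
  simp_rw [ENNReal.ofReal_mul hst.le] at ht
  rw [lintegral_const_mul _ (by fun_prop), h3, ← mul_assoc, ← ENNReal.ofReal_mul hst.le,
    mul_inv_cancel₀ hst.ne', ENNReal.ofReal_one, one_mul] at ht
  exact ht

lemma scaleIntegrand_nonneg (hpos : ∀ w, 0 < stableDensity β w) (w : ℝ) :
    0 ≤ scaleIntegrand β w := div_nonneg (sq_nonneg _) (hpos w).le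

lemma scaleInfo_nonneg (hpos : ∀ w, 0 < stableDensity β w) : 0 ≤ scaleInfo β :=
  integral_nonneg fun w => scaleIntegrand_nonneg hpos w

lemma tendsto_lintegral_scaleDensity [l.IsCountablyGenerated]
    (hβ : 0 < β) (hβ2 : β ≤ 2) (hpos : ∀ w, 0 < stableDensity β w) (hs : ∀ᶠ t in l, 0 < s t)
    (hL : ∀ᶠ t in l, 0 < L t) (hL0 : Tendsto L l (𝓝 0)) (θ : ℝ) (μ : Measure ℝ)
    [IsProbabilityMeasure μ] :
    Tendsto (fun t => ∫⁻ x, ENNReal.ofReal (scaleDensity β (s t) θ (L t) μ x)) l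
      (𝓝 (ENNReal.ofReal (scaleInfo β))) := by
  refine tendsto_order.2 ⟨fun c hc => ?_, fun c hc => ?_⟩
  · have h := eventually_lt_setLIntegral_scaleDensity hβ hβ2 hpos hs hL hL0 θ μ
      (K := Set.univ) (c := c) MeasurableSet.univ (by
        rwa [setLIntegral_univ, ← ofReal_integral_eq_lintegral_ofReal
          (integrable_scaleIntegrand hβ hβ2 hpos)
          (ae_of_all _ fun w => scaleIntegrand_nonneg hpos w)])
    simpa using h
  · filter_upwards [hs, hL] with t hst hLt
    have := isProbabilityMeasure_compoundPoisson hLt.le μ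
    exact (lintegral_scoreMix_sq_div_le hβ hβ2 hpos hst θ _).trans_lt hc

/-- The score of the scale parameter concentrates at observations of order `s`. -/
lemma exists_eventually_setLIntegral_scaleDensity_le [l.IsCountablyGenerated]
    (hβ : 0 < β) (hβ2 : β ≤ 2) (hpos : ∀ w, 0 < stableDensity β w) (hs : ∀ᶠ t in l, 0 < s t)
    (hL : ∀ᶠ t in l, 0 < L t) (hL0 : Tendsto L l (𝓝 0)) (θ : ℝ) (μ : Measure ℝ)
    [IsProbabilityMeasure μ] {δ : ℝ} (hδ : 0 < δ) :
    ∃ R : ℝ, 0 < R ∧ ∀ᶠ t in l, ∫⁻ x in ((fun x => x / s t) ⁻¹' Set.Icc (-R) R)ᶜ,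
      ENNReal.ofReal (scaleDensity β (s t) θ (L t) μ x) ≤ ENNReal.ofReal δ := by
  have hint := integrable_scaleIntegrand hβ hβ2 hpos
  have hup : ∀ᶠ t in l, ∫⁻ x, ENNReal.ofReal (scaleDensity β (s t) θ (L t) μ x) ≤
      ENNReal.ofReal (scaleInfo β) := by
    filter_upwards [hs, hL] with t hst hLt
    have := isProbabilityMeasure_compoundPoisson hLt.le μ
    exact lintegral_scoreMix_sq_div_le hβ hβ2 hpos hst θ _
  rcases lt_or_ge (scaleInfo β) δ with hlt | hge
  · refine ⟨1, one_pos, hup.mono fun t ht => ?_⟩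
    exact (setLIntegral_le_lintegral _ _).trans (ht.trans (ENNReal.ofReal_le_ofReal hlt.le))
  · have h1 := intervalIntegral_tendsto_integral hint tendsto_neg_atTop_atBot tendsto_id
    have h2 := (h1.eventually (lt_mem_nhds (show scaleInfo β - δ < scaleInfo β by linarith))).and
      (eventually_gt_atTop 0)
    obtain ⟨R, hR, hR0⟩ := h2.exists
    refine ⟨R, hR0, ?_⟩
    have h3 : ENNReal.ofReal (scaleInfo β - δ) <
        ∫⁻ w in Set.Icc (-R) R, ENNReal.ofReal (scaleIntegrand β w) := by
      rw [← ofReal_integral_eq_lintegral_ofReal hint.integrableOn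
        (ae_of_all _ fun w => scaleIntegrand_nonneg hpos w), integral_Icc_eq_integral_Ioc,
        ← intervalIntegral.integral_of_le (by linarith)]
      exact (ENNReal.ofReal_lt_ofReal_iff (lt_of_le_of_lt (by linarith) hR)).2 hR
    filter_upwards [hup, eventually_lt_setLIntegral_scaleDensity hβ hβ2 hpos hs hL hL0 θ μ
      measurableSet_Icc h3] with t ht1 ht2
    have hS : MeasurableSet ((fun x => x / s t) ⁻¹' Set.Icc (-R) R) := by
      have : Measurable fun x : ℝ => x / s t := by fun_prop
      exact this measurableSet_Icc
    rw [← lintegral_add_compl _ hS] at ht1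
    have h4 : ENNReal.ofReal (scaleInfo β - δ) +
        ∫⁻ x in ((fun x => x / s t) ⁻¹' Set.Icc (-R) R)ᶜ,
          ENNReal.ofReal (scaleDensity β (s t) θ (L t) μ x) ≤ ENNReal.ofReal (scaleInfo β) :=
      (add_le_add ht2.le le_rfl).trans ht1
    have h5 : ENNReal.ofReal (scaleInfo β) =
        ENNReal.ofReal (scaleInfo β - δ) + ENNReal.ofReal δ := by
      rw [← ENNReal.ofReal_add (by linarith) hδ.le, sub_add_cancel]
    rw [h5] at h4
    exact (ENNReal.add_le_add_iff_left ENNReal.ofReal_ne_top).1 h4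

lemma exp_neg_mul_scaledDensity_le_mixDensity (hβ : 0 < β) (hpos : ∀ w, 0 < stableDensity β w)
    {s : ℝ} (hs : 0 < s) (θ : ℝ) {L : ℝ} (hL : 0 ≤ L) (μ : Measure ℝ) [IsProbabilityMeasure μ]
    (x : ℝ) :
    Real.exp (-L) * scaledDensity β s x ≤ mixDensity β s θ (compoundPoisson L μ) x := by
  have := isProbabilityMeasure_compoundPoisson hL μ
  have hp := mixDensity_pos hβ hpos hs θ (compoundPoisson L μ) x
  rw [← ENNReal.ofReal_le_ofReal_iff hp.le, ofReal_mixDensity_eq_tsum hβ hpos hs θ hL]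
  refine le_trans (le_of_eq ?_) (ENNReal.le_tsum 0)
  rw [poissonWeight_zero, stepDensity, iterConv, lintegral_dirac, mul_zero, sub_zero,
    ENNReal.ofReal_mul (Real.exp_pos _).le]

/-- The score of the jump scale is at most of the order `1 / s` of the density itself. -/
lemma abs_jumpScoreMix_le {B : ℝ} (hB : ∀ w, |stableDensity β w| ≤ B)
    (hf : IsJumpDensity f) [IsProbabilityMeasure (jumpLaw f)] {s : ℝ} (hs : 0 < s) (θ : ℝ)
    {L : ℝ} (hL : 0 ≤ L) (x : ℝ) :
    |jumpScoreMix β s θ L f x| ≤ B * (∫ w, |multScore f w|) / s := by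
  have := isProbabilityMeasure_compoundPoisson hL (jumpLaw f)
  have h1 : ∀ x, |mixDensity β s θ (compoundPoisson L (jumpLaw f)) x| ≤ 1 / s * B := by
    intro x
    have h := norm_integral_le_of_norm_le_const (μ := compoundPoisson L (jumpLaw f))
      (f := fun y => scaledDensity β s (x - θ * y)) (C := 1 / s * B)
      (ae_of_all _ fun y => by
        rw [scaledDensity, norm_mul, Real.norm_of_nonneg (by positivity : 0 ≤ 1 / s)]
        exact mul_le_mul_of_nonneg_left (hB _) (by positivity))
    simpa [mixDensity] using h
  have h2 := norm_integral_le_of_norm_le (hf.integrable_multScore.abs.const_mul (1 / s * B))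
    (f := fun w => mixDensity β s θ (compoundPoisson L (jumpLaw f)) (x - θ * w) * multScore f w)
    (ae_of_all _ fun w => by
      rw [norm_mul]
      exact mul_le_mul_of_nonneg_right (h1 _) (abs_nonneg _))
  rw [integral_const_mul, Real.norm_eq_abs] at h2
  refine h2.trans_eq ?_
  ring

lemma multInfo_nonneg (hf : IsJumpDensity f) : 0 ≤ multInfo f :=
  integral_nonneg hf.multIntegrand_nonneg

/-- Cauchy-Schwarz on a window for the mixed entry of the information matrix. -/
lemma sq_setLIntegral_cross_le (hβ : 0 < β) (hpos : ∀ w, 0 < stableDensity β w)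
    (hf : IsJumpDensity f) [IsProbabilityMeasure (jumpLaw f)] {s : ℝ} (hs : 0 < s) (θ : ℝ) {L : ℝ}
    (hL : 0 ≤ L) (S : Set ℝ) :
    (∫⁻ x in S, ENNReal.ofReal |scoreMix β s θ (compoundPoisson L (jumpLaw f)) x *
        (L * jumpScoreMix β s θ L f x) / mixDensity β s θ (compoundPoisson L (jumpLaw f)) x|) ^ 2 ≤
      (∫⁻ x in S, ENNReal.ofReal (scaleDensity β s θ L (jumpLaw f) x)) *
        ∫⁻ x in S, ENNReal.ofReal ((L * jumpScoreMix β s θ L f x) ^ 2 /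
          mixDensity β s θ (compoundPoisson L (jumpLaw f)) x) := by
  have := isProbabilityMeasure_compoundPoisson hL (jumpLaw f)
  have hm1 := measurable_scaleDensity hβ s θ hL (jumpLaw f)
  have hm2 := hf.measurable_jumpScoreMix hβ s θ hL
  have hm3 := (continuous_mixDensity hβ s θ (compoundPoisson L (jumpLaw f))).measurable
  refine sq_lintegral_le_of_sq_le_mul (by fun_prop) (by fun_prop) fun x => ?_
  have hp := mixDensity_pos hβ hpos hs θ (compoundPoisson L (jumpLaw f)) x
  rw [← ENNReal.ofReal_pow (abs_nonneg _), sq_abs, scaleDensity,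
    ← ENNReal.ofReal_mul (by positivity)]
  apply le_of_eq
  congr 1
  field_simp

/-- The mixed entry is `o(√L)`: near the origin the score of `θ` is small, away from it the score
of `σ` carries no information. -/
lemma eventually_abs_cross_le [l.IsCountablyGenerated]
    (hβ : 0 < β) (hβ2 : β ≤ 2) (hpos : ∀ w, 0 < stableDensity β w) (hs : ∀ᶠ t in l, 0 < s t)
    (hL : ∀ᶠ t in l, 0 < L t) (hL0 : Tendsto L l (𝓝 0)) (θ : ℝ)
    (hf : IsJumpDensity f) [IsProbabilityMeasure (jumpLaw f)] {ε : ℝ} (hε : 0 < ε) :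
    ∀ᶠ t in l, |∫ x, scoreMix β (s t) θ (compoundPoisson (L t) (jumpLaw f)) x *
        (L t * jumpScoreMix β (s t) θ (L t) f x) /
          mixDensity β (s t) θ (compoundPoisson (L t) (jumpLaw f)) x| ≤ ε * √(L t) := by
  have hI := scaleInfo_nonneg hpos
  have hM := multInfo_nonneg hf
  obtain ⟨B, hB0, hB, -⟩ := exists_bound_stableDensity hβ
  -- `δ` bounds the information on `σ` outside the window, which is paired by Cauchy-Schwarz with
  -- the bound `2 L 𝓛` for the information on the jump scale
  set δ : ℝ := ε ^ 2 / (8 * (multInfo f + 1)) with hδ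
  have hδ0 : 0 < δ := by positivity
  obtain ⟨R, hR0, hR⟩ := exists_eventually_setLIntegral_scaleDensity_le hβ hβ2 hpos hs hL hL0 θ
    (jumpLaw f) hδ0
  obtain ⟨w0, -, hw0⟩ := (isCompact_Icc (a := -R) (b := R)).exists_isMinOn
    ⟨0, by constructor <;> linarith⟩ (continuous_stableDensity hβ).continuousOn
  set m := stableDensity β w0
  have hm0 : 0 < m := hpos w0
  set A := ∫ w, |multScore f w|
  have hA0 : 0 ≤ A := integral_nonneg fun y => abs_nonneg _
  set C : ℝ := (B * A) ^ 2 * Real.exp 1 / m with hC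
  have hC0 : 0 ≤ C := by positivity
  have hsmall : ∀ᶠ t in l, scaleInfo β * (2 * R * C) * L t < ε ^ 2 / 4 := by
    have : Tendsto (fun t => scaleInfo β * (2 * R * C) * L t) l (𝓝 0) := by
      simpa using hL0.const_mul (scaleInfo β * (2 * R * C))
    exact this.eventually (gt_mem_nhds (by positivity))
  filter_upwards [hs, hL, hR, hsmall, hL0.eventually (gt_mem_nhds one_pos)]
    with t hst hLt hRt hsm hL1
  have := isProbabilityMeasure_compoundPoisson hLt.le (jumpLaw f)
  set S : Set ℝ := (fun x => x / s t) ⁻¹' Set.Icc (-R) R with hSdef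
  have hS : MeasurableSet S := by
    have : Measurable fun x : ℝ => x / s t := by fun_prop
    exact this measurableSet_Icc
  have hsq : √(L t) ^ 2 = L t := Real.sq_sqrt hLt.le
  have hvol : volume S ≤ ENNReal.ofReal (2 * R * s t) := by
    have : S ⊆ Set.Icc (-(R * s t)) (R * s t) := by
      intro x hx
      have h1 : -R ≤ x / s t := hx.1
      have h2 : x / s t ≤ R := hx.2
      rw [le_div_iff₀ hst] at h1
      rw [div_le_iff₀ hst] at h2
      exact ⟨by linarith, h2⟩
    refine (measure_mono this).trans_eq ?_
    rw [Real.volume_Icc]; congr 1; ring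
  have hin : ∫⁻ x in S, ENNReal.ofReal ((L t * jumpScoreMix β (s t) θ (L t) f x) ^ 2 /
      mixDensity β (s t) θ (compoundPoisson (L t) (jumpLaw f)) x) ≤
      ENNReal.ofReal (2 * R * C * L t ^ 2) := by
    have hb : ∀ x ∈ S, ENNReal.ofReal ((L t * jumpScoreMix β (s t) θ (L t) f x) ^ 2 /
      mixDensity β (s t) θ (compoundPoisson (L t) (jumpLaw f)) x) ≤
        ENNReal.ofReal (C * L t ^ 2 / s t) := by
      intro x hx
      apply ENNReal.ofReal_le_ofReal
      have h1 := exp_neg_mul_scaledDensity_le_mixDensity hβ hpos hst θ hLt.le (jumpLaw f) x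
      have h2 : m ≤ stableDensity β (x / s t) := hw0 hx
      have h3 : Real.exp (-1) ≤ Real.exp (-L t) := Real.exp_le_exp.2 (by linarith)
      have h4 : Real.exp (-1) * (1 / s t * m) ≤
          mixDensity β (s t) θ (compoundPoisson (L t) (jumpLaw f)) x := by
        refine le_trans ?_ h1
        rw [scaledDensity]
        gcongr
      have h5 := abs_jumpScoreMix_le hB hf hst θ hLt.le x
      have h6 : (L t * jumpScoreMix β (s t) θ (L t) f x) ^ 2 ≤ (L t * (B * A / s t)) ^ 2 := by
        rw [← sq_abs, abs_mul, abs_of_pos hLt]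
        gcongr
      calc _ ≤ (L t * (B * A / s t)) ^ 2 / (Real.exp (-1) * (1 / s t * m)) := by gcongr
        _ = _ := by
          rw [hC, Real.exp_neg]
          field_simp
    refine (setLIntegral_mono measurable_const hb).trans ?_
    rw [setLIntegral_const]
    refine (mul_le_mul_right hvol _).trans_eq ?_
    rw [← ENNReal.ofReal_mul (by positivity)]
    congr 1
    field_simp
  have hall := hf.lintegral_jumpScoreMix_sq_div_le hβ hβ2 hpos hst θ hLt.le
  have hall1 := lintegral_scoreMix_sq_div_le hβ hβ2 hpos hst θ
    (compoundPoisson (L t) (jumpLaw f))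
  have hX := sq_setLIntegral_cross_le hβ hpos hf hst θ hLt.le S
  have hY := sq_setLIntegral_cross_le hβ hpos hf hst θ hLt.le Sᶜ
  have root : ∀ {X : ENNReal}, X ^ 2 ≤ ENNReal.ofReal (ε ^ 2 / 4 * L t) →
      X ≤ ENNReal.ofReal (ε / 2 * √(L t)) := by
    intro X hX
    rw [show ε ^ 2 / 4 * L t = (ε / 2 * √(L t)) ^ 2 by rw [mul_pow, hsq]; ring,
      ENNReal.ofReal_pow (by positivity)] at hX
    exact (ENNReal.pow_right_strictMono two_ne_zero).le_iff_le.1 hX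
  have hX2 := root (hX.trans ((mul_le_mul' ((setLIntegral_le_lintegral _ _).trans hall1)
    hin).trans (by
      rw [← ENNReal.ofReal_mul hI]
      apply ENNReal.ofReal_le_ofReal
      nlinarith)))
  have hY2 := root (hY.trans ((mul_le_mul' hRt
    ((setLIntegral_le_lintegral _ _).trans hall)).trans (by
      rw [← ENNReal.ofReal_mul hδ0.le]
      apply ENNReal.ofReal_le_ofReal
      have h1 : L t + L t ^ 2 ≤ 2 * L t := by nlinarith
      calc δ * ((L t + L t ^ 2) * multInfo f) ≤ δ * ((2 * L t) * (multInfo f + 1)) := by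
            gcongr; linarith
        _ = _ := by rw [hδ]; field_simp; ring)))
  rw [← ENNReal.ofReal_le_ofReal_iff (by positivity), ← Real.enorm_eq_ofReal_abs]
  refine (enorm_integral_le_lintegral_enorm _).trans ?_
  simp_rw [Real.enorm_eq_ofReal_abs]
  rw [← lintegral_add_compl _ hS]
  refine (add_le_add hX2 hY2).trans_eq ?_
  rw [← ENNReal.ofReal_add (by positivity) (by positivity)]
  congr 1; ring

end

/-! ### The entry `θθ` -/

section

variable {β : ℝ} {f : ℝ → ℝ} {ι : Type*} {l : Filter ι} {s L : ι → ℝ}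

lemma poissonWeight_add_two_le {L : ℝ} (hL : 0 ≤ L) (n : ℕ) :
    poissonWeight L (n + 2) ≤ L ^ 2 * poissonWeight L n := by
  have h : (n.factorial : ℝ) ≤ (n + 2).factorial := by
    exact_mod_cast Nat.factorial_le (Nat.le_add_right n 2)
  have h0 : (0 : ℝ) < n.factorial := by positivity
  calc poissonWeight L (n + 2) = Real.exp (-L) * (L ^ (n + 2) / (n + 2).factorial) := rfl
    _ ≤ Real.exp (-L) * (L ^ (n + 2) / n.factorial) := by gcongr
    _ = L ^ 2 * poissonWeight L n := by rw [poissonWeight]; ring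

lemma IsJumpDensity.stepDensity_succ_le (hf : IsJumpDensity f) [IsProbabilityMeasure (jumpLaw f)]
    (hβ : 0 < β) (hβ2 : β ≤ 2) (hpos : ∀ w, 0 < stableDensity β w) {s : ℝ} (hs : 0 < s)
    {θ : ℝ} (hθ : θ ≠ 0) {M : ℝ} (hM : ∀ u, f u ≤ M) (n : ℕ) (x : ℝ) :
    stepDensity β s θ (jumpLaw f) (n + 1) x ≤ ENNReal.ofReal (M / |θ|) := by
  have hm := measurable_stepDensity hβ s θ (jumpLaw f) n
  rw [hf.stepDensity_succ hβ]
  calc ∫⁻ w, stepDensity β s θ (jumpLaw f) n (x - θ * w) * ENNReal.ofReal (f w)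
      ≤ ∫⁻ w, stepDensity β s θ (jumpLaw f) n (x - θ * w) * ENNReal.ofReal M := by
        gcongr with w; exact hM w
    _ = ENNReal.ofReal (M / |θ|) := by
        have := lintegral_lintegral_scaledDensity hβ hβ2 hpos hs θ (iterConv (jumpLaw f) n)
        rw [lintegral_mul_const _ (by fun_prop), lintegral_comp_sub_mul hm hθ]
        simp only [stepDensity]
        rw [this, mul_one, ← ENNReal.ofReal_mul (abs_nonneg _), abs_inv, inv_mul_eq_div]

lemma tsum_eq_add_add_tsum (F : ℕ → ENNReal) : ∑' n, F n = F 0 + F 1 + ∑' n, F (n + 2) := by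
  rw [tsum_eq_zero_add' ENNReal.summable, tsum_eq_zero_add' ENNReal.summable, add_assoc]

/-- An observation with at least two jumps has a density of order `L ^ 2`. -/
lemma IsJumpDensity.mixDensity_le (hf : IsJumpDensity f) [IsProbabilityMeasure (jumpLaw f)]
    (hβ : 0 < β) (hβ2 : β ≤ 2) (hpos : ∀ w, 0 < stableDensity β w) {s : ℝ} (hs : 0 < s)
    {θ : ℝ} (hθ : θ ≠ 0) {M : ℝ} (hM0 : 0 ≤ M) (hM : ∀ u, f u ≤ M) {L : ℝ} (hL : 0 ≤ L) (x : ℝ) :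
    mixDensity β s θ (compoundPoisson L (jumpLaw f)) x ≤
      scaledDensity β s x + L * (stepDensity β s θ (jumpLaw f) 1 x).toReal +
        L ^ 2 * (M / |θ|) := by
  have hsd := (scaledDensity_pos hpos hs x).le
  have hQ := fun n => hf.stepDensity_succ_le hβ hβ2 hpos hs hθ hM n x
  have hQ1 : stepDensity β s θ (jumpLaw f) 1 x ≠ ⊤ := ne_top_of_le_ne_top ENNReal.ofReal_ne_top (hQ 0)
  set q := (stepDensity β s θ (jumpLaw f) 1 x).toReal with hq
  have hq0 : 0 ≤ q := ENNReal.toReal_nonneg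
  have hA : 0 ≤ L * q := mul_nonneg hL hq0
  have hB : 0 ≤ L ^ 2 * (M / |θ|) := by positivity
  rw [← ENNReal.ofReal_le_ofReal_iff (add_nonneg (add_nonneg hsd hA) hB),
    ofReal_mixDensity_eq_tsum hβ hpos hs θ hL, ENNReal.ofReal_add (add_nonneg hsd hA) hB,
    ENNReal.ofReal_add hsd hA, ENNReal.ofReal_mul hL, hq, ENNReal.ofReal_toReal hQ1, tsum_eq_add_add_tsum]
  have hexp : Real.exp (-L) ≤ 1 := Real.exp_le_one_iff.2 (by linarith)
  refine add_le_add (add_le_add ?_ ?_) ?_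
  · rw [stepDensity, iterConv, lintegral_dirac, mul_zero, sub_zero, poissonWeight_zero]
    exact mul_le_of_le_one_left' (by rwa [ENNReal.ofReal_le_one])
  · refine mul_le_mul_left (ENNReal.ofReal_le_ofReal ?_) _
    rw [poissonWeight]
    simpa using mul_le_of_le_one_left hL hexp
  · calc ∑' n, ENNReal.ofReal (poissonWeight L (n + 2)) * stepDensity β s θ (jumpLaw f) (n + 2) x
        ≤ ∑' n, ENNReal.ofReal (poissonWeight L n) * ENNReal.ofReal (L ^ 2 * (M / |θ|)) := by
          refine ENNReal.tsum_le_tsum fun n => ?_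
          refine (mul_le_mul' (ENNReal.ofReal_le_ofReal (poissonWeight_add_two_le hL n))
            (hQ (n + 1))).trans_eq ?_
          rw [← ENNReal.ofReal_mul (mul_nonneg (sq_nonneg _) (poissonWeight_nonneg hL n)),
            ← ENNReal.ofReal_mul (poissonWeight_nonneg hL n)]
          congr 1; ring
      _ = ENNReal.ofReal (L ^ 2 * (M / |θ|)) := by
          rw [ENNReal.tsum_mul_right, ← ENNReal.ofReal_tsum_of_nonneg (poissonWeight_nonneg hL)
            (hasSum_poissonWeight L).summable, (hasSum_poissonWeight L).tsum_eq,
            ENNReal.ofReal_one, one_mul]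

/-- At a fixed distance from the origin the stable density of small scale is of the order `L` of the
mean number of jumps, like the density of one jump. -/
lemma tendsto_scaledDensity_div (hβ : 0 < β) (hβ2 : β ≤ 2) (hs : ∀ᶠ t in l, 0 < s t)
    (hs0 : Tendsto s l (𝓝 0)) (hL : ∀ᶠ t in l, 0 < L t) {κ : ℝ}
    (hκ : Tendsto (fun t => s t ^ β / L t) l (𝓝 κ)) {x : ℝ} (hx : x ≠ 0) :
    Tendsto (fun t => scaledDensity β (s t) x / L t) l
      (𝓝 (tailLimit β * κ / |x| ^ (1 + β))) := by
  have hx0 := abs_pos.2 hx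
  have h1 : Tendsto (fun t => |x| / s t) l atTop := by
    have h : Tendsto s l (𝓝[>] 0) := tendsto_nhdsWithin_iff.2 ⟨hs0, hs⟩
    simpa [div_eq_mul_inv] using (h.inv_tendsto_nhdsGT_zero).const_mul_atTop hx0
  refine ((((tendsto_stableDensity_tail hβ hβ2).comp h1).mul hκ).div_const _).congr' ?_
  filter_upwards [hs, hL] with t hst hLt
  have e : |x| / s t = |x / s t| := by rw [abs_div, abs_of_pos hst]
  have h3 : 0 < |x| ^ (1 + β) := by positivity
  have h4 : 0 < s t ^ β := by positivity
  rw [Function.comp_apply, Real.div_rpow hx0.le hst.le, e, stableDensity_abs, scaledDensity,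
    Real.rpow_add hst, Real.rpow_one]
  field_simp

/-- As `s → 0`, the density of `s W_1` plus one scaled jump tends to the density of the scaled
jump. -/
lemma IsJumpDensity.tendsto_stepDensity_one [l.IsCountablyGenerated] (hf : IsJumpDensity f)
    [IsProbabilityMeasure (jumpLaw f)] (hβ : 0 < β) (hβ2 : β ≤ 2)
    (hpos : ∀ w, 0 < stableDensity β w) (hs : ∀ᶠ t in l, 0 < s t) (hs0 : Tendsto s l (𝓝 0))
    {θ : ℝ} (hθ : θ ≠ 0) (x : ℝ) :
    Tendsto (fun t => (stepDensity β (s t) θ (jumpLaw f) 1 x).toReal) l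
      (𝓝 (f (x / θ) / |θ|)) := by
  obtain ⟨M, hM0, hM⟩ := hf.exists_bound
  have hfc := hf.differentiable.continuous
  have hfm := hfc.measurable
  have h1 := tendsto_lintegral_scaledDensity_mul hβ hβ2 hpos hs hs0
    (T := fun y => ENNReal.ofReal |θ⁻¹| * ENNReal.ofReal (f ((x - y) / θ))) (by fun_prop)
    (C := ENNReal.ofReal |θ⁻¹| * ENNReal.ofReal M)
    (ENNReal.mul_ne_top ENNReal.ofReal_ne_top ENNReal.ofReal_ne_top)
    (fun y => by gcongr; exact hM _)
    (by
      have : Continuous fun y => |θ⁻¹| * f ((x - y) / θ) := by fun_prop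
      simp_rw [← ENNReal.ofReal_mul (abs_nonneg θ⁻¹)]
      exact (ENNReal.continuous_ofReal.comp this).continuousAt)
  have h2 : ∀ t, ∫⁻ y, ENNReal.ofReal (scaledDensity β (s t) y) *
      (ENNReal.ofReal |θ⁻¹| * ENNReal.ofReal (f ((x - y) / θ))) =
      stepDensity β (s t) θ (jumpLaw f) 1 x := by
    intro t
    have hsd := (continuous_scaledDensity hβ (s t)).measurable
    have h3 := lintegral_comp_sub_mul (F := fun y => ENNReal.ofReal (scaledDensity β (s t) y) *
      ENNReal.ofReal (f ((x - y) / θ))) (by fun_prop) hθ x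
    rw [hf.stepDensity_succ hβ, ← lintegral_const_mul _ (by fun_prop)] at *
    simp_rw [mul_left_comm _ (ENNReal.ofReal |θ⁻¹|)]
    rw [← h3]
    congr 1; ext w
    rw [stepDensity, iterConv, lintegral_dirac, mul_zero, sub_zero, sub_sub_cancel,
      mul_div_cancel_left₀ _ hθ]
  simp_rw [h2] at h1
  have h4 := (ENNReal.tendsto_toReal (ENNReal.mul_ne_top ENNReal.ofReal_ne_top
    ENNReal.ofReal_ne_top)).comp h1
  simp only [sub_zero] at h4
  rw [← ENNReal.ofReal_mul (abs_nonneg _), ENNReal.toReal_ofReal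
    (mul_nonneg (abs_nonneg _) (hf.nonneg _)), abs_inv, inv_mul_eq_div] at h4
  exact h4

/-- The law of the observation concentrates at `0`, so that its convolution with the score of the
jump density converges to that score in `L¹`. -/
lemma IsJumpDensity.tendsto_lintegral_jumpScoreMix_sub [l.IsCountablyGenerated]
    (hf : IsJumpDensity f)
    [IsProbabilityMeasure (jumpLaw f)] (hβ : 0 < β) (hβ2 : β ≤ 2)
    (hpos : ∀ w, 0 < stableDensity β w) (hs : ∀ᶠ t in l, 0 < s t) (hs0 : Tendsto s l (𝓝 0))
    (hL : ∀ᶠ t in l, 0 < L t) (hL0 : Tendsto L l (𝓝 0)) {θ : ℝ} (hθ : θ ≠ 0) :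
    Tendsto (fun t => ∫⁻ x, ‖jumpScoreMix β (s t) θ (L t) f x - |θ|⁻¹ * multScore f (x / θ)‖ₑ) l
      (𝓝 0) := by
  set k : ℝ → ℝ := fun x => |θ|⁻¹ * multScore f (x / θ) with hk
  have hki : Integrable k := (hf.integrable_multScore.comp_div hθ).const_mul _
  have hkm : Measurable k := by
    have := hf.measurable_multScore
    fun_prop
  set T : ℝ → ENNReal := fun y => ∫⁻ x, ‖k (x - y) - k x‖ₑ with hT
  have hTm : Measurable T := by
    have h : Measurable (Function.uncurry fun y x : ℝ => ‖k (x - y) - k x‖ₑ) := by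
      simp only [Function.uncurry_def]; fun_prop
    exact h.lintegral_prod_right'
  have hT0 : T 0 = 0 := by simp [hT]
  set C : ENNReal := 2 * ∫⁻ x, ‖k x‖ₑ with hC
  have hCtop : C ≠ ⊤ := ENNReal.mul_ne_top (by norm_num) hki.2.ne
  have hTC : ∀ y, T y ≤ C := by
    intro y
    calc T y ≤ ∫⁻ x, (‖k (x - y)‖ₑ + ‖k x‖ₑ) := lintegral_mono fun x => enorm_sub_le
      _ = C := by
        rw [lintegral_add_right _ (by fun_prop),
          lintegral_sub_right_eq_self (fun x => ‖k x‖ₑ) y, hC, two_mul]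
  have hcont : ContinuousAt T 0 := by
    rw [ContinuousAt, hT0]; exact tendsto_lintegral_translate_sub hki
  have h1 := tendsto_lintegral_scaledDensity_mul hβ hβ2 hpos hs hs0 hTm hCtop hTC hcont
  rw [hT0] at h1
  have h2 : Tendsto (fun t => (∫⁻ y, ENNReal.ofReal (scaledDensity β (s t) y) * T y) +
      C * ENNReal.ofReal (L t)) l (𝓝 0) := by
    have := ENNReal.Tendsto.const_mul (ENNReal.tendsto_ofReal hL0) (Or.inr hCtop)
    simpa using h1.add this
  refine tendsto_of_tendsto_of_tendsto_of_le_of_le' tendsto_const_nhds h2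
    (Eventually.of_forall fun t => zero_le) ?_
  filter_upwards [hs, hL] with t hst hLt
  have := isProbabilityMeasure_compoundPoisson hLt.le (jumpLaw f)
  set G := compoundPoisson (L t) (jumpLaw f) with hG
  have hsd := (continuous_scaledDensity hβ (s t)).measurable
  have hmc := continuous_mixDensity hβ (s t) θ G
  have hmm := hmc.measurable
  have hmi := integrable_mixDensity hβ hβ2 hpos hst θ G
  have hmp := mixDensity_pos hβ hpos hst θ G
  have hm1 : ∫ y, mixDensity β (s t) θ G y = 1 := by
    rw [integral_eq_lintegral_of_nonneg_ae (ae_of_all _ fun y => (hmp y).le)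
      hmi.aestronglyMeasurable, lintegral_mixDensity hβ hβ2 hpos hst, ENNReal.toReal_one]
  have hpt : ∀ x, ‖jumpScoreMix β (s t) θ (L t) f x - k x‖ₑ ≤
      ∫⁻ y, ENNReal.ofReal (mixDensity β (s t) θ G y) * ‖k (x - y) - k x‖ₑ := by
    intro x
    obtain ⟨B, -, hB⟩ := exists_bound_mixDensity hβ (s t) θ G
    have hi1 : Integrable fun y => mixDensity β (s t) θ G y * k (x - y) :=
      (hki.comp_sub_left x).bdd_mul (c := B) hmc.aestronglyMeasurable (ae_of_all _ fun y => hB y)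
    have e1 : jumpScoreMix β (s t) θ (L t) f x = ∫ y, mixDensity β (s t) θ G y * k (x - y) := by
      have h3 := Measure.integral_comp_mul_left
        (fun z => mixDensity β (s t) θ G (x - z) * multScore f (z / θ)) θ
      have h4 := integral_sub_left_eq_self
        (fun y => mixDensity β (s t) θ G y * multScore f ((x - y) / θ)) volume x
      simp only [sub_sub_cancel] at h4
      rw [h4, smul_eq_mul, abs_inv, ← integral_const_mul] at h3
      rw [jumpScoreMix]
      simp only [mul_div_cancel_left₀ _ hθ] at h3
      rw [h3]
      congr 1; ext y; simp only [hk]; ring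
    have e2 : k x = ∫ y, mixDensity β (s t) θ G y * k x := by
      rw [integral_mul_const, hm1, one_mul]
    rw [show jumpScoreMix β (s t) θ (L t) f x - k x =
        ∫ y, (mixDensity β (s t) θ G y * k (x - y) - mixDensity β (s t) θ G y * k x) by
      rw [integral_sub hi1 (hmi.mul_const _), ← e1, ← e2]]
    refine (enorm_integral_le_lintegral_enorm _).trans_eq ?_
    congr 1; ext y
    rw [← mul_sub, enorm_mul, Real.enorm_of_nonneg (hmp y).le]
  calc ∫⁻ x, ‖jumpScoreMix β (s t) θ (L t) f x - k x‖ₑ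
      ≤ ∫⁻ x, ∫⁻ y, ENNReal.ofReal (mixDensity β (s t) θ G y) * ‖k (x - y) - k x‖ₑ :=
        lintegral_mono hpt
    _ = ∫⁻ y, ENNReal.ofReal (mixDensity β (s t) θ G y) * T y := by
        rw [lintegral_lintegral_swap (by
          apply Measurable.aemeasurable; simp only [Function.uncurry_def]; fun_prop)]
        congr 1; ext y
        rw [lintegral_const_mul _ (by fun_prop)]
    _ = ∫⁻ v, ∫⁻ y, ENNReal.ofReal (scaledDensity β (s t) (y - θ * v)) * T y ∂volume ∂G := by
        rw [lintegral_lintegral_swap (by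
          apply Measurable.aemeasurable; simp only [Function.uncurry_def]; fun_prop)]
        congr 1; ext y
        rw [lintegral_mul_const _ (by fun_prop), ofReal_mixDensity hβ hpos hst]
    _ ≤ _ := by
        refine (lintegral_compoundPoisson_le hLt.le (jumpLaw f) (C := C) fun v => ?_).trans_eq ?_
        · calc ∫⁻ y, ENNReal.ofReal (scaledDensity β (s t) (y - θ * v)) * T y
              ≤ ∫⁻ y, ENNReal.ofReal (scaledDensity β (s t) (y - θ * v)) * C := by
                gcongr with y; exact hTC y
            _ = C := by
                rw [lintegral_mul_const _ (by fun_prop), lintegral_sub_right_eq_self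
                  (fun y => ENNReal.ofReal (scaledDensity β (s t) y)) (θ * v),
                  lintegral_scaledDensity hβ hβ2 hpos hst, one_mul]
        · simp

/-- The asymptotic lower bound for the information on the jump scale: at the scale of the jumps the
density of the observation is at most that of one jump plus the tail of the stable law. -/
lemma IsJumpDensity.eventually_lt_lintegral_jumpScoreMix [l.IsCountablyGenerated]
    (hf : IsJumpDensity f)
    [IsProbabilityMeasure (jumpLaw f)] (hβ : 0 < β) (hβ2 : β ≤ 2)
    (hpos : ∀ w, 0 < stableDensity β w) (hs : ∀ᶠ t in l, 0 < s t) (hs0 : Tendsto s l (𝓝 0))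
    (hL : ∀ᶠ t in l, 0 < L t) (hL0 : Tendsto L l (𝓝 0)) {κ : ℝ}
    (hκ : Tendsto (fun t => s t ^ β / L t) l (𝓝 κ)) {θ : ℝ} (hθ : θ ≠ 0) {c : ENNReal}
    (hc : c < ∫⁻ z, ENNReal.ofReal (multScore f z ^ 2 /
      (f z + tailLimit β * κ / (|θ| ^ β * |z| ^ (1 + β))))) :
    ∀ᶠ t in l, c < ∫⁻ x, ENNReal.ofReal ((L t * jumpScoreMix β (s t) θ (L t) f x) ^ 2 /
      mixDensity β (s t) θ (compoundPoisson (L t) (jumpLaw f)) x / L t) := by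
  obtain ⟨M, hM0, hM⟩ := hf.exists_bound
  have hθ0 := abs_pos.2 hθ
  have hkm := hf.measurable_multScore
  have hfm := hf.differentiable.continuous.measurable
  set k : ℝ → ℝ := fun x => |θ|⁻¹ * multScore f (x / θ) with hk
  set D : ℝ → ℝ := fun x => f (x / θ) / |θ| + tailLimit β * κ / |x| ^ (1 + β) with hD
  have hchange : ∫⁻ z, ENNReal.ofReal (multScore f z ^ 2 /
      (f z + tailLimit β * κ / (|θ| ^ β * |z| ^ (1 + β)))) =
      ∫⁻ x, ENNReal.ofReal (k x ^ 2 / D x) := by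
    have h1 := lintegral_comp_mul_left (F := fun x => ENNReal.ofReal (k x ^ 2 / D x))
      (by fun_prop) hθ
    have e : ∀ z, ENNReal.ofReal (k (θ * z) ^ 2 / D (θ * z)) = ENNReal.ofReal |θ⁻¹| *
        ENNReal.ofReal (multScore f z ^ 2 /
          (f z + tailLimit β * κ / (|θ| ^ β * |z| ^ (1 + β)))) := by
      intro z
      rw [← ENNReal.ofReal_mul (abs_nonneg _)]
      congr 1
      simp only [hk, hD]
      rw [mul_div_cancel_left₀ _ hθ, abs_mul, Real.mul_rpow hθ0.le (abs_nonneg _),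
        Real.rpow_add hθ0, Real.rpow_one, abs_inv]
      rw [show f z / |θ| + tailLimit β * κ / (|θ| * |θ| ^ β * |z| ^ (1 + β)) =
        |θ|⁻¹ * (f z + tailLimit β * κ / (|θ| ^ β * |z| ^ (1 + β))) by
          rw [mul_assoc, ← div_div, ← div_div, div_right_comm]; ring]
      rw [mul_pow, pow_two |θ|⁻¹, mul_assoc, mul_div_mul_left _ _ (by positivity),
        mul_div_assoc]
    simp_rw [e] at h1
    rw [lintegral_const_mul _ (by fun_prop)] at h1
    exact (ENNReal.mul_right_inj (by simpa using hθ) ENNReal.ofReal_ne_top).1 h1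
  rw [hchange] at hc
  refine eventually_lt_lintegral ?_ (fun u hu => ?_) hc
  · filter_upwards [hL] with t hLt
    have := isProbabilityMeasure_compoundPoisson hLt.le (jumpLaw f)
    have h1 := hf.measurable_jumpScoreMix hβ (s t) θ hLt.le
    have h2 := (continuous_mixDensity hβ (s t) θ (compoundPoisson (L t) (jumpLaw f))).measurable
    fun_prop
  · obtain ⟨N, hN⟩ := eventually_atTop.1 (hu.eventually hL)
    have huN : Tendsto (fun n => u (n + N)) atTop l := hu.comp (tendsto_add_atTop_nat N)
    have h1 : TendstoInMeasure volume
        (fun n => jumpScoreMix β (s (u (n + N))) θ (L (u (n + N))) f) atTop k := by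
      refine tendstoInMeasure_of_tendsto_eLpNorm one_ne_zero
        (fun n => (hf.measurable_jumpScoreMix hβ _ θ
          (hN (n + N) (Nat.le_add_left N n)).le).aestronglyMeasurable)
        (by fun_prop) ?_
      simp_rw [eLpNorm_one_eq_lintegral_enorm]
      exact (hf.tendsto_lintegral_jumpScoreMix_sub hβ hβ2 hpos hs hs0 hL hL0 hθ).comp huN
    obtain ⟨φ, hφ, hae⟩ := h1.exists_seq_tendsto_ae
    refine ⟨fun n => φ n + N, fun a b hab => Nat.add_lt_add_right (hφ hab) N, ?_⟩
    have huφ : Tendsto (fun n => u (φ n + N)) atTop l := huN.comp hφ.tendsto_atTop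
    have hx0 : ∀ᵐ x : ℝ, x ≠ 0 := by simp [ae_iff]
    filter_upwards [hae, hx0] with x hx hx0
    -- where `D` vanishes, division by zero makes the target zero
    by_cases hDx : D x = 0
    · simp [hDx]
    have h2 : Tendsto (fun t => scaledDensity β (s t) x / L t +
        (stepDensity β (s t) θ (jumpLaw f) 1 x).toReal + L t * (M / |θ|)) l (𝓝 (D x)) := by
      have := ((tendsto_scaledDensity_div hβ hβ2 hs hs0 hL hκ hx0).add
        (hf.tendsto_stepDensity_one hβ hβ2 hpos hs hs0 hθ x)).add (hL0.mul_const (M / |θ|))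
      rw [zero_mul, add_zero, add_comm (tailLimit β * κ / |x| ^ (1 + β))] at this
      exact this
    have h3 := (ENNReal.continuous_ofReal.tendsto _).comp
      ((hx.pow 2).div (h2.comp huφ) hDx)
    rw [← h3.liminf_eq]
    refine liminf_le_liminf ?_
    filter_upwards [huφ.eventually hs, huφ.eventually hL] with n hsn hLn
    have := isProbabilityMeasure_compoundPoisson hLn.le (jumpLaw f)
    have hp := mixDensity_pos hβ hpos hsn θ (compoundPoisson (L (u (φ n + N))) (jumpLaw f)) x
    have hle := hf.mixDensity_le hβ hβ2 hpos hsn hθ hM0 hM hLn.le x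
    apply ENNReal.ofReal_le_ofReal
    simp only [Pi.div_apply, Function.comp_apply]
    refine le_trans ?_ (le_of_eq (a := jumpScoreMix β (s (u (φ n + N))) θ (L (u (φ n + N))) f x ^ 2 /
      (mixDensity β (s (u (φ n + N))) θ (compoundPoisson (L (u (φ n + N))) (jumpLaw f)) x /
        L (u (φ n + N)))) (by field_simp))
    refine div_le_div_of_nonneg_left (sq_nonneg _) (by positivity) ?_
    rw [div_le_iff₀ hLn]
    refine hle.trans_eq ?_
    field_simp

end

/-! ### The observation at the time `Δ` -/

section

variable {β σ θ lam : ℝ} {f : ℝ → ℝ} {Δ : ℝ≥0}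

lemma rpow_scale (hβ : 0 < β) (hσ : 0 ≤ σ) (Δ : ℝ≥0) :
    (σ * (Δ : ℝ) ^ (1 / β)) ^ β = σ ^ β * Δ := by
  rw [Real.mul_rpow hσ (by positivity), ← Real.rpow_mul Δ.coe_nonneg, one_div_mul_cancel hβ.ne',
    Real.rpow_one]

lemma isJumpDensity_of_withDensity [IsProbabilityMeasure (jumpLaw f)] (hf0 : ∀ u, 0 ≤ f u)
    (hfd : Differentiable ℝ f) (hf : Tendsto (fun u => u * f u) (cocompact ℝ) (𝓝 0))
    (hL : Integrable (multIntegrand f)) : IsJumpDensity f where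
  nonneg := hf0
  differentiable := hfd
  tendsto_mul := hf
  integrable_multIntegrand := hL
  integrable := by
    refine ⟨hfd.continuous.aestronglyMeasurable, ?_⟩
    rw [hasFiniteIntegral_iff_ofReal (ae_of_all _ hf0)]
    have h := measure_univ (μ := jumpLaw f)
    rw [jumpLaw, withDensity_apply _ MeasurableSet.univ, setLIntegral_univ] at h
    rw [h]; exact ENNReal.one_lt_top

lemma IsStdStableProcess.stableDensity_pos {Ω : Type*} [MeasurableSpace Ω] {P : Measure Ω}
    [IsProbabilityMeasure P] {W : ℝ≥0 → Ω → ℝ} (hW : IsStdStableProcess P β W) (hβ : 0 < β)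
    (hβ2 : β ≤ 2) (w : ℝ) : 0 < stableDensity β w := by
  have := Measure.isProbabilityMeasure_map (μ := P) (hW.measurable 1).aemeasurable
  refine LevyFisher.stableDensity_pos hβ hβ2
    (stableDensity_nonneg hβ hβ2 (ν := P.map (W 1)) fun u => ?_) w
  rw [hW.charFun_eq, stableChar]
  simp

/-- The density of the observation, identified through its characteristic function. -/
lemma map_add_eq_withDensity {Ω : Type*} [MeasurableSpace Ω] {P : Measure Ω}
    [IsProbabilityMeasure P] {W Y : ℝ≥0 → Ω → ℝ} (hW : IsStdStableProcess P β W) (hβ : 0 < β)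
    (hβ2 : β ≤ 2) (hY : ∀ t, Measurable (Y t))
    (hWY : IndepFun (fun ω t => W t ω) (fun ω t => Y t ω) P) (hΔ : 0 < Δ) {s : ℝ} (hs : 0 < s)
    (r : ℝ) :
    P.map (fun ω => s * W Δ ω + r * Y Δ ω) =
      volume.withDensity (fun x => ENNReal.ofReal (density β Δ (P.map (Y Δ)) s r x)) := by
  have hpos := hW.stableDensity_pos hβ hβ2
  have hWm := hW.measurable Δ
  have hYm := hY Δ
  have hG := Measure.isProbabilityMeasure_map (μ := P) hYm.aemeasurable
  have hτ : 0 < s * (Δ : ℝ) ^ (1 / β) := by positivity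
  have hind : IndepFun (fun ω => s * W Δ ω) (fun ω => r * Y Δ ω) P :=
    hWY.comp (φ := fun w : ℝ≥0 → ℝ => s * w Δ) (ψ := fun w : ℝ≥0 → ℝ => r * w Δ)
      (by fun_prop) (by fun_prop)
  simp_rw [density_eq_mixDensity]
  have hm := (continuous_mixDensity hβ (s * (Δ : ℝ) ^ (1 / β)) r (P.map (Y Δ))).measurable
  have hp := mixDensity_pos hβ hpos hτ r (P.map (Y Δ))
  have := Measure.isProbabilityMeasure_map (μ := P) (f := fun ω => s * W Δ ω + r * Y Δ ω)
    (by fun_prop)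
  have : IsFiniteMeasure (volume.withDensity fun x =>
      ENNReal.ofReal (mixDensity β (s * (Δ : ℝ) ^ (1 / β)) r (P.map (Y Δ)) x)) := by
    refine isFiniteMeasure_withDensity ?_
    rw [lintegral_mixDensity hβ hβ2 hpos hτ]
    exact ENNReal.one_ne_top
  apply Measure.ext_of_charFun
  ext u
  have h1 : P.map (fun ω => s * W Δ ω) = (P.map (W Δ)).map (fun x => s * x) :=
    (Measure.map_map (measurable_const_mul s) hWm).symm
  have h2 : P.map (fun ω => r * Y Δ ω) = (P.map (Y Δ)).map (fun x => r * x) :=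
    (Measure.map_map (measurable_const_mul r) hYm).symm
  rw [hind.charFun_map_fun_add_eq_mul (by fun_prop) (by fun_prop), Pi.mul_apply, h1, h2,
    charFun_map_mul, charFun_map_mul, charFun_withDensity_ofReal hm]
  simp_rw [max_eq_left (hp _).le]
  rw [integral_exp_mul_mixDensity hβ hβ2 hpos hτ, hW.charFun_eq, ← Complex.ofReal_exp, stableChar,
    mul_right_comm s, abs_mul (s * u), abs_of_nonneg (by positivity : 0 ≤ (Δ : ℝ) ^ (1 / β)),
    rpow_scale hβ (abs_nonneg _), mul_comm (Δ : ℝ)]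

lemma hasDerivAt_density_sigma (hβ : 0 < β) (hβ2 : β ≤ 2) (hσ : 0 < σ) (hΔ : 0 < Δ)
    (G : Measure ℝ) [IsProbabilityMeasure G] (θ x : ℝ) :
    HasDerivAt (fun s => density β Δ G s θ x)
      (-(1 / σ) * scoreMix β (σ * (Δ : ℝ) ^ (1 / β)) θ G x) σ := by
  have hτ : 0 < (Δ : ℝ) ^ (1 / β) := by positivity
  simp_rw [density_eq_mixDensity]
  have h := (hasDerivAt_mixDensity_scale hβ hβ2 (mul_pos hσ hτ) θ G x).comp σ
    ((hasDerivAt_id σ).mul_const ((Δ : ℝ) ^ (1 / β)))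
  refine h.congr_deriv ?_
  field_simp

lemma IsJumpDensity.hasDerivAt_density_theta (hf : IsJumpDensity f)
    [IsProbabilityMeasure (jumpLaw f)] (hβ : 0 < β) (hσ : 0 < σ) (hΔ : 0 < Δ) (hθ : θ ≠ 0)
    {L : ℝ} (hL : 0 ≤ L) (x : ℝ) :
    HasDerivAt (fun r => density β Δ (compoundPoisson L (jumpLaw f)) σ r x)
      (-(1 / θ) * (L * jumpScoreMix β (σ * (Δ : ℝ) ^ (1 / β)) θ L f x)) θ := by
  have hτ : 0 < (Δ : ℝ) ^ (1 / β) := by positivity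
  simp_rw [density_eq_mixDensity]
  refine (hf.hasDerivAt_mixDensity_jump hβ (mul_pos hσ hτ) hL hθ x).congr_deriv ?_
  rw [jumpScoreMix]; ring

/-- The information density of the jump scale, before integration over the observation. -/
def jumpDensity (β s θ L : ℝ) (f : ℝ → ℝ) (x : ℝ) : ℝ :=
  (L * jumpScoreMix β s θ L f x) ^ 2 / mixDensity β s θ (compoundPoisson L (jumpLaw f)) x

/-- The mixed information density, before integration over the observation. -/
def crossDensity (β s θ L : ℝ) (f : ℝ → ℝ) (x : ℝ) : ℝ :=
  scoreMix β s θ (compoundPoisson L (jumpLaw f)) x * (L * jumpScoreMix β s θ L f x) /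
    mixDensity β s θ (compoundPoisson L (jumpLaw f)) x

lemma scaleDensity_nonneg (hβ : 0 < β) (hpos : ∀ w, 0 < stableDensity β w) {s : ℝ} (hs : 0 < s)
    (θ : ℝ) {L : ℝ} (hL : 0 ≤ L) (μ : Measure ℝ) [IsProbabilityMeasure μ] (x : ℝ) :
    0 ≤ scaleDensity β s θ L μ x := by
  have := isProbabilityMeasure_compoundPoisson hL μ
  exact div_nonneg (sq_nonneg _) (mixDensity_pos hβ hpos hs θ _ x).le

lemma integrable_scaleDensity (hβ : 0 < β) (hβ2 : β ≤ 2) (hpos : ∀ w, 0 < stableDensity β w)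
    {s : ℝ} (hs : 0 < s) (θ : ℝ) {L : ℝ} (hL : 0 ≤ L) (μ : Measure ℝ) [IsProbabilityMeasure μ] :
    Integrable (scaleDensity β s θ L μ) := by
  have := isProbabilityMeasure_compoundPoisson hL μ
  refine ⟨(measurable_scaleDensity hβ s θ hL μ).aestronglyMeasurable, ?_⟩
  rw [hasFiniteIntegral_iff_ofReal (ae_of_all _ (scaleDensity_nonneg hβ hpos hs θ hL μ))]
  exact (lintegral_scoreMix_sq_div_le hβ hβ2 hpos hs θ _).trans_lt ENNReal.ofReal_lt_top

lemma jumpDensity_nonneg [IsProbabilityMeasure (jumpLaw f)] (hβ : 0 < β)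
    (hpos : ∀ w, 0 < stableDensity β w) {s : ℝ} (hs : 0 < s) (θ : ℝ) {L : ℝ} (hL : 0 ≤ L) (x : ℝ) :
    0 ≤ jumpDensity β s θ L f x := by
  have := isProbabilityMeasure_compoundPoisson hL (jumpLaw f)
  exact div_nonneg (sq_nonneg _) (mixDensity_pos hβ hpos hs θ _ x).le

lemma infoSS_integrand_eq (hβ : 0 < β) (hβ2 : β ≤ 2) (hσ : 0 < σ) (hΔ : 0 < Δ) {L : ℝ} (hL : 0 ≤ L)
    (μ : Measure ℝ) [IsProbabilityMeasure μ] (θ x : ℝ) :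
    dSigma β Δ (compoundPoisson L μ) σ θ x ^ 2 /
      density β Δ (compoundPoisson L μ) σ θ x =
      1 / σ ^ 2 * scaleDensity β (σ * (Δ : ℝ) ^ (1 / β)) θ L μ x := by
  have := isProbabilityMeasure_compoundPoisson hL μ
  rw [dSigma, (hasDerivAt_density_sigma hβ hβ2 hσ hΔ _ θ x).deriv, density_eq_mixDensity,
    scaleDensity]
  ring

namespace IsJumpDensity

lemma integrable_jumpDensity (hf : IsJumpDensity f) [IsProbabilityMeasure (jumpLaw f)]
    (hβ : 0 < β) (hβ2 : β ≤ 2) (hpos : ∀ w, 0 < stableDensity β w)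
    {s : ℝ} (hs : 0 < s) (θ : ℝ) {L : ℝ} (hL : 0 ≤ L) : Integrable (jumpDensity β s θ L f) := by
  have := isProbabilityMeasure_compoundPoisson hL (jumpLaw f)
  refine ⟨(((hf.measurable_jumpScoreMix hβ s θ hL).const_mul L).pow_const 2).div
    (continuous_mixDensity hβ s θ _).measurable |>.aestronglyMeasurable, ?_⟩
  rw [hasFiniteIntegral_iff_ofReal (ae_of_all _ (jumpDensity_nonneg hβ hpos hs θ hL))]
  exact (hf.lintegral_jumpScoreMix_sq_div_le hβ hβ2 hpos hs θ hL).trans_lt ENNReal.ofReal_lt_top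

lemma integrable_crossDensity (hf : IsJumpDensity f) [IsProbabilityMeasure (jumpLaw f)]
    (hβ : 0 < β) (hβ2 : β ≤ 2) (hpos : ∀ w, 0 < stableDensity β w)
    {s : ℝ} (hs : 0 < s) (θ : ℝ) {L : ℝ} (hL : 0 ≤ L) : Integrable (crossDensity β s θ L f) := by
  have := isProbabilityMeasure_compoundPoisson hL (jumpLaw f)
  refine ((integrable_scaleDensity hβ hβ2 hpos hs θ hL (jumpLaw f)).add
    (hf.integrable_jumpDensity hβ hβ2 hpos hs θ hL)).mono'
    (((measurable_scoreMix hβ s θ _).mul ((hf.measurable_jumpScoreMix hβ s θ hL).const_mul L)).div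
    (continuous_mixDensity hβ s θ _).measurable).aestronglyMeasurable (ae_of_all _ fun x => ?_)
  have hp := mixDensity_pos hβ hpos hs θ (compoundPoisson L (jumpLaw f)) x
  rw [Pi.add_apply, scaleDensity, jumpDensity, crossDensity, ← add_div, norm_div,
    Real.norm_of_nonneg hp.le, norm_mul, Real.norm_eq_abs, Real.norm_eq_abs]
  gcongr
  rw [← sq_abs (scoreMix _ _ _ _ _), ← sq_abs (L * _)]
  nlinarith [sq_nonneg (|scoreMix β s θ (compoundPoisson L (jumpLaw f)) x| -
    |L * jumpScoreMix β s θ L f x|), sq_nonneg |scoreMix β s θ (compoundPoisson L (jumpLaw f)) x|,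
    sq_nonneg |L * jumpScoreMix β s θ L f x|]

lemma integral_jumpDensity_le (hf : IsJumpDensity f) [IsProbabilityMeasure (jumpLaw f)]
    (hβ : 0 < β) (hβ2 : β ≤ 2) (hpos : ∀ w, 0 < stableDensity β w)
    {s : ℝ} (hs : 0 < s) (θ : ℝ) {L : ℝ} (hL : 0 ≤ L) :
    ∫ x, jumpDensity β s θ L f x ≤ (L + L ^ 2) * multInfo f := by
  have hM := multInfo_nonneg hf
  rw [← ENNReal.ofReal_le_ofReal_iff (by positivity), ofReal_integral_eq_lintegral_ofReal
    (hf.integrable_jumpDensity hβ hβ2 hpos hs θ hL)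
    (ae_of_all _ (jumpDensity_nonneg hβ hpos hs θ hL))]
  exact hf.lintegral_jumpScoreMix_sq_div_le hβ hβ2 hpos hs θ hL

lemma infoST_integrand_eq (hf : IsJumpDensity f) [IsProbabilityMeasure (jumpLaw f)] (hβ : 0 < β)
    (hβ2 : β ≤ 2) (hσ : 0 < σ) (hΔ : 0 < Δ) (hθ : θ ≠ 0) {L : ℝ} (hL : 0 ≤ L) (x : ℝ) :
    dSigma β Δ (compoundPoisson L (jumpLaw f)) σ θ x *
      dTheta β Δ (compoundPoisson L (jumpLaw f)) σ θ x /
      density β Δ (compoundPoisson L (jumpLaw f)) σ θ x =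
      1 / (σ * θ) * crossDensity β (σ * (Δ : ℝ) ^ (1 / β)) θ L f x := by
  have := isProbabilityMeasure_compoundPoisson hL (jumpLaw f)
  rw [dSigma, dTheta, (hasDerivAt_density_sigma hβ hβ2 hσ hΔ _ θ x).deriv,
    (hf.hasDerivAt_density_theta hβ hσ hΔ hθ hL x).deriv, density_eq_mixDensity, crossDensity,
    ← one_div_mul_one_div]
  ring

lemma infoTT_integrand_eq (hf : IsJumpDensity f) [IsProbabilityMeasure (jumpLaw f)] (hβ : 0 < β)
    (hσ : 0 < σ) (hΔ : 0 < Δ) (hθ : θ ≠ 0) {L : ℝ} (hL : 0 ≤ L) (x : ℝ) :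
    dTheta β Δ (compoundPoisson L (jumpLaw f)) σ θ x ^ 2 /
      density β Δ (compoundPoisson L (jumpLaw f)) σ θ x =
      1 / θ ^ 2 * jumpDensity β (σ * (Δ : ℝ) ^ (1 / β)) θ L f x := by
  rw [dTheta, (hf.hasDerivAt_density_theta hβ hσ hΔ hθ hL x).deriv, density_eq_mixDensity,
    jumpDensity]
  ring

lemma hasFisherInfo (hf : IsJumpDensity f) [IsProbabilityMeasure (jumpLaw f)] (hβ : 0 < β)
    (hβ2 : β ≤ 2) (hσ : 0 < σ) (hΔ : 0 < Δ) (hθ : θ ≠ 0) {L : ℝ} (hL : 0 ≤ L)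
    (hpos : ∀ w, 0 < stableDensity β w) :
    HasFisherInfo β Δ (compoundPoisson L (jumpLaw f)) σ θ := by
  have := isProbabilityMeasure_compoundPoisson hL (jumpLaw f)
  have hs : 0 < σ * (Δ : ℝ) ^ (1 / β) := by positivity
  refine ⟨fun x => ?_, fun x => (hasDerivAt_density_sigma hβ hβ2 hσ hΔ _ θ x).differentiableAt,
    fun x => (hf.hasDerivAt_density_theta hβ hσ hΔ hθ hL x).differentiableAt, ?_, ?_, ?_⟩
  · rw [density_eq_mixDensity]; exact mixDensity_pos hβ hpos hs θ _ x
  · simp_rw [infoSS_integrand_eq hβ hβ2 hσ hΔ hL]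
    exact (integrable_scaleDensity hβ hβ2 hpos hs θ hL _).const_mul _
  · simp_rw [hf.infoST_integrand_eq hβ hβ2 hσ hΔ hθ hL]
    exact (hf.integrable_crossDensity hβ hβ2 hpos hs θ hL).const_mul _
  · simp_rw [hf.infoTT_integrand_eq hβ hσ hΔ hθ hL]
    exact (hf.integrable_jumpDensity hβ hβ2 hpos hs θ hL).const_mul _

end IsJumpDensity

/-! ### Small times -/

lemma eventually_pos_nhdsGT : ∀ᶠ Δ : ℝ≥0 in 𝓝[>] 0, 0 < Δ := self_mem_nhdsWithin

lemma tendsto_coe_nhdsGT : Tendsto (fun Δ : ℝ≥0 => (Δ : ℝ)) (𝓝[>] 0) (𝓝 0) :=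
  (NNReal.continuous_coe.tendsto' 0 0 NNReal.coe_zero).mono_left nhdsWithin_le_nhds

lemma eventually_scale_pos (hσ : 0 < σ) (β : ℝ) :
    ∀ᶠ Δ : ℝ≥0 in 𝓝[>] 0, 0 < σ * (Δ : ℝ) ^ (1 / β) := by
  filter_upwards [eventually_pos_nhdsGT] with Δ hΔ
  positivity

lemma tendsto_scale (hβ : 0 < β) (σ : ℝ) :
    Tendsto (fun Δ : ℝ≥0 => σ * (Δ : ℝ) ^ (1 / β)) (𝓝[>] 0) (𝓝 0) := by
  have h := (tendsto_coe_nhdsGT.rpow_const (Or.inr (by positivity : 0 ≤ 1 / β))).const_mul σ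
  rwa [Real.zero_rpow (by positivity), mul_zero] at h

lemma eventually_mean_pos (hlam : 0 < lam) : ∀ᶠ Δ : ℝ≥0 in 𝓝[>] 0, 0 < lam * (Δ : ℝ) := by
  filter_upwards [eventually_pos_nhdsGT] with Δ hΔ
  positivity

lemma tendsto_mean (lam : ℝ) : Tendsto (fun Δ : ℝ≥0 => lam * (Δ : ℝ)) (𝓝[>] 0) (𝓝 0) := by
  simpa using tendsto_coe_nhdsGT.const_mul lam

lemma tendsto_infoSS (hβ : 0 < β) (hβ2 : β ≤ 2) (hσ : 0 < σ) (hlam : 0 < lam)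
    (hpos : ∀ w, 0 < stableDensity β w) (μ : Measure ℝ) [IsProbabilityMeasure μ] (θ : ℝ) :
    Tendsto (fun Δ : ℝ≥0 => infoSS β Δ (compoundPoisson (lam * Δ) μ) σ θ) (𝓝[>] 0)
      (𝓝 (1 / σ ^ 2 * scaleInfo β)) := by
  have h := (ENNReal.tendsto_toReal ENNReal.ofReal_ne_top).comp
    (tendsto_lintegral_scaleDensity hβ hβ2 hpos (eventually_scale_pos hσ β)
    (eventually_mean_pos hlam) (tendsto_mean lam) θ μ)
  rw [ENNReal.toReal_ofReal (scaleInfo_nonneg hpos)] at h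
  refine (h.const_mul (1 / σ ^ 2)).congr' ?_
  filter_upwards [eventually_pos_nhdsGT, eventually_scale_pos hσ β, eventually_mean_pos hlam]
    with Δ hΔ hs hL
  have := isProbabilityMeasure_compoundPoisson hL.le μ
  simp_rw [infoSS, infoSS_integrand_eq hβ hβ2 hσ hΔ hL.le]
  rw [integral_const_mul, integral_eq_lintegral_of_nonneg_ae
    (ae_of_all _ (scaleDensity_nonneg hβ hpos hs θ hL.le μ))
    (measurable_scaleDensity hβ _ θ hL.le _).aestronglyMeasurable]
  rfl

lemma tailLimit_nonneg (hβ : 0 < β) (hβ2 : β ≤ 2) : 0 ≤ tailLimit β := by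
  rcases hβ2.eq_or_lt with rfl | h
  · rw [tailLimit_two]
  · exact (tailLimit_pos hβ h).le

namespace IsJumpDensity

lemma tendsto_infoST (hf : IsJumpDensity f) [IsProbabilityMeasure (jumpLaw f)] (hβ : 0 < β) (hβ2 : β ≤ 2)
    (hσ : 0 < σ) (hθ : θ ≠ 0) (hlam : 0 < lam) (hpos : ∀ w, 0 < stableDensity β w) :
    Tendsto (fun Δ : ℝ≥0 => 1 / √(Δ : ℝ) *
      infoST β Δ (compoundPoisson (lam * Δ) (jumpLaw f)) σ θ) (𝓝[>] 0) (𝓝 0) := by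
  rw [Metric.tendsto_nhds]
  intro ε hε
  have hsl : 0 < √lam := Real.sqrt_pos.2 hlam
  have hσθ : 0 < |σ * θ| := abs_pos.2 (mul_ne_zero hσ.ne' hθ)
  have hε' : 0 < ε / 2 * |σ * θ| / √lam := by positivity
  filter_upwards [eventually_pos_nhdsGT, eventually_mean_pos hlam,
    eventually_abs_cross_le hβ hβ2 hpos (eventually_scale_pos hσ β)
      (eventually_mean_pos hlam) (tendsto_mean lam) θ hf hε'] with Δ hΔ hL h
  have hsΔ : 0 < √(Δ : ℝ) := Real.sqrt_pos.2 (by positivity)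
  have e : infoST β Δ (compoundPoisson (lam * Δ) (jumpLaw f)) σ θ =
      1 / (σ * θ) * ∫ x, crossDensity β (σ * (Δ : ℝ) ^ (1 / β)) θ (lam * Δ) f x := by
    simp_rw [infoST, hf.infoST_integrand_eq hβ hβ2 hσ hΔ hθ hL.le]
    rw [integral_const_mul]
  change |∫ x, crossDensity β (σ * (Δ : ℝ) ^ (1 / β)) θ (lam * Δ) f x| ≤ _ at h
  rw [Real.sqrt_mul hlam.le] at h
  rw [Real.dist_eq, sub_zero, e, abs_mul, abs_mul, abs_of_pos (by positivity : 0 < 1 / √(Δ : ℝ)),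
    abs_div, abs_one]
  calc 1 / √(Δ : ℝ) * (1 / |σ * θ| *
        |∫ x, crossDensity β (σ * (Δ : ℝ) ^ (1 / β)) θ (lam * Δ) f x|)
      ≤ 1 / √(Δ : ℝ) * (1 / |σ * θ| * (ε / 2 * |σ * θ| / √lam * (√lam * √(Δ : ℝ)))) := by gcongr
    _ = ε / 2 := by field_simp
    _ < ε := by linarith

lemma infoTT_div_eq (hf : IsJumpDensity f) [IsProbabilityMeasure (jumpLaw f)] (hβ : 0 < β)
    (hσ : 0 < σ) (hθ : θ ≠ 0) (hlam : 0 < lam)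
    (hΔ : 0 < Δ) :
    1 / (Δ : ℝ) * infoTT β Δ (compoundPoisson (lam * Δ) (jumpLaw f)) σ θ =
      lam / θ ^ 2 * ∫ x, jumpDensity β (σ * (Δ : ℝ) ^ (1 / β)) θ (lam * Δ) f x / (lam * Δ) := by
  have hΔ' : 0 < (Δ : ℝ) := by positivity
  simp_rw [infoTT, hf.infoTT_integrand_eq hβ hσ hΔ hθ (by positivity : 0 ≤ lam * (Δ : ℝ))]
  rw [integral_const_mul, integral_div]
  field_simp

lemma eventually_infoTT_lt (hf : IsJumpDensity f) [IsProbabilityMeasure (jumpLaw f)] (hβ : 0 < β) (hβ2 : β ≤ 2)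
    (hσ : 0 < σ) (hθ : θ ≠ 0) (hlam : 0 < lam) (hpos : ∀ w, 0 < stableDensity β w)
    {z : ℝ} (hz : lam / θ ^ 2 * multInfo f < z) :
    ∀ᶠ Δ : ℝ≥0 in 𝓝[>] 0,
      1 / (Δ : ℝ) * infoTT β Δ (compoundPoisson (lam * Δ) (jumpLaw f)) σ θ < z := by
  have h1 : Tendsto (fun Δ : ℝ≥0 => lam / θ ^ 2 * ((1 + lam * Δ) * multInfo f)) (𝓝[>] 0)
      (𝓝 (lam / θ ^ 2 * ((1 + 0) * multInfo f))) :=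
    (((tendsto_mean lam).const_add 1).mul_const _).const_mul _
  rw [add_zero, one_mul] at h1
  filter_upwards [eventually_pos_nhdsGT, eventually_scale_pos hσ β, eventually_mean_pos hlam,
    h1.eventually (gt_mem_nhds hz)] with Δ hΔ hs hL h
  rw [hf.infoTT_div_eq hβ hσ hθ hlam hΔ]
  refine lt_of_le_of_lt ?_ h
  gcongr
  rw [integral_div, div_le_iff₀ hL]
  refine (hf.integral_jumpDensity_le hβ hβ2 hpos hs θ hL.le).trans_eq ?_
  ring

/-- The denominator is at least `f`; where `f` vanishes, the numerator vanishes too. -/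
lemma integrable_lowerBound (hf : IsJumpDensity f) (hβ : 0 < β) (hβ2 : β ≤ 2) (θ : ℝ) {κ : ℝ} (hκ : 0 ≤ κ) :
    Integrable fun z => multScore f z ^ 2 /
      (f z + tailLimit β * κ / (|θ| ^ β * |z| ^ (1 + β))) := by
  have hc := tailLimit_nonneg hβ hβ2
  have h1 := hf.measurable_multScore
  have h2 := hf.differentiable.continuous.measurable
  refine hf.integrable_multIntegrand.mono' (by
    apply Measurable.aestronglyMeasurable; fun_prop) (ae_of_all _ fun z => ?_)
  have h3 := hf.nonneg z
  have h4 : 0 ≤ tailLimit β * κ / (|θ| ^ β * |z| ^ (1 + β)) := by positivity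
  rw [Real.norm_of_nonneg (by positivity), multIntegrand_eq]
  rcases h3.eq_or_lt with h0 | h0
  · simp [hf.multScore_eq_zero h0.symm]
  · gcongr
    linarith

lemma eventually_lt_infoTT (hf : IsJumpDensity f) [IsProbabilityMeasure (jumpLaw f)] (hβ : 0 < β) (hβ2 : β ≤ 2)
    (hσ : 0 < σ) (hθ : θ ≠ 0) (hlam : 0 < lam) (hpos : ∀ w, 0 < stableDensity β w)
    {z : ℝ}
    (hz : z < lam / θ ^ 2 * ∫ z, multScore f z ^ 2 /
      (f z + tailLimit β * (σ ^ β / lam) / (|θ| ^ β * |z| ^ (1 + β)))) :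
    ∀ᶠ Δ : ℝ≥0 in 𝓝[>] 0,
      z < 1 / (Δ : ℝ) * infoTT β Δ (compoundPoisson (lam * Δ) (jumpLaw f)) σ θ := by
  have hc := tailLimit_nonneg hβ hβ2
  have hκ0 : 0 ≤ σ ^ β / lam := by positivity
  have hfac : 0 < lam / θ ^ 2 := by positivity
  have hnn : ∀ z, 0 ≤ multScore f z ^ 2 /
      (f z + tailLimit β * (σ ^ β / lam) / (|θ| ^ β * |z| ^ (1 + β))) := fun z => by
    have := hf.nonneg z
    positivity
  have hκ : Tendsto (fun Δ : ℝ≥0 => (σ * (Δ : ℝ) ^ (1 / β)) ^ β / (lam * Δ)) (𝓝[>] 0)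
      (𝓝 (σ ^ β / lam)) := by
    refine tendsto_const_nhds.congr' ?_
    filter_upwards [eventually_pos_nhdsGT] with Δ hΔ
    have hΔ' : (Δ : ℝ) ≠ 0 := by positivity
    rw [rpow_scale hβ hσ.le, mul_div_mul_right _ _ hΔ']
  rw [← div_lt_iff₀' hfac] at hz
  -- negative levels are treated apart, because `ENNReal.ofReal` does not see them
  rcases lt_or_ge z 0 with hz0 | hz0
  · filter_upwards [eventually_pos_nhdsGT, eventually_scale_pos hσ β, eventually_mean_pos hlam]
      with Δ hΔ hs hL
    rw [hf.infoTT_div_eq hβ hσ hθ hlam hΔ]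
    refine hz0.trans_le (mul_nonneg hfac.le (integral_nonneg fun x =>
      div_nonneg (jumpDensity_nonneg hβ hpos hs θ hL.le x) hL.le))
  · have hzf : 0 ≤ z / (lam / θ ^ 2) := by positivity
    have hz2 := (ENNReal.ofReal_lt_ofReal_iff_of_nonneg hzf).2 hz
    rw [ofReal_integral_eq_lintegral_ofReal
      (hf.integrable_lowerBound hβ hβ2 θ hκ0) (ae_of_all _ hnn)] at hz2
    filter_upwards [eventually_pos_nhdsGT, eventually_scale_pos hσ β, eventually_mean_pos hlam,
      hf.eventually_lt_lintegral_jumpScoreMix hβ hβ2 hpos (eventually_scale_pos hσ β)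
        (tendsto_scale hβ σ) (eventually_mean_pos hlam) (tendsto_mean lam) hκ hθ hz2]
      with Δ hΔ hs hL h
    rw [hf.infoTT_div_eq hβ hσ hθ hlam hΔ, ← div_lt_iff₀' hfac]
    rw [← ENNReal.ofReal_lt_ofReal_iff_of_nonneg hzf, ofReal_integral_eq_lintegral_ofReal
      ((hf.integrable_jumpDensity hβ hβ2 hpos hs θ hL.le).div_const _) (ae_of_all _ fun x =>
      div_nonneg (jumpDensity_nonneg hβ hpos hs θ hL.le x) hL.le)]
    exact h

end IsJumpDensity

lemma lowerIntegrand_eq (hβ : 0 < β) (hβ2 : β < 2) (hlam : 0 < lam) (σ θ : ℝ) (f : ℝ → ℝ) (x : ℝ) :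
    lowerIntegrand β σ θ lam f x = 1 / lam * (multScore f x ^ 2 /
      (f x + tailLimit β * (σ ^ β / lam) / (|θ| ^ β * |x| ^ (1 + β)))) := by
  rw [lowerIntegrand, tailConst_eq_tailLimit hβ hβ2, multScore, div_mul_div_comm, one_mul, mul_add]
  congr 2
  field_simp

end

end LevyFisher

end

theorem theorem6 {Ω : Type*} [MeasurableSpace Ω] (P : Measure Ω) [IsProbabilityMeasure P]
    (W Y : ℝ≥0 → Ω → ℝ) (β σ θ lam : ℝ) (hβ : 0 < β) (hβ2 : β ≤ 2) (hσ : 0 < σ) (hθ : θ ≠ 0)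
    (hlam : 0 < lam)
    (μ : Measure ℝ) [IsProbabilityMeasure μ] (f : ℝ → ℝ) (hf0 : ∀ u, 0 ≤ f u)
    (hμ : μ = volume.withDensity (fun u => ENNReal.ofReal (f u)))
    (hfd : Differentiable ℝ f)
    (hf_lim : Tendsto (fun u => u * f u) (cocompact ℝ) (𝓝 0))
    (hf_bdd : BddAbove (Set.range (fun u => |deriv f u| * (1 + |u|))))
    (hL : Integrable (LevyFisher.multIntegrand f))
    (hW : LevyFisher.IsStdStableProcess P β W)
    (hY : LevyFisher.IsCompoundPoisson P lam μ Y)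
    (hWY : IndepFun (fun ω t => W t ω) (fun ω t => Y t ω) P) :
    -- the density and the information quantities are well defined
    (∀ Δ : ℝ≥0, 0 < Δ → ∀ s r : ℝ, 0 < s →
      P.map (fun ω => s * W Δ ω + r * Y Δ ω) =
        volume.withDensity
          (fun x => ENNReal.ofReal (LevyFisher.density β Δ (P.map (Y Δ)) s r x))) ∧
    (∀ Δ : ℝ≥0, 0 < Δ → LevyFisher.HasFisherInfo β Δ (P.map (Y Δ)) σ θ) ∧
    Integrable (LevyFisher.scaleIntegrand β) ∧
    -- the entries `σσ` and `σθ`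
    Tendsto (fun Δ : ℝ≥0 => LevyFisher.infoSS β Δ (P.map (Y Δ)) σ θ) (𝓝[>] 0)
      (𝓝 (1 / σ ^ 2 * LevyFisher.scaleInfo β)) ∧
    Tendsto (fun Δ : ℝ≥0 => 1 / √(Δ : ℝ) * LevyFisher.infoST β Δ (P.map (Y Δ)) σ θ) (𝓝[>] 0)
      (𝓝 0) ∧
    -- the entry `θθ`
    (β < 2 →
      Integrable (LevyFisher.lowerIntegrand β σ θ lam f) ∧
      ((lam ^ 2 / θ ^ 2 * ∫ x, LevyFisher.lowerIntegrand β σ θ lam f x : ℝ) : EReal) ≤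
        liminf (fun Δ : ℝ≥0 =>
          ((1 / (Δ : ℝ) * LevyFisher.infoTT β Δ (P.map (Y Δ)) σ θ : ℝ) : EReal)) (𝓝[>] 0) ∧
      liminf (fun Δ : ℝ≥0 =>
          ((1 / (Δ : ℝ) * LevyFisher.infoTT β Δ (P.map (Y Δ)) σ θ : ℝ) : EReal)) (𝓝[>] 0) ≤
        limsup (fun Δ : ℝ≥0 =>
          ((1 / (Δ : ℝ) * LevyFisher.infoTT β Δ (P.map (Y Δ)) σ θ : ℝ) : EReal)) (𝓝[>] 0) ∧
      limsup (fun Δ : ℝ≥0 =>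
          ((1 / (Δ : ℝ) * LevyFisher.infoTT β Δ (P.map (Y Δ)) σ θ : ℝ) : EReal)) (𝓝[>] 0) ≤
        ((lam / θ ^ 2 * LevyFisher.multInfo f : ℝ) : EReal)) ∧
    (β = 2 →
      Tendsto (fun Δ : ℝ≥0 => 1 / (Δ : ℝ) * LevyFisher.infoTT β Δ (P.map (Y Δ)) σ θ) (𝓝[>] 0)
        (𝓝 (lam / θ ^ 2 * LevyFisher.multInfo f))) := by
  subst hμ
  change IsProbabilityMeasure (LevyFisher.jumpLaw f) at *
  change LevyFisher.IsCompoundPoisson P lam (LevyFisher.jumpLaw f) Y at hY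
  have hf := LevyFisher.isJumpDensity_of_withDensity hf0 hfd hf_lim hL
  have hpos := hW.stableDensity_pos hβ hβ2
  have hG := fun Δ => hY.map_eq hlam.le Δ
  have hlo : ∀ z : ℝ, z < lam / θ ^ 2 * ∫ z, LevyFisher.multScore f z ^ 2 /
      (f z + LevyFisher.tailLimit β * (σ ^ β / lam) / (|θ| ^ β * |z| ^ (1 + β))) → _ :=
    fun z hz => hf.eventually_lt_infoTT hβ hβ2 hσ hθ hlam hpos hz
  have hup := fun z : ℝ => hf.eventually_infoTT_lt hβ hβ2 hσ hθ hlam hpos (z := z)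
  refine ⟨fun Δ hΔ s r hs => LevyFisher.map_add_eq_withDensity hW hβ hβ2 hY.measurable hWY hΔ hs r,
    fun Δ hΔ => ?_, LevyFisher.integrable_scaleIntegrand hβ hβ2 hpos, ?_, ?_, fun hβlt => ?_,
    fun hβeq => ?_⟩
  · rw [hG]
    exact hf.hasFisherInfo hβ hβ2 hσ hΔ hθ (by positivity) hpos
  · simp_rw [hG]
    exact LevyFisher.tendsto_infoSS hβ hβ2 hσ hlam hpos _ θ
  · simp_rw [hG]
    exact hf.tendsto_infoST hβ hβ2 hσ hθ hlam hpos
  · simp_rw [hG]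
    have e := LevyFisher.lowerIntegrand_eq hβ hβlt hlam σ θ f
    have hi := hf.integrable_lowerBound hβ hβ2 θ (κ := σ ^ β / lam) (by positivity)
    refine ⟨?_, ?_, liminf_le_limsup, ?_⟩
    · rw [funext e]; exact hi.const_mul _
    · rw [← EReal.ge_of_forall_gt_iff_ge]
      intro z hz
      rw [EReal.coe_lt_coe_iff] at hz
      refine le_liminf_of_le (by isBoundedDefault) ((hlo z ?_).mono fun Δ h =>
        EReal.coe_le_coe_iff.2 h.le)
      simp_rw [e] at hz
      rw [integral_const_mul, ← mul_assoc] at hz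
      refine hz.trans_eq ?_
      congr 1
      field_simp
    · rw [← EReal.le_of_forall_lt_iff_le]
      intro z hz
      rw [EReal.coe_lt_coe_iff] at hz
      exact limsup_le_of_le (by isBoundedDefault) ((hup z hz).mono fun Δ h =>
        EReal.coe_le_coe_iff.2 h.le)
  · simp_rw [hG]
    subst hβeq
    refine tendsto_order.2 ⟨fun z hz => hlo z ?_, hup⟩
    simp only [LevyFisher.tailLimit_two, zero_mul, zero_div, add_zero]
    exact hz
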